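/- Let $\frac{10}{3}<p<6$ and $\lambda>0$. All functions are real valued. For $u\in H^1(\mathbb R^3)$ put $$B(u)=\int_{\mathbb R^3}\int_{\mathbb R^3}\frac{|u(x)|^2|u(y)|^2}{|x-y|}\,dx\,dy,\qquad I_\lambda(u)=\frac12\int_{\mathbb R^3}|\nabla u|^2dx+\frac14B(u)-\frac1p\int_{\mathbb R^3}|u|^p\,dx+\frac{\lambda}{2}\int_{\mathbb R^3}u^2dx,$$ and, for a potential $V:\mathbb R^3\to\mathbb R$, $J_{V,\lambda}(u)=I_\lambda(u)+\frac12\int_{\mathbb R^3}V(x)u^2\,dx$. Let $$S=\inf\Big\{\tfrac{\|\nabla u\|_2^2}{\|u\|_6^2}:\ u\in L^6(\mathbb R^3)\setminus\{0\},\ \nabla u\in L^2(\mathbb R^3)\Big\}.$$ **Splitting Lemma.** Let $V\in L^{\bar q}(\mathbb R^3)$ for some $\bar q\in[\frac32,\infty]$, with $V^-:=-\min\{V,0\}\in L^{3/2}(\mathbb R^3)$, $\|V^-\|_{3/2}<S$ and $\lim_{|x|\to\infty}V(x)=0$ (up to null sets). Let $(u_n)\subset H^1(\mathbb R^3)$ be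 a bounded Palais–Smale sequence for $J_{V,\lambda}$ (that is, $J_{V,\lambda}(u_n)$ is bounded and $J_{V,\lambda}'(u_n)\to0$ in $H^{-1}(\mathbb R^3)$) with $u_n\rightharpoonup u$ weakly in $H^1(\mathbb R^3)$. Then, after passing to a subsequence of $(u_n)$, there exist an integer $k\ge0$, $k$ nontrivial weak solutions $w^1,\dots,w^k\in H^1(\mathbb R^3)$ of the limit equation $$-\Delta w+\lambda w+(|x|^{-1}*|w|^2)w=|w|^{p-2}w\quad\text{in }\mathbb R^3,$$ and $k$ sequences $(y_n^j)_n\subset\mathbb R^3$, $1\le j\le k$, such that $|y_n^j|\to\infty$ as $n\to\infty$ for each $j$ and $$u_n=u+\sum_{j=1}^kw^j(\cdot-y_n^j)+o(1)\quad\text{strongly in }H^1(\mathbb R^3),$$ $$\|u_n\|_2^2=\|u\|_2^2+\sum_{j=1}^k\|w^j\|_2^2+o(1),\qquad J_{V,\lambda}(u_n)=J_{V,\lambda}(u)+\sum_{j=1}^kI_\lambda(w^j)+o(1).$$ -/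

import Mathlib

open MeasureTheory Filter Topology
open scoped ENNReal ContDiff

noncomputable section

namespace SchrodingerPoisson

/-- The Euclidean space `ℝ³`. -/
abbrev R3 : Type := EuclideanSpace ℝ (Fin 3)

/-- `g` is the weak (distributional) gradient of `u` on `ℝ³`:
`∫ u ∂_v φ = - ∫ ⟨g, v⟩ φ` for every test function `φ ∈ C_c^∞(ℝ³)` and every direction `v`. -/
def IsWeakGradient (u : R3 → ℝ) (g : R3 → R3) : Prop :=
  ∀ φ : R3 → ℝ, ContDiff ℝ ∞ φ → HasCompactSupport φ → ∀ v : R3,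
    ∫ x, u x * fderiv ℝ φ x v = - ∫ x, inner ℝ (g x) v * φ x

lemma memLp_test {φ : R3 → ℝ} (hφ : ContDiff ℝ ∞ φ) (hc : HasCompactSupport φ) :
    MemLp φ 2 (volume : Measure R3) :=
  hφ.continuous.memLp_of_hasCompactSupport hc

lemma memLp_test_fderiv {φ : R3 → ℝ} (hφ : ContDiff ℝ ∞ φ) (hc : HasCompactSupport φ) (v : R3) :
    MemLp (fun x => fderiv ℝ φ x v) 2 (volume : Measure R3) := by
  have h1 : Continuous (fun x => fderiv ℝ φ x v) :=
    (hφ.continuous_fderiv (by simp)).clm_apply continuous_const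
  refine h1.memLp_of_hasCompactSupport ?_
  exact hc.fderiv_apply (𝕜 := ℝ) v

/-- The Sobolev space `H¹(ℝ³)` of real functions, realised as the space of pairs `(u, ∇u)` in
`L²(ℝ³) × L²(ℝ³; ℝ³)`, where `∇u` is the weak gradient of `u`. The inherited norm is
`(‖u‖₂² + ‖∇u‖₂²)^{1/2}`. -/
def h1Submodule :
    Submodule ℝ (WithLp 2 (Lp ℝ 2 (volume : Measure R3) × Lp R3 2 (volume : Measure R3)))
    where
  carrier := {f | IsWeakGradient f.fst f.snd}
  zero_mem' := by
    intro φ _ _ v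
    have h1 : (fun x => ((0 : Lp ℝ 2 (volume : Measure R3)) : R3 → ℝ) x * fderiv ℝ φ x v)
        =ᵐ[volume] fun _ => 0 := by
      filter_upwards [Lp.coeFn_zero ℝ 2 (volume : Measure R3)] with x _
      simp
    have h2 : (fun x => inner ℝ (((0 : Lp R3 2 (volume : Measure R3)) : R3 → R3) x) v * φ x)
        =ᵐ[volume] fun _ => 0 := by
      filter_upwards [Lp.coeFn_zero R3 2 (volume : Measure R3)] with x _
      simp
    change ∫ x, ((0 : Lp ℝ 2 (volume : Measure R3)) : R3 → ℝ) x * fderiv ℝ φ x v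
      = - ∫ x, inner ℝ (((0 : Lp R3 2 (volume : Measure R3)) : R3 → R3) x) v * φ x
    rw [integral_congr_ae h1, integral_congr_ae h2]
    simp
  add_mem' := by
    intro f g hf hg φ hφ hc v
    have I1 : ∀ w : Lp ℝ 2 (volume : Measure R3),
        Integrable (fun x => w x * fderiv ℝ φ x v) volume := fun w =>
      (Lp.memLp w).integrable_mul (memLp_test_fderiv hφ hc v)
    have I2 : ∀ w : Lp R3 2 (volume : Measure R3),
        Integrable (fun x => inner ℝ (w x) v * φ x) volume := fun w =>
      ((Lp.memLp w).inner_const v).integrable_mul (memLp_test hφ hc)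
    have h1 : (fun x => (f + g).fst x * fderiv ℝ φ x v)
        =ᵐ[volume] fun x => f.fst x * fderiv ℝ φ x v + g.fst x * fderiv ℝ φ x v := by
      filter_upwards [Lp.coeFn_add f.fst g.fst] with x hx
      simp only [WithLp.add_fst, hx, Pi.add_apply]
      ring
    have h2 : (fun x => inner ℝ ((f + g).snd x) v * φ x)
        =ᵐ[volume] fun x => inner ℝ (f.snd x) v * φ x + inner ℝ (g.snd x) v * φ x := by
      filter_upwards [Lp.coeFn_add f.snd g.snd] with x hx
      simp only [WithLp.add_snd, hx, Pi.add_apply, inner_add_left]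
      ring
    rw [integral_congr_ae h1, integral_congr_ae h2, integral_add (I1 _) (I1 _),
      integral_add (I2 _) (I2 _), hf φ hφ hc v, hg φ hφ hc v]
    ring
  smul_mem' := by
    intro c f hf φ hφ hc v
    have h1 : (fun x => (c • f).fst x * fderiv ℝ φ x v)
        =ᵐ[volume] fun x => c * (f.fst x * fderiv ℝ φ x v) := by
      filter_upwards [Lp.coeFn_smul c f.fst] with x hx
      simp only [WithLp.smul_fst, hx, Pi.smul_apply, smul_eq_mul]
      ring
    have h2 : (fun x => inner ℝ ((c • f).snd x) v * φ x)
        =ᵐ[volume] fun x => c * (inner ℝ (f.snd x) v * φ x) := by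
      filter_upwards [Lp.coeFn_smul c f.snd] with x hx
      simp only [WithLp.smul_snd, hx, Pi.smul_apply, real_inner_smul_left]
      ring
    rw [integral_congr_ae h1, integral_congr_ae h2, integral_const_mul, integral_const_mul,
      hf φ hφ hc v]
    ring

/-- The Hilbert space `H¹(ℝ³)`. -/
abbrev H1 : Type := h1Submodule

namespace H1

/-- The function underlying an element of `H¹(ℝ³)`. -/
def fn (u : H1) : R3 → ℝ := u.1.fst

/-- The weak gradient of an element of `H¹(ℝ³)`. -/
def grad (u : H1) : R3 → R3 := u.1.snd

end H1

lemma measurePreserving_sub (y : R3) :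
    MeasurePreserving (fun x : R3 => x - y) volume volume :=
  measurePreserving_sub_right volume y

/-- The translate `w(· - y)` of `w ∈ H¹(ℝ³)`, again an element of `H¹(ℝ³)`. -/
def translate (y : R3) (w : H1) : H1 :=
  ⟨WithLp.toLp 2
    (Lp.compMeasurePreserving (fun x : R3 => x - y) (measurePreserving_sub y) w.1.fst,
     Lp.compMeasurePreserving (fun x : R3 => x - y) (measurePreserving_sub y) w.1.snd), by
    intro φ hφ hc v
    have h1 : (fun x => (Lp.compMeasurePreserving (fun x : R3 => x - y)
          (measurePreserving_sub y) w.1.fst : R3 → ℝ) x * fderiv ℝ φ x v)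
        =ᵐ[volume] fun x => w.1.fst (x - y) * fderiv ℝ φ x v := by
      filter_upwards [Lp.coeFn_compMeasurePreserving w.1.fst (measurePreserving_sub y)] with x hx
      rw [hx]; rfl
    have h2 : (fun x => inner ℝ ((Lp.compMeasurePreserving (fun x : R3 => x - y)
          (measurePreserving_sub y) w.1.snd : R3 → R3) x) v * φ x)
        =ᵐ[volume] fun x => inner ℝ (w.1.snd (x - y)) v * φ x := by
      filter_upwards [Lp.coeFn_compMeasurePreserving w.1.snd (measurePreserving_sub y)] with x hx
      rw [hx]; rfl
    have hψ : ContDiff ℝ ∞ (fun x => φ (x + y)) := hφ.comp (contDiff_id.add contDiff_const)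
    have hψc : HasCompactSupport (fun x => φ (x + y)) :=
      hc.comp_homeomorph (Homeomorph.addRight y)
    have key := w.2 (fun x => φ (x + y)) hψ hψc v
    simp only [fderiv_comp_add_right] at key
    have e1 := integral_sub_right_eq_self (μ := (volume : Measure R3))
      (fun x => w.1.fst x * fderiv ℝ φ (x + y) v) y
    have e2 := integral_sub_right_eq_self (μ := (volume : Measure R3))
      (fun x => inner ℝ (w.1.snd x) v * φ (x + y)) y
    simp only [sub_add_cancel] at e1 e2
    change ∫ x, (Lp.compMeasurePreserving (fun x : R3 => x - y)
          (measurePreserving_sub y) w.1.fst : R3 → ℝ) x * fderiv ℝ φ x v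
      = - ∫ x, inner ℝ ((Lp.compMeasurePreserving (fun x : R3 => x - y)
          (measurePreserving_sub y) w.1.snd : R3 → R3) x) v * φ x
    rw [integral_congr_ae h1, integral_congr_ae h2, e1, e2, key]⟩

/-- The Aubin–Talenti constant `S = inf ‖∇u‖₂² / ‖u‖₆²`, the infimum being over all nonzero `u`
in `D^{1,2}(ℝ³) = {u ∈ L⁶(ℝ³) : ∇u ∈ L²(ℝ³)}`. -/
def sobolevS : ℝ :=
  sInf {r : ℝ | ∃ (u : R3 → ℝ) (g : R3 → R3), MemLp u 6 volume ∧ MemLp g 2 volume ∧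
    IsWeakGradient u g ∧ ¬ (u =ᵐ[volume] 0) ∧
    r = (eLpNorm g 2 volume).toReal ^ 2 / (eLpNorm u 6 volume).toReal ^ 2}

/-- The negative part `V⁻ = - min {V, 0}`. -/
def negPart (V : R3 → ℝ) : R3 → ℝ := fun x => - min (V x) 0

/-- `lim_{|x| → ∞} V(x) = 0` for a potential `V` that is determined up to null sets: for every
`ε > 0` there is `R` with `|V(x)| < ε` for almost every `x` with `|x| ≥ R`. -/
def VanishesAtInfinity (V : R3 → ℝ) : Prop :=
  ∀ ε > 0, ∃ R : ℝ, ∀ᵐ x ∂(volume : Measure R3), R ≤ ‖x‖ → |V x| < ε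

/-- The Coulomb potential `φ_u = |x|⁻¹ ∗ |u|²`. -/
def coulomb (u : H1) (x : R3) : ℝ := ∫ y, |u.fn y| ^ 2 / ‖x - y‖

/-- `B(u) = ∫∫ |u(x)|² |u(y)|² / |x - y| dx dy`. -/
def coulombEnergy (u : H1) : ℝ :=
  ∫ x, ∫ y, |u.fn x| ^ 2 * |u.fn y| ^ 2 / ‖x - y‖

/-- `I(u) = ½ ∫ |∇u|² + ¼ B(u) - (1/p) ∫ |u|^p`. -/
def energyI (p : ℝ) (u : H1) : ℝ :=
  1 / 2 * (∫ x, ‖u.grad x‖ ^ 2) + 1 / 4 * coulombEnergy u - 1 / p * (∫ x, |u.fn x| ^ p)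

/-- `J_V(u) = ½ ∫ |∇u|² + ½ ∫ V u² + ¼ B(u) - (1/p) ∫ |u|^p`. -/
def energyJ (V : R3 → ℝ) (p : ℝ) (u : H1) : ℝ :=
  1 / 2 * (∫ x, ‖u.grad x‖ ^ 2) + 1 / 2 * (∫ x, V x * u.fn x ^ 2)
    + 1 / 4 * coulombEnergy u - 1 / p * (∫ x, |u.fn x| ^ p)

/-- `I_λ(u) = I(u) + (λ/2) ∫ u²`. -/
def energyILam (p lam : ℝ) (u : H1) : ℝ := energyI p u + lam / 2 * (∫ x, u.fn x ^ 2)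

/-- `J_{V,λ}(u) = J_V(u) + (λ/2) ∫ u²`. -/
def energyJLam (V : R3 → ℝ) (p lam : ℝ) (u : H1) : ℝ :=
  energyJ V p u + lam / 2 * (∫ x, u.fn x ^ 2)

/-- A Palais–Smale sequence for a functional `J` on `H¹(ℝ³)`: the values `J(u_n)` are bounded and
the Fréchet derivatives `J'(u_n)` tend to `0` in the norm of the dual space. -/
def IsPalaisSmale (J : H1 → ℝ) (u : ℕ → H1) : Prop :=
  (∃ C : ℝ, ∀ n, |J (u n)| ≤ C) ∧
  ∃ D : ℕ → (H1 →L[ℝ] ℝ), (∀ n, HasFDerivAt J (D n) (u n)) ∧ Tendsto D atTop (𝓝 0)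

/-- Weak convergence in `H¹(ℝ³)`. -/
def WeaklyConverges (u : ℕ → H1) (u₀ : H1) : Prop :=
  Tendsto (fun n => toWeakSpace ℝ H1 (u n)) atTop (𝓝 (toWeakSpace ℝ H1 u₀))

/-- `w ∈ H¹(ℝ³)` is a weak solution of `-Δw + λ w + (|x|⁻¹ ∗ |w|²) w = |w|^{p-2} w` in `ℝ³`. -/
def IsLimitSolution (p lam : ℝ) (w : H1) : Prop :=
  ∀ v : H1, (∫ x, inner ℝ (w.grad x) (v.grad x)) + lam * (∫ x, w.fn x * v.fn x)
    + (∫ x, coulomb w x * w.fn x * v.fn x) = ∫ x, |w.fn x| ^ (p - 2) * w.fn x * v.fn x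

end SchrodingerPoisson

end

noncomputable section

namespace SchrodingerPoisson

/-! ### The Hilbert space `H¹(ℝ³)` -/

/-! The proof is a profile decomposition in the style of Struwe and Lions. Regard `u₀` as a profile
with centre `0`, subtract from `u n` the translated profiles found so far, and look at the
remainder. If some sequence of translates of the remainder is not weakly null, a subsequence has a
nonzero weak limit, which is a new profile. Its centre drifts away from all earlier ones, because
the remainder recentred at an earlier centre is weakly null
(`tendsto_norm_atTop_of_weakTo_translate`, `IsProfileSystem.exists_snoc`). Separation from the
centre `0` says that the centres of all profiles other than `u₀` escape to infinity.

Along escaping centres the term with `V` disappears, so each of these profiles solves the limit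
equation (`isLimitSolution_of_weakTo`). A nonzero solution has norm bounded below, since the Coulomb
term is nonnegative and the power is subcritical (`exists_le_norm_sq_of_isLimitSolution`). The
squared norms of the profiles add up to at most the bound for `‖u n‖ ^ 2`, so the extraction stops
after finitely many profiles (`exists_profileSystem`).

When it stops, all translates of the remainder are weakly null, and Lions' lemma sends it to zero in
`L^q` for `2 < q < 6`. Testing the derivative at `u n` with the remainder `r n` removes the
potential, Coulomb, power and cross terms, and leaves `∫ |∇ r n|² + λ ∫ (r n)² → 0`. As `λ > 0`,
this is strong convergence (`tendsto_remainder_of_vanishing`). Mass and energy decouple because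
every ingredient of `I_λ` is translation invariant and asymptotically additive under weakly null
perturbations (`IsSplitting`), while `∫ V u²` is weakly continuous.

Two devices supply the compactness. Mollification at radius `ε` changes an `H¹` function by at most
`ε ‖u‖` in `L²`, and the mollified value at a point is a continuous functional of a translate;
Rellich's and Lions' lemmas follow. The Newtonian potential of an `L¹ ∩ L²` function is bounded by
cutting the kernel into near, middle and far zones, with free parameters tuned to each limit. -/

/-- The pairs in which `h1Submodule` lives. -/
abbrev L2Pair : Type :=
  WithLp 2 (Lp ℝ 2 (volume : Measure R3) × Lp R3 2 (volume : Measure R3))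

instance fact_two_ne_top : Fact ((2 : ℝ≥0∞) ≠ ⊤) := ⟨by simp⟩

instance : SecondCountableTopology L2Pair :=
  have : Fact (1 ≤ (2 : ℝ≥0∞)) := ⟨by norm_num⟩
  have : SecondCountableTopology (Lp ℝ 2 (volume : Measure R3)) := Lp.SecondCountableTopology
  have : SecondCountableTopology (Lp R3 2 (volume : Measure R3)) := Lp.SecondCountableTopology
  (WithLp.homeomorphProd 2 (Lp ℝ 2 (volume : Measure R3))
    (Lp R3 2 (volume : Measure R3))).secondCountableTopology

lemma real_inner_eq_mul' (x y : ℝ) : inner ℝ x y = x * y := by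
  simp [mul_comm]

lemma memLp_test_smul {φ : R3 → ℝ} (hφ : ContDiff ℝ ∞ φ) (hc : HasCompactSupport φ) (v : R3) :
    MemLp (fun x => φ x • v) 2 (volume : Measure R3) :=
  (hφ.continuous.smul continuous_const).memLp_of_hasCompactSupport hc.smul_right

namespace H1

/-- The function underlying an element of `H¹`, as a continuous linear map into `L²`. -/
def fnL : H1 →L[ℝ] Lp ℝ 2 (volume : Measure R3) :=
  (WithLp.fstL 2 ℝ _ _).comp h1Submodule.subtypeL

/-- The weak gradient of an element of `H¹`, as a continuous linear map into `L²`. -/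
def gradL : H1 →L[ℝ] Lp R3 2 (volume : Measure R3) :=
  (WithLp.sndL 2 ℝ _ _).comp h1Submodule.subtypeL

lemma fn_eq (u : H1) : u.fn = fnL u := rfl

lemma grad_eq (u : H1) : u.grad = gradL u := rfl

lemma memLp_fn (u : H1) : MemLp u.fn 2 volume := Lp.memLp _

lemma memLp_grad (u : H1) : MemLp u.grad 2 volume := Lp.memLp _

lemma fn_add (u v : H1) : (u + v).fn =ᵐ[volume] fun x => u.fn x + v.fn x := by
  rw [fn_eq, map_add]; exact Lp.coeFn_add _ _

lemma fn_sub (u v : H1) : (u - v).fn =ᵐ[volume] fun x => u.fn x - v.fn x := by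
  rw [fn_eq, map_sub]; exact Lp.coeFn_sub _ _

lemma fn_smul (c : ℝ) (u : H1) : (c • u).fn =ᵐ[volume] fun x => c * u.fn x := by
  rw [fn_eq, map_smul]; exact Lp.coeFn_smul _ _

lemma grad_add (u v : H1) : (u + v).grad =ᵐ[volume] fun x => u.grad x + v.grad x := by
  rw [grad_eq, map_add]; exact Lp.coeFn_add _ _

lemma grad_smul (c : ℝ) (u : H1) : (c • u).grad =ᵐ[volume] fun x => c • u.grad x := by
  rw [grad_eq, map_smul]; exact Lp.coeFn_smul _ _

lemma inner_fnL (u v : H1) : inner ℝ (fnL u) (fnL v) = ∫ x, u.fn x * v.fn x := by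
  rw [L2.inner_def]
  refine integral_congr_ae (.of_forall fun x => ?_)
  simp only [← fn_eq, real_inner_eq_mul']

lemma inner_gradL (u v : H1) :
    inner ℝ (gradL u) (gradL v) = ∫ x, inner ℝ (u.grad x) (v.grad x) := by
  rw [L2.inner_def]; rfl

lemma inner_eq (u v : H1) : inner ℝ u v = (∫ x, u.fn x * v.fn x)
    + ∫ x, inner ℝ (u.grad x) (v.grad x) := by
  rw [← inner_fnL, ← inner_gradL]; rfl

lemma norm_fnL_sq (u : H1) : ‖fnL u‖ ^ 2 = ∫ x, u.fn x ^ 2 := by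
  rw [← real_inner_self_eq_norm_sq, inner_fnL]; simp only [pow_two]

lemma norm_gradL_sq (u : H1) : ‖gradL u‖ ^ 2 = ∫ x, ‖u.grad x‖ ^ 2 := by
  rw [← real_inner_self_eq_norm_sq, inner_gradL]; simp only [real_inner_self_eq_norm_sq]

lemma norm_sq_eq_add (u : H1) : ‖u‖ ^ 2 = ‖fnL u‖ ^ 2 + ‖gradL u‖ ^ 2 :=
  WithLp.prod_norm_sq_eq_of_L2 _

lemma norm_sq_eq (u : H1) : ‖u‖ ^ 2 = (∫ x, u.fn x ^ 2) + ∫ x, ‖u.grad x‖ ^ 2 := by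
  rw [norm_sq_eq_add, norm_fnL_sq, norm_gradL_sq]

lemma norm_fnL_le (u : H1) : ‖fnL u‖ ≤ ‖u‖ := by
  refine abs_le_of_sq_le_sq' ?_ (norm_nonneg _) |>.2
  rw [norm_sq_eq_add]; nlinarith [sq_nonneg ‖gradL u‖]

lemma norm_gradL_le (u : H1) : ‖gradL u‖ ≤ ‖u‖ := by
  refine abs_le_of_sq_le_sq' ?_ (norm_nonneg _) |>.2
  rw [norm_sq_eq_add]; nlinarith [sq_nonneg ‖fnL u‖]

lemma integrable_mul (u v : H1) : Integrable fun x => u.fn x * v.fn x :=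
  u.memLp_fn.integrable_mul v.memLp_fn

lemma integrable_sq (u : H1) : Integrable fun x => u.fn x ^ 2 := u.memLp_fn.integrable_sq

lemma aestronglyMeasurable_fn (u : H1) : AEStronglyMeasurable u.fn volume := u.memLp_fn.1

lemma integral_sq_le (u : H1) : ∫ x, u.fn x ^ 2 ≤ ‖u‖ ^ 2 := by
  rw [← norm_fnL_sq]; gcongr; exact norm_fnL_le u

/-- For a fixed test function and direction the weak gradient identity equates two `L²` pairings
with fixed elements, hence is a closed condition. Completeness gives Riesz representation on `H1`.
-/
lemma isClosed_h1Submodule : IsClosed (h1Submodule : Set L2Pair) := by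
  have : (h1Submodule : Set L2Pair) = ⋂ (φ : R3 → ℝ) (hφ : ContDiff ℝ ∞ φ)
      (hc : HasCompactSupport φ) (v : R3), {f : L2Pair |
        inner ℝ f.fst ((memLp_test_fderiv hφ hc v).toLp _)
          = - inner ℝ f.snd ((memLp_test_smul hφ hc v).toLp _)} := by
    ext f
    simp only [Set.mem_iInter, Set.mem_ofPred_eq]
    change IsWeakGradient f.fst f.snd ↔ _
    refine forall_congr' fun φ => forall_congr' fun hφ => forall_congr' fun hc =>
      forall_congr' fun v => ?_
    rw [L2.inner_def, L2.inner_def]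
    have h1 : ∫ x, f.fst x * fderiv ℝ φ x v
        = ∫ x, inner ℝ (f.fst x) ((memLp_test_fderiv hφ hc v).toLp _ x) := by
      refine integral_congr_ae ?_
      filter_upwards [(memLp_test_fderiv hφ hc v).coeFn_toLp] with x hx
      rw [hx, real_inner_eq_mul']
    have h2 : ∫ x, inner ℝ (f.snd x) v * φ x
        = ∫ x, inner ℝ (f.snd x) ((memLp_test_smul hφ hc v).toLp _ x) := by
      refine integral_congr_ae ?_
      filter_upwards [(memLp_test_smul hφ hc v).coeFn_toLp] with x hx
      rw [hx, real_inner_smul_right, mul_comm]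
    rw [h1, h2]
  rw [this]
  refine isClosed_iInter fun φ => isClosed_iInter fun hφ => isClosed_iInter fun hc =>
    isClosed_iInter fun v => isClosed_eq ?_ ?_
  · exact (WithLp.continuous_fst _ _ _).inner continuous_const
  · exact ((WithLp.continuous_snd _ _ _).inner continuous_const).neg

instance : CompleteSpace H1 := isClosed_h1Submodule.completeSpace_coe

/-- Separability makes dual balls weak-* sequentially compact, which is how weakly convergent
subsequences are extracted. -/
instance : TopologicalSpace.SeparableSpace H1 := inferInstance

end H1

/-! ### Translations -/

lemma translate_fn (y : R3) (w : H1) : (translate y w).fn =ᵐ[volume] fun x => w.fn (x - y) :=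
  Lp.coeFn_compMeasurePreserving w.1.fst (measurePreserving_sub y)

lemma translate_grad (y : R3) (w : H1) :
    (translate y w).grad =ᵐ[volume] fun x => w.grad (x - y) :=
  Lp.coeFn_compMeasurePreserving w.1.snd (measurePreserving_sub y)

lemma ae_comp_sub {P : R3 → Prop} (y : R3) (h : ∀ᵐ x ∂(volume : Measure R3), P x) :
    ∀ᵐ x ∂(volume : Measure R3), P (x - y) :=
  (measurePreserving_sub y).quasiMeasurePreserving.ae h

lemma H1.ext_fn_grad {u v : H1} (h : u.fn =ᵐ[volume] v.fn) (h' : u.grad =ᵐ[volume] v.grad) :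
    u = v := by
  apply Subtype.ext
  apply WithLp.ofLp_injective
  exact Prod.ext (Lp.ext h) (Lp.ext h')

lemma translate_add (y : R3) (u v : H1) :
    translate y (u + v) = translate y u + translate y v := by
  apply H1.ext_fn_grad
  · filter_upwards [translate_fn y (u + v), translate_fn y u, translate_fn y v,
      H1.fn_add (translate y u) (translate y v), ae_comp_sub y (H1.fn_add u v)]
      with x h1 h2 h3 h4 h5
    rw [h1, h4, h2, h3, h5]
  · filter_upwards [translate_grad y (u + v), translate_grad y u, translate_grad y v,
      H1.grad_add (translate y u) (translate y v), ae_comp_sub y (H1.grad_add u v)]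
      with x h1 h2 h3 h4 h5
    rw [h1, h4, h2, h3, h5]

lemma translate_smul (y : R3) (c : ℝ) (u : H1) :
    translate y (c • u) = c • translate y u := by
  apply H1.ext_fn_grad
  · filter_upwards [translate_fn y (c • u), translate_fn y u,
      H1.fn_smul c (translate y u), ae_comp_sub y (H1.fn_smul c u)] with x h1 h2 h3 h4
    rw [h1, h3, h2, h4]
  · filter_upwards [translate_grad y (c • u), translate_grad y u,
      H1.grad_smul c (translate y u), ae_comp_sub y (H1.grad_smul c u)] with x h1 h2 h3 h4
    rw [h1, h3, h2, h4]

lemma translate_translate (y z : R3) (u : H1) :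
    translate y (translate z u) = translate (y + z) u := by
  apply H1.ext_fn_grad
  · filter_upwards [translate_fn y (translate z u), translate_fn (y + z) u,
      ae_comp_sub y (translate_fn z u)] with x h1 h2 h3
    rw [h1, h2, h3, sub_sub]
  · filter_upwards [translate_grad y (translate z u), translate_grad (y + z) u,
      ae_comp_sub y (translate_grad z u)] with x h1 h2 h3
    rw [h1, h2, h3, sub_sub]

lemma translate_zero (u : H1) : translate 0 u = u := by
  apply H1.ext_fn_grad
  · filter_upwards [translate_fn 0 u] with x h
    rw [h, sub_zero]
  · filter_upwards [translate_grad 0 u] with x h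
    rw [h, sub_zero]

lemma inner_translate_translate (y : R3) (u v : H1) :
    inner ℝ (translate y u) (translate y v) = inner ℝ u v := by
  have h1 : inner ℝ (translate y u).1.fst (translate y v).1.fst = inner ℝ u.1.fst v.1.fst :=
    (Lp.compMeasurePreservingₗᵢ ℝ (fun x : R3 => x - y) (measurePreserving_sub y)).inner_map_map
      u.1.fst v.1.fst
  have h2 : inner ℝ (translate y u).1.snd (translate y v).1.snd = inner ℝ u.1.snd v.1.snd :=
    (Lp.compMeasurePreservingₗᵢ ℝ (fun x : R3 => x - y) (measurePreserving_sub y)).inner_map_map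
      u.1.snd v.1.snd
  exact congrArg₂ (· + ·) h1 h2

/-- Translation by `y` as a linear isometry of `H¹`. -/
def translateₗᵢ (y : R3) : H1 →ₗᵢ[ℝ] H1 where
  toFun := translate y
  map_add' := translate_add y
  map_smul' := translate_smul y
  norm_map' u := by
    have h := inner_translate_translate y u u
    rw [real_inner_self_eq_norm_sq, real_inner_self_eq_norm_sq] at h
    exact (pow_left_inj₀ (norm_nonneg _) (norm_nonneg _) two_ne_zero).1 h

lemma norm_translate (y : R3) (u : H1) : ‖translate y u‖ = ‖u‖ := (translateₗᵢ y).norm_map u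

lemma translate_sub (y : R3) (u v : H1) :
    translate y (u - v) = translate y u - translate y v := (translateₗᵢ y).map_sub u v

lemma translate_sum {ι : Type*} (s : Finset ι) (y : R3) (f : ι → H1) :
    translate y (∑ i ∈ s, f i) = ∑ i ∈ s, translate y (f i) := map_sum (translateₗᵢ y) f s

lemma inner_translate (y : R3) (u v : H1) :
    inner ℝ (translate y u) v = inner ℝ u (translate (-y) v) := by
  rw [← inner_translate_translate (-y), translate_translate, neg_add_cancel, translate_zero]

lemma translate_neg_translate (y : R3) (u : H1) : translate (-y) (translate y u) = u := by
  rw [translate_translate, neg_add_cancel, translate_zero]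

lemma translate_translate_neg (y : R3) (u : H1) : translate y (translate (-y) u) = u := by
  rw [translate_translate, add_neg_cancel, translate_zero]

/-- Strong continuity in the shift: a convergent sequence of centres may be moved onto the fixed
test vector, where it converges in norm. -/
lemma continuous_translate (u : H1) : Continuous fun y : R3 => translate y u := by
  have hg : Continuous fun y : R3 => (⟨fun x => x - y, by fun_prop⟩ : C(R3, R3)) := by
    refine ContinuousMap.continuous_of_continuous_uncurry _ ?_
    exact (continuous_snd.sub continuous_fst)
  refine Continuous.subtype_mk ?_ _
  refine (WithLp.prod_continuous_toLp 2 _ _).comp (Continuous.prodMk ?_ ?_)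
  · exact Continuous.compMeasurePreservingLp (f := fun _ : R3 => u.1.fst) continuous_const hg
      measurePreserving_sub (by simp)
  · exact Continuous.compMeasurePreservingLp (f := fun _ : R3 => u.1.snd) continuous_const hg
      measurePreserving_sub (by simp)

/-- Translation invariance of the integral. -/
lemma integral_comp_sub {E : Type*} [NormedAddCommGroup E] [NormedSpace ℝ E] (f : R3 → E)
    (y : R3) : ∫ x, f (x - y) = ∫ x, f x := integral_sub_right_eq_self f y

/-! ### Weak convergence -/

/-- Sequential weak convergence in `H¹`, expressed through inner products. -/
def WeakTo (a : ℕ → H1) (b : H1) : Prop :=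
  ∀ h : H1, Tendsto (fun n => (inner ℝ (a n) h : ℝ)) atTop (𝓝 (inner ℝ b h))

lemma WeaklyConverges.weakTo {a : ℕ → H1} {b : H1} (h : WeaklyConverges a b) : WeakTo a b := by
  intro v
  have hc : Continuous fun x : WeakSpace ℝ H1 => (topDualPairing ℝ H1).flip x (innerSL ℝ v) :=
    WeakBilin.eval_continuous (topDualPairing ℝ H1).flip (innerSL ℝ v)
  have := (hc.tendsto _).comp h
  simp_rw [real_inner_comm v]
  exact this

namespace WeakTo

variable {a a' : ℕ → H1} {b b' : H1}

lemma apply (h : WeakTo a b) (L : H1 →L[ℝ] ℝ) : Tendsto (fun n => L (a n)) atTop (𝓝 (L b)) := by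
  have := h ((InnerProductSpace.toDual ℝ H1).symm L)
  simp_rw [real_inner_comm ((InnerProductSpace.toDual ℝ H1).symm L),
    InnerProductSpace.toDual_symm_apply] at this
  exact this

lemma add (h : WeakTo a b) (h' : WeakTo a' b') : WeakTo (fun n => a n + a' n) (b + b') := by
  intro v
  simp_rw [inner_add_left]
  exact (h v).add (h' v)

lemma sub (h : WeakTo a b) (h' : WeakTo a' b') : WeakTo (fun n => a n - a' n) (b - b') := by
  intro v
  simp_rw [inner_sub_left]
  exact (h v).sub (h' v)

lemma const (b : H1) : WeakTo (fun _ => b) b := fun _ => tendsto_const_nhds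

lemma sum {ι : Type*} (s : Finset ι) {a : ι → ℕ → H1} {b : ι → H1}
    (h : ∀ i ∈ s, WeakTo (a i) (b i)) : WeakTo (fun n => ∑ i ∈ s, a i n) (∑ i ∈ s, b i) := by
  intro v
  simp_rw [sum_inner]
  exact tendsto_finsetSum s fun i hi => h i hi v

lemma comp (h : WeakTo a b) {σ : ℕ → ℕ} (hσ : StrictMono σ) : WeakTo (fun n => a (σ n)) b :=
  fun v => (h v).comp hσ.tendsto_atTop

lemma sub_self (h : WeakTo a b) : WeakTo (fun n => a n - b) 0 := by
  simpa using h.sub (const b)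

/-- Pairing of a weakly convergent sequence with a strongly convergent one. -/
lemma inner_tendsto (h : WeakTo a b) {C : ℝ} (hC : ∀ n, ‖a n‖ ≤ C)
    (h' : Tendsto a' atTop (𝓝 b')) :
    Tendsto (fun n => (inner ℝ (a n) (a' n) : ℝ)) atTop (𝓝 (inner ℝ b b')) := by
  have h1 : Tendsto (fun n => (inner ℝ (a n) (a' n - b') : ℝ)) atTop (𝓝 0) := by
    refine squeeze_zero_norm (a := fun n => C * ‖a' n - b'‖) (fun n => ?_) ?_
    · refine (norm_inner_le_norm _ _).trans ?_
      gcongr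
      exact hC n
    · have := (tendsto_iff_norm_sub_tendsto_zero.1 h').const_mul C
      simpa using this
  have h2 := h1.add (h b')
  simp_rw [← inner_add_right, sub_add_cancel, zero_add] at h2
  exact h2

end WeakTo

/-- Bounded sequences in `H¹` have weakly convergent subsequences. -/
lemma exists_weakTo_subseq {a : ℕ → H1} {C : ℝ} (hC : ∀ n, ‖a n‖ ≤ C) :
    ∃ (b : H1) (σ : ℕ → ℕ), StrictMono σ ∧ WeakTo (fun n => a (σ n)) b := by
  -- Banach–Alaoglu for the functionals `⟨a n, ·⟩`; the Riesz isometry turns the weak-* limit back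
  -- into a vector.
  have hs := WeakDual.isSeqCompact_closedBall ℝ H1 0 C
  obtain ⟨l, -, σ, hσ, hl⟩ := hs (x := fun n => StrongDual.toWeakDual (innerSL ℝ (a n)))
    (fun n => by
      refine le_trans (le_of_eq ?_) (hC n)
      exact (dist_zero_right (innerSL ℝ (a n))).trans (innerSL_apply_norm ℝ (a n)))
  refine ⟨(InnerProductSpace.toDual ℝ H1).symm (WeakDual.toStrongDual l), σ, hσ, fun v => ?_⟩
  rw [InnerProductSpace.toDual_symm_apply]
  exact ((WeakDual.eval_continuous v).tendsto l).comp hl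

/-! ### Mollification -/

lemma sq_lintegral_le {T : Type*} [MeasurableSpace T] (ν : Measure T) [IsProbabilityMeasure ν]
    {g : T → ℝ≥0∞} (hg : AEMeasurable g ν) : (∫⁻ t, g t ∂ν) ^ 2 ≤ ∫⁻ t, g t ^ 2 ∂ν := by
  have h := ENNReal.lintegral_mul_le_Lp_mul_Lq ν Real.HolderConjugate.two_two hg
    (aemeasurable_const (b := (1 : ℝ≥0∞)))
  simp only [Pi.mul_apply, mul_one, ENNReal.one_rpow, lintegral_const, measure_univ,
    ENNReal.rpow_two, one_pow] at h
  calc (∫⁻ t, g t ∂ν) ^ 2 ≤ ((∫⁻ t, g t ^ 2 ∂ν) ^ (1 / 2 : ℝ)) ^ 2 := by gcongr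
    _ = ∫⁻ t, g t ^ 2 ∂ν := by
      rw [← ENNReal.rpow_two, ← ENNReal.rpow_mul]; norm_num

/-- Jensen in `t` followed by Tonelli. It serves the `L²` contraction of mollification, the bound
for differences of translates and the mollification error, each an average over a probability
measure. -/
lemma lintegral_sq_lintegral_le {T : Type*} [MeasurableSpace T] (ν : Measure T)
    [IsProbabilityMeasure ν] {F : R3 → T → ℝ≥0∞}
    (hF : AEMeasurable (Function.uncurry F) ((volume : Measure R3).prod ν)) :
    ∫⁻ x, (∫⁻ t, F x t ∂ν) ^ 2 ≤ ∫⁻ t, (∫⁻ x, F x t ^ 2) ∂ν := by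
  rw [← lintegral_lintegral_swap (f := fun x t => F x t ^ 2) (hF.pow_const 2)]
  refine lintegral_mono_ae ?_
  filter_upwards [hF.aestronglyMeasurable.prodMk_left] with x hx
  exact sq_lintegral_le ν hx.aemeasurable

/-- The probability measure with density a normalised bump function. -/
def bumpMeasure (φ : ContDiffBump (0 : R3)) : Measure R3 :=
  volume.withDensity fun t => ((φ.normed volume t).toNNReal : ℝ≥0∞)

lemma measurable_bump (φ : ContDiffBump (0 : R3)) :
    Measurable fun t => (φ.normed (volume : Measure R3) t).toNNReal :=
  φ.continuous_normed.measurable.real_toNNReal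

lemma integral_bumpMeasure {E : Type*} [NormedAddCommGroup E] [NormedSpace ℝ E]
    (φ : ContDiffBump (0 : R3)) (f : R3 → E) :
    ∫ t, f t ∂(bumpMeasure φ) = ∫ t, φ.normed volume t • f t := by
  rw [bumpMeasure, integral_withDensity_eq_integral_smul (measurable_bump φ)]
  refine integral_congr_ae (.of_forall fun t => ?_)
  simp only [NNReal.smul_def, Real.coe_toNNReal _ (φ.nonneg_normed t)]

instance (φ : ContDiffBump (0 : R3)) : IsProbabilityMeasure (bumpMeasure φ) := by
  constructor
  have h : ∫⁻ t, ENNReal.ofReal (φ.normed (volume : Measure R3) t) = 1 := by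
    rw [← ofReal_integral_eq_lintegral_ofReal φ.integrable_normed
      (.of_forall φ.nonneg_normed), φ.integral_normed, ENNReal.ofReal_one]
  rw [bumpMeasure, withDensity_apply _ MeasurableSet.univ, Measure.restrict_univ]
  exact h

lemma ae_bumpMeasure_norm_lt (φ : ContDiffBump (0 : R3)) :
    ∀ᵐ t ∂(bumpMeasure φ), ‖t‖ < φ.rOut := by
  rw [bumpMeasure, ae_withDensity_iff (measurable_bump φ).coe_nnreal_ennreal]
  refine .of_forall fun t ht => ?_
  have h1 : t ∈ Function.support (φ.normed (volume : Measure R3)) := by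
    intro h0
    simp [h0] at ht
  rw [φ.support_normed_eq] at h1
  simpa using h1

/-- Convolution with a normalised bump function. -/
def mollify {E : Type*} [NormedAddCommGroup E] [NormedSpace ℝ E] (φ : ContDiffBump (0 : R3))
    (f : R3 → E) (x : R3) : E := ∫ t, f (x - t) ∂(bumpMeasure φ)

lemma mollify_eq_convolution (φ : ContDiffBump (0 : R3)) (f : R3 → ℝ) :
    mollify φ f = convolution (φ.normed volume) f (ContinuousLinearMap.lsmul ℝ ℝ) volume := by
  ext x
  rw [mollify, integral_bumpMeasure, convolution_def]
  rfl

lemma mollify_eq_integral {E : Type*} [NormedAddCommGroup E] [NormedSpace ℝ E]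
    (φ : ContDiffBump (0 : R3)) (f : R3 → E) (x : R3) :
    mollify φ f x = ∫ s, φ.normed volume (x - s) • f s := by
  rw [mollify, integral_bumpMeasure, ← integral_sub_left_eq_self _ volume x]
  simp only [sub_sub_cancel]

lemma integrable_bump_mul {E : Type*} [NormedAddCommGroup E] [NormedSpace ℝ E]
    (φ : ContDiffBump (0 : R3)) {f : R3 → E} (hf : MemLp f 2 volume) (x : R3) :
    Integrable fun s => φ.normed volume (x - s) • f s := by
  have h1 : MemLp (fun s => φ.normed (volume : Measure R3) (x - s)) 2 volume := by
    refine Continuous.memLp_of_hasCompactSupport ?_ ?_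
    · exact φ.continuous_normed.comp (by fun_prop)
    · exact φ.hasCompactSupport_normed.comp_homeomorph (Homeomorph.subLeft x)
  exact memLp_one_iff_integrable.1 (hf.smul h1)

lemma integrable_bumpMeasure {E : Type*} [NormedAddCommGroup E] [NormedSpace ℝ E]
    (φ : ContDiffBump (0 : R3)) {f : R3 → E} (hf : MemLp f 2 volume) (x : R3) :
    Integrable (fun t => f (x - t)) (bumpMeasure φ) := by
  rw [bumpMeasure, integrable_withDensity_iff_integrable_smul (measurable_bump φ)]
  have h := (integrable_bump_mul φ hf x).comp_sub_left x
  refine h.congr (.of_forall fun t => ?_)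
  simp only [sub_sub_cancel, NNReal.smul_def, Real.coe_toNNReal _ (φ.nonneg_normed t)]

lemma contDiff_mollify (φ : ContDiffBump (0 : R3)) {f : R3 → ℝ} (hf : MemLp f 2 volume) :
    ContDiff ℝ 1 (mollify φ f) := by
  rw [mollify_eq_convolution]
  exact φ.hasCompactSupport_normed.contDiff_convolution_left (n := 1) _
    φ.contDiff_normed (hf.locallyIntegrable (by norm_num))

/-- The weak gradient identity is tested with `s ↦ ρ (x - s)`; the sign from the chain rule cancels
the sign in the identity. -/
lemma IsWeakGradient.fderiv_mollify {f : R3 → ℝ} {g : R3 → R3} (h : IsWeakGradient f g)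
    (hf : MemLp f 2 volume) (φ : ContDiffBump (0 : R3)) (x v : R3) :
    fderiv ℝ (mollify φ f) x v = ∫ s, inner ℝ (g s) v * φ.normed volume (x - s) := by
  set ρ := φ.normed (volume : Measure R3) with hρ
  have hρs : ContDiff ℝ ∞ ρ := φ.contDiff_normed
  have hρc : HasCompactSupport ρ := φ.hasCompactSupport_normed
  have h1 := hρc.hasFDerivAt_convolution_left (μ := volume) (ContinuousLinearMap.lsmul ℝ ℝ)
    (hρs.of_le (by simp)) (hf.locallyIntegrable (by norm_num)) x
  rw [← mollify_eq_convolution] at h1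
  have hdc : HasCompactSupport (fderiv ℝ ρ) := hρc.fderiv (𝕜 := ℝ)
  have hex : ConvolutionExistsAt (fderiv ℝ ρ) f x
      ((ContinuousLinearMap.lsmul ℝ ℝ).precompL R3) volume :=
    hdc.convolutionExists_left _ (hρs.continuous_fderiv (by simp))
      (hf.locallyIntegrable (by norm_num)) x
  rw [h1.fderiv, convolution_def, ContinuousLinearMap.integral_apply hex]
  simp only [ContinuousLinearMap.precompL_apply, ContinuousLinearMap.lsmul_apply, smul_eq_mul]
  rw [← integral_sub_left_eq_self _ volume x]
  simp only [sub_sub_cancel]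
  have hψ : ContDiff ℝ ∞ (fun s => ρ (x - s)) := hρs.comp (contDiff_const.sub contDiff_id)
  have hψc : HasCompactSupport (fun s => ρ (x - s)) :=
    hρc.comp_homeomorph (Homeomorph.subLeft x)
  have key := h _ hψ hψc v
  have hd : ∀ s, fderiv ℝ (fun s => ρ (x - s)) s v = - fderiv ℝ ρ (x - s) v := by
    intro s
    have h2 : HasFDerivAt (fun s => ρ (x - s)) ((fderiv ℝ ρ (x - s)).comp
        (-ContinuousLinearMap.id ℝ R3)) s :=
      ((hρs.differentiable (by simp)).differentiableAt.hasFDerivAt).comp s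
        ((hasFDerivAt_id s).const_sub x)
    rw [h2.fderiv]; simp
  simp only [hd, mul_neg, integral_neg, neg_inj] at key
  rw [← key]
  exact integral_congr_ae (.of_forall fun s => mul_comm _ _)

/-- Cauchy–Schwarz under the convolution integral. The vector-valued bound is thereby reduced to the
`L²` contraction for the scalar function `‖g‖`. -/
lemma IsWeakGradient.norm_fderiv_mollify_le {f : R3 → ℝ} {g : R3 → R3} (h : IsWeakGradient f g)
    (hf : MemLp f 2 volume) (hg : MemLp g 2 volume) (φ : ContDiffBump (0 : R3)) (x : R3) :
    ‖fderiv ℝ (mollify φ f) x‖ ≤ mollify φ (fun s => ‖g s‖) x := by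
  refine ContinuousLinearMap.opNorm_le_bound _
    (integral_nonneg fun t => norm_nonneg _) fun v => ?_
  rw [h.fderiv_mollify hf, mollify_eq_integral, ← integral_mul_const]
  refine (norm_integral_le_integral_norm _).trans ?_
  refine integral_mono_of_nonneg (.of_forall fun s => norm_nonneg _)
    ((integrable_bump_mul φ hg.norm x).mul_const _) (.of_forall fun s => ?_)
  simp only [norm_mul, smul_eq_mul, Real.norm_of_nonneg (φ.nonneg_normed _)]
  nlinarith [norm_inner_le_norm (𝕜 := ℝ) (g s) v, φ.nonneg_normed (μ := volume) (x - s)]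

lemma lintegral_enorm_sq {E : Type*} [NormedAddCommGroup E] (f : R3 → E) :
    ∫⁻ x, ‖f x‖ₑ ^ 2 = eLpNorm f 2 volume ^ 2 := by
  have h := eLpNorm_nnreal_pow_eq_lintegral (f := f) (μ := (volume : Measure R3)) (p := 2)
    two_ne_zero
  simp only [NNReal.coe_ofNat, ENNReal.rpow_two, ENNReal.coe_ofNat] at h
  exact h.symm

lemma aemeasurable_comp_sub {E : Type*} [NormedAddCommGroup E] {f : R3 → E}
    (hf : AEStronglyMeasurable f volume) (ν : Measure R3) [SFinite ν] :
    AEStronglyMeasurable (fun p : R3 × R3 => f (p.1 - p.2)) ((volume : Measure R3).prod ν) :=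
  hf.comp_quasiMeasurePreserving (quasiMeasurePreserving_sub volume ν)

lemma lintegral_mollify_sq_le {E : Type*} [NormedAddCommGroup E] [NormedSpace ℝ E]
    (φ : ContDiffBump (0 : R3)) {f : R3 → E} (hf : AEStronglyMeasurable f volume) :
    ∫⁻ x, ‖mollify φ f x‖ₑ ^ 2 ≤ ∫⁻ x, ‖f x‖ₑ ^ 2 := by
  calc ∫⁻ x, ‖mollify φ f x‖ₑ ^ 2
      ≤ ∫⁻ x, (∫⁻ t, ‖f (x - t)‖ₑ ∂(bumpMeasure φ)) ^ 2 := by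
        gcongr with x; exact enorm_integral_le_lintegral_enorm _
    _ ≤ ∫⁻ t, (∫⁻ x, ‖f (x - t)‖ₑ ^ 2) ∂(bumpMeasure φ) :=
        lintegral_sq_lintegral_le _ (aemeasurable_comp_sub hf _).enorm
    _ = ∫⁻ x, ‖f x‖ₑ ^ 2 := by
        simp_rw [lintegral_sub_right_eq_self (fun x => ‖f x‖ₑ ^ 2)]
        simp

lemma eLpNorm_mollify_le {E : Type*} [NormedAddCommGroup E] [NormedSpace ℝ E]
    (φ : ContDiffBump (0 : R3)) {f : R3 → E} (hf : AEStronglyMeasurable f volume) :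
    eLpNorm (mollify φ f) 2 volume ≤ eLpNorm f 2 volume := by
  have := lintegral_mollify_sq_le φ hf
  rw [lintegral_enorm_sq, lintegral_enorm_sq] at this
  exact (ENNReal.pow_le_pow_left_iff two_ne_zero).1 this

lemma IsWeakGradient.eLpNorm_fderiv_mollify_le {f : R3 → ℝ} {g : R3 → R3}
    (h : IsWeakGradient f g) (hf : MemLp f 2 volume) (hg : MemLp g 2 volume)
    (φ : ContDiffBump (0 : R3)) :
    eLpNorm (fderiv ℝ (mollify φ f)) 2 volume ≤ eLpNorm g 2 volume := by
  refine (eLpNorm_mono_real (g := mollify φ (fun s => ‖g s‖))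
    (h.norm_fderiv_mollify_le hf hg φ)).trans ?_
  refine (eLpNorm_mollify_le φ hg.1.norm).trans ?_
  rw [eLpNorm_norm]

/-- A sequence of bump functions shrinking to the origin. -/
def shrinkingBump (n : ℕ) : ContDiffBump (0 : R3) where
  rIn := 1 / (n + 1)
  rOut := 2 / (n + 1)
  rIn_pos := by positivity
  rIn_lt_rOut := by gcongr; norm_num

lemma tendsto_rOut_shrinkingBump : Tendsto (fun n => (shrinkingBump n).rOut) atTop (𝓝 0) := by
  have := (tendsto_one_div_add_atTop_nhds_zero_nat (𝕜 := ℝ)).const_mul 2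
  simpa [shrinkingBump, div_eq_mul_inv] using this

lemma ae_tendsto_mollify {f : R3 → ℝ} (hf : MemLp f 2 volume) :
    ∀ᵐ x ∂(volume : Measure R3),
      Tendsto (fun n => mollify (shrinkingBump n) f x) atTop (𝓝 (f x)) := by
  -- The value `2` is the ratio of outer to inner radius, which must stay bounded for Lebesgue
  -- differentiation to apply.
  have := ContDiffBump.ae_convolution_tendsto_right_of_locallyIntegrable (K := 2)
    tendsto_rOut_shrinkingBump (.of_forall fun n => by simp [shrinkingBump]; field_simp; norm_num)
    (hf.locallyIntegrable (by norm_num))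
  simpa only [mollify_eq_convolution] using this

/-! ### The Sobolev inequality -/

/-- A fixed cutoff function. -/
def cutoff : ContDiffBump (0 : R3) := ⟨1, 2, one_pos, one_lt_two⟩

lemma exists_fderiv_cutoff_le : ∃ M : NNReal, ∀ x, ‖fderiv ℝ (cutoff : R3 → ℝ) x‖ ≤ M := by
  have h := (cutoff.hasCompactSupport.fderiv (𝕜 := ℝ)).exists_bound_of_continuous
    ((cutoff.contDiff (n := 1)).continuous_fderiv (by simp))
  obtain ⟨C, hC⟩ := h
  exact ⟨C.toNNReal, fun x => (hC x).trans (Real.le_coe_toNNReal C)⟩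

/-- The constant of the Sobolev inequality on `ℝ³`. -/
def gnsConst : NNReal := SNormLESNormFDerivOfEqConst ℝ (volume : Measure R3) 2

/-- Gagliardo–Nirenberg–Sobolev in dimension three, where `1/6 = 1/2 - 1/3`. -/
lemma eLpNorm_six_le_of_contDiff {f : R3 → ℝ} (hf : ContDiff ℝ 1 f) (hc : HasCompactSupport f) :
    eLpNorm f 6 volume ≤ gnsConst * eLpNorm (fderiv ℝ f) 2 volume := by
  have h := eLpNorm_le_eLpNorm_fderiv_of_eq (volume : Measure R3) hf hc (p := 2) (p' := 6)
    (by norm_num) (by simp) (by simp; norm_num)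
  exact_mod_cast h

/-- The inequality for compactly supported `C¹` functions is applied to a dilated cutoff times a
mollification of `f`, and Fatou's lemma passes to the limit. The product rule leaves the term `M
‖f‖₂`: the decay of the cutoff's gradient is discarded, since a bound by the full `H¹` norm
suffices. -/
lemma IsWeakGradient.exists_eLpNorm_six_le : ∃ M : NNReal, ∀ (f : R3 → ℝ) (g : R3 → R3),
    IsWeakGradient f g → MemLp f 2 volume → MemLp g 2 volume →
    eLpNorm f 6 volume ≤ gnsConst * (eLpNorm g 2 volume + M * eLpNorm f 2 volume) := by
  obtain ⟨M, hM⟩ := exists_fderiv_cutoff_le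
  refine ⟨M, fun f g h hf hg => ?_⟩
  set m := fun n => mollify (shrinkingBump n) f with hm
  set χ : ℕ → R3 → ℝ := fun n x => cutoff (((n : ℝ) + 1)⁻¹ • x) with hχ
  have hmc : ∀ n, ContDiff ℝ 1 (m n) := fun n => contDiff_mollify _ hf
  have hχc : ∀ n, ContDiff ℝ 1 (χ n) := fun n =>
    cutoff.contDiff.comp (contDiff_const_smul _)
  have hχd : ∀ n x, ‖fderiv ℝ (χ n) x‖ ≤ M := by
    intro n x
    have h0 : HasFDerivAt (fun x : R3 => ((n : ℝ) + 1)⁻¹ • x)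
        (((n : ℝ) + 1)⁻¹ • ContinuousLinearMap.id ℝ R3) x :=
      (((n : ℝ) + 1)⁻¹ • ContinuousLinearMap.id ℝ R3).hasFDerivAt
    have h1 : HasFDerivAt (χ n) ((fderiv ℝ (cutoff : R3 → ℝ) (((n : ℝ) + 1)⁻¹ • x)).comp
        (((n : ℝ) + 1)⁻¹ • ContinuousLinearMap.id ℝ R3)) x :=
      (((cutoff.contDiff (n := 1)).differentiable (by simp)).differentiableAt.hasFDerivAt).comp x h0
    rw [h1.fderiv, ContinuousLinearMap.comp_smul, norm_smul, ContinuousLinearMap.comp_id]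
    have h2 : ‖((n : ℝ) + 1)⁻¹‖ ≤ 1 := by
      rw [norm_inv, Real.norm_of_nonneg (by positivity)]
      exact inv_le_one_of_one_le₀ (by linarith [(Nat.cast_nonneg n : (0 : ℝ) ≤ n)])
    calc _ ≤ 1 * (M : ℝ) := mul_le_mul h2 (hM _) (norm_nonneg _) zero_le_one
      _ = M := one_mul _
  have hb : ∀ n, eLpNorm (fun x => χ n x * m n x) 6 volume
      ≤ gnsConst * (eLpNorm g 2 volume + M * eLpNorm f 2 volume) := by
    intro n
    have hsupp : HasCompactSupport (fun x => χ n x * m n x) := by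
      refine HasCompactSupport.mul_right ?_
      exact cutoff.hasCompactSupport.comp_homeomorph
        (Homeomorph.smulOfNeZero (((n : ℝ) + 1)⁻¹) (by positivity))
    refine (eLpNorm_six_le_of_contDiff ((hχc n).mul (hmc n)) hsupp).trans ?_
    gcongr
    have hd : ∀ x, ‖fderiv ℝ (fun x => χ n x * m n x) x‖
        ≤ ‖‖fderiv ℝ (m n) x‖ + M * ‖m n x‖‖ := by
      intro x
      rw [fderiv_fun_mul ((hχc n).differentiable (by simp)).differentiableAt
        ((hmc n).differentiable (by simp)).differentiableAt]
      rw [Real.norm_of_nonneg (by positivity)]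
      refine (norm_add_le _ _).trans ?_
      rw [norm_smul, norm_smul]
      have h1 : ‖χ n x‖ ≤ 1 := by
        rw [Real.norm_of_nonneg cutoff.nonneg]; exact cutoff.le_one
      have h2 := hχd n x
      nlinarith [norm_nonneg (fderiv ℝ (m n) x), norm_nonneg (m n x)]
    refine (eLpNorm_mono hd).trans ((eLpNorm_add_le ?_ ?_ (by norm_num)).trans ?_)
    · exact ((hmc n).continuous_fderiv (by simp)).norm.aestronglyMeasurable
    · exact (continuous_const.mul (hmc n).continuous.norm).aestronglyMeasurable
    · gcongr
      · rw [eLpNorm_norm]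
        exact h.eLpNorm_fderiv_mollify_le hf hg _
      · refine (eLpNorm_const_smul (M : ℝ) (fun x => ‖m n x‖) 2 volume).le.trans ?_
        rw [eLpNorm_norm]
        gcongr
        · simp
        · exact eLpNorm_mollify_le _ hf.1
  refine (Lp.eLpNorm_lim_le_liminf_eLpNorm (f := fun n x => χ n x * m n x)
    (fun n => ((hχc n).continuous.mul (hmc n).continuous).aestronglyMeasurable) f ?_).trans
    (Filter.liminf_le_of_le (by isBoundedDefault) fun b hb' => ?_)
  · filter_upwards [ae_tendsto_mollify hf] with x hx
    have h1 : Tendsto (fun n => χ n x) atTop (𝓝 1) := by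
      have h2 : Tendsto (fun n : ℕ => ((n : ℝ) + 1)⁻¹ • x) atTop (𝓝 ((0 : ℝ) • x)) := by
        have := (tendsto_one_div_add_atTop_nhds_zero_nat (𝕜 := ℝ)).smul_const x
        simpa only [one_div] using this
      rw [zero_smul] at h2
      have h3 : (cutoff : R3 → ℝ) 0 = 1 :=
        cutoff.one_of_mem_closedBall (Metric.mem_closedBall_self cutoff.rIn_pos.le)
      rw [← h3]
      exact (cutoff.continuous.tendsto 0).comp h2
    simpa using h1.mul hx
  · obtain ⟨n, hn⟩ := hb'.exists
    exact hn.trans (hb n)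

namespace H1

lemma eLpNorm_fn (u : H1) : eLpNorm u.fn 2 volume = ENNReal.ofReal ‖fnL u‖ := by
  rw [fn_eq, Lp.norm_def, ENNReal.ofReal_toReal (Lp.memLp _).2.ne]

lemma eLpNorm_grad (u : H1) : eLpNorm u.grad 2 volume = ENNReal.ofReal ‖gradL u‖ := by
  rw [grad_eq, Lp.norm_def, ENNReal.ofReal_toReal (Lp.memLp _).2.ne]

lemma isWeakGradient (u : H1) : IsWeakGradient u.fn u.grad := u.2

lemma exists_eLpNorm_six_le : ∃ C : NNReal, ∀ u : H1,
    eLpNorm u.fn 6 volume ≤ C * ENNReal.ofReal ‖u‖ := by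
  obtain ⟨M, hM⟩ := IsWeakGradient.exists_eLpNorm_six_le
  refine ⟨gnsConst * (1 + M), fun u => (hM _ _ u.isWeakGradient u.memLp_fn u.memLp_grad).trans ?_⟩
  rw [eLpNorm_fn, eLpNorm_grad]
  push_cast
  rw [mul_assoc, add_mul, one_mul]
  gcongr
  · exact norm_gradL_le u
  · exact norm_fnL_le u

lemma memLp_six (u : H1) : MemLp u.fn 6 volume := by
  obtain ⟨C, hC⟩ := exists_eLpNorm_six_le
  exact ⟨u.memLp_fn.1, (hC u).trans_lt (ENNReal.mul_lt_top (by simp) (by simp))⟩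

lemma integrable_pow_six (u : H1) : Integrable fun x => u.fn x ^ 6 := by
  have h := u.memLp_six.integrable_norm_pow (by norm_num)
  refine h.congr (.of_forall fun x => ?_)
  simp only [Real.norm_eq_abs]
  exact Even.pow_abs ⟨3, rfl⟩ _

/-- The Sobolev embedding `H¹ ⊂ L⁶`, in integral form. -/
lemma exists_integral_pow_six_le : ∃ C : ℝ, 0 ≤ C ∧ ∀ u : H1,
    ∫ x, u.fn x ^ 6 ≤ C * ‖u‖ ^ 6 := by
  obtain ⟨C, hC⟩ := exists_eLpNorm_six_le
  refine ⟨(C : ℝ) ^ 6, by positivity, fun u => ?_⟩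
  have h1 := eLpNorm_nnreal_pow_eq_lintegral (f := u.fn) (μ := (volume : Measure R3)) (p := 6)
    (by norm_num)
  have h2 : ENNReal.ofReal (∫ x, u.fn x ^ 6) = eLpNorm u.fn 6 volume ^ 6 := by
    rw [ofReal_integral_eq_lintegral_ofReal u.integrable_pow_six
      (.of_forall fun x => Even.pow_nonneg ⟨3, rfl⟩ _)]
    have h3 : eLpNorm u.fn 6 volume ^ 6 = ∫⁻ x, ‖u.fn x‖ₑ ^ 6 := by
      have : ((6 : NNReal) : ℝ) = ((6 : ℕ) : ℝ) := by norm_num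
      simp only [this, ENNReal.rpow_natCast] at h1
      exact_mod_cast h1
    rw [h3]
    refine lintegral_congr fun x => ?_
    rw [Real.enorm_eq_ofReal_abs, ← ENNReal.ofReal_pow (abs_nonneg _), Even.pow_abs ⟨3, rfl⟩]
  have h4 : ENNReal.ofReal (∫ x, u.fn x ^ 6) ≤ ENNReal.ofReal ((C : ℝ) ^ 6 * ‖u‖ ^ 6) := by
    rw [h2, ← mul_pow, ENNReal.ofReal_pow (by positivity), ENNReal.ofReal_mul (by positivity),
      ENNReal.ofReal_coe_nnreal]
    gcongr
    exact hC u
  exact (ENNReal.ofReal_le_ofReal_iff (by positivity)).1 h4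

end H1

/-! ### Translation and mollification estimates -/

/-- Integrate the derivative along the segment `t ↦ x - t • h`, then use Jensen in `t`, Tonelli and
translation invariance. -/
lemma lintegral_translate_sub_le_of_contDiff {m : R3 → ℝ} (hm : ContDiff ℝ 1 m) (h : R3) :
    ∫⁻ x, ‖m (x - h) - m x‖ₑ ^ 2 ≤ ‖h‖ₑ ^ 2 * ∫⁻ x, ‖fderiv ℝ m x‖ₑ ^ 2 := by
  have hmd : Continuous (fderiv ℝ m) := hm.continuous_fderiv (by simp)
  let ν : Measure ℝ := volume.restrict (Set.Ioc 0 1)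
  have : IsProbabilityMeasure ν := ⟨by simp [ν]⟩
  have h1 : ∀ x, ‖m (x - h) - m x‖ₑ ≤ ‖h‖ₑ * ∫⁻ t, ‖fderiv ℝ m (x - t • h)‖ₑ ∂ν := by
    intro x
    have hd : ∀ t ∈ Set.uIcc (0 : ℝ) 1, HasDerivAt (fun t : ℝ => m (x - t • h))
        (fderiv ℝ m (x - t • h) (-h)) t := by
      intro t _
      have h2 : HasDerivAt (fun t : ℝ => x - t • h) (-h) t := by
        simpa using ((hasDerivAt_id t).smul_const h).const_sub x
      exact (hm.differentiable (by simp)).differentiableAt.hasFDerivAt.comp_hasDerivAt t h2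
    have hint : Continuous (fun t : ℝ => fderiv ℝ m (x - t • h) (-h)) :=
      (hmd.comp (by fun_prop)).clm_apply continuous_const
    have h3 := intervalIntegral.integral_eq_sub_of_hasDerivAt hd (hint.intervalIntegrable _ _)
    simp only [one_smul, zero_smul, sub_zero] at h3
    rw [← h3, intervalIntegral.integral_of_le zero_le_one]
    refine (enorm_integral_le_lintegral_enorm _).trans ?_
    rw [← lintegral_const_mul' _ _ (by simp)]
    refine lintegral_mono fun t => ?_
    refine (ContinuousLinearMap.le_opENorm _ _).trans ?_
    rw [enorm_neg, mul_comm]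
  calc ∫⁻ x, ‖m (x - h) - m x‖ₑ ^ 2
      ≤ ∫⁻ x, ‖h‖ₑ ^ 2 * (∫⁻ t, ‖fderiv ℝ m (x - t • h)‖ₑ ∂ν) ^ 2 := by
        gcongr with x; rw [← mul_pow]; gcongr; exact h1 x
    _ = ‖h‖ₑ ^ 2 * ∫⁻ x, (∫⁻ t, ‖fderiv ℝ m (x - t • h)‖ₑ ∂ν) ^ 2 :=
        lintegral_const_mul' _ _ (by simp)
    _ ≤ ‖h‖ₑ ^ 2 * ∫⁻ t, (∫⁻ x, ‖fderiv ℝ m (x - t • h)‖ₑ ^ 2) ∂ν := by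
        gcongr
        refine lintegral_sq_lintegral_le ν ?_
        have : Continuous fun p : R3 × ℝ => ‖fderiv ℝ m (p.1 - p.2 • h)‖ₑ :=
          (hmd.comp (by fun_prop)).enorm
        exact this.aemeasurable
    _ = ‖h‖ₑ ^ 2 * ∫⁻ x, ‖fderiv ℝ m x‖ₑ ^ 2 := by
        simp_rw [fun t : ℝ => lintegral_sub_right_eq_self
          (μ := (volume : Measure R3)) (fun x => ‖fderiv ℝ m x‖ₑ ^ 2) (t • h)]
        simp

/-- The `C¹` estimate for mollifications, whose gradients are bounded in `L²` by that of `u`,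
survives the almost everywhere limit by Fatou. -/
lemma H1.lintegral_translate_sub_le (u : H1) (h : R3) :
    ∫⁻ x, ‖u.fn (x - h) - u.fn x‖ₑ ^ 2 ≤ ‖h‖ₑ ^ 2 * ∫⁻ x, ‖u.grad x‖ₑ ^ 2 := by
  set m := fun n => mollify (shrinkingBump n) u.fn with hm
  have hmc : ∀ n, ContDiff ℝ 1 (m n) := fun n => contDiff_mollify _ u.memLp_fn
  have hb : ∀ n, ∫⁻ x, ‖m n (x - h) - m n x‖ₑ ^ 2 ≤ ‖h‖ₑ ^ 2 * ∫⁻ x, ‖u.grad x‖ₑ ^ 2 := by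
    intro n
    refine (lintegral_translate_sub_le_of_contDiff (hmc n) h).trans ?_
    rw [lintegral_enorm_sq, lintegral_enorm_sq]
    gcongr
    exact u.isWeakGradient.eLpNorm_fderiv_mollify_le u.memLp_fn u.memLp_grad _
  have hc : ∀ n, Continuous fun x => ‖m n (x - h) - m n x‖ₑ ^ 2 := fun n =>
    (ENNReal.continuous_pow 2).comp
      (((hmc n).continuous.comp (by fun_prop)).sub (hmc n).continuous).enorm
  calc ∫⁻ x, ‖u.fn (x - h) - u.fn x‖ₑ ^ 2
      ≤ ∫⁻ x, liminf (fun n => ‖m n (x - h) - m n x‖ₑ ^ 2) atTop := by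
        refine lintegral_mono_ae ?_
        filter_upwards [ae_tendsto_mollify u.memLp_fn,
          ae_comp_sub h (ae_tendsto_mollify u.memLp_fn)] with x h1 h2
        refine le_of_eq (Tendsto.liminf_eq ?_).symm
        exact ((ENNReal.continuous_pow 2).tendsto _).comp ((h2.sub h1).enorm)
    _ ≤ liminf (fun n => ∫⁻ x, ‖m n (x - h) - m n x‖ₑ ^ 2) atTop :=
        lintegral_liminf_le' fun n => (hc n).aemeasurable
    _ ≤ _ := by
        refine Filter.liminf_le_of_le (by isBoundedDefault) fun b hb' => ?_
        obtain ⟨n, hn⟩ := hb'.exists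
        exact hn.trans (hb n)

/-- The error is an average of differences `u(· - t) - u` over `‖t‖ < rOut`. The bound depends on
`u` only through its gradient, so it is uniform along bounded sequences; this uniformity is the
source of compactness. -/
lemma H1.lintegral_sub_mollify_le (u : H1) (φ : ContDiffBump (0 : R3)) :
    ∫⁻ x, ‖u.fn x - mollify φ u.fn x‖ₑ ^ 2
      ≤ ENNReal.ofReal φ.rOut ^ 2 * ∫⁻ x, ‖u.grad x‖ₑ ^ 2 := by
  calc ∫⁻ x, ‖u.fn x - mollify φ u.fn x‖ₑ ^ 2
      ≤ ∫⁻ x, (∫⁻ t, ‖u.fn (x - t) - u.fn x‖ₑ ∂(bumpMeasure φ)) ^ 2 := by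
        gcongr with x
        have h1 : mollify φ u.fn x - u.fn x
            = ∫ t, (u.fn (x - t) - u.fn x) ∂(bumpMeasure φ) := by
          rw [integral_sub (integrable_bumpMeasure φ u.memLp_fn x) (integrable_const _)]
          simp [mollify]
        rw [← enorm_neg, neg_sub, h1]
        exact enorm_integral_le_lintegral_enorm _
    _ ≤ ∫⁻ t, (∫⁻ x, ‖u.fn (x - t) - u.fn x‖ₑ ^ 2) ∂(bumpMeasure φ) := by
        refine lintegral_sq_lintegral_le _ ?_
        exact ((aemeasurable_comp_sub u.memLp_fn.1 _).sub u.memLp_fn.1.comp_fst).enorm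
    _ ≤ ∫⁻ t, ENNReal.ofReal φ.rOut ^ 2 * (∫⁻ x, ‖u.grad x‖ₑ ^ 2) ∂(bumpMeasure φ) := by
        refine lintegral_mono_ae ?_
        filter_upwards [ae_bumpMeasure_norm_lt φ] with t ht
        refine (u.lintegral_translate_sub_le t).trans ?_
        gcongr
        rw [← ofReal_norm]
        exact ENNReal.ofReal_le_ofReal ht.le
    _ = _ := by simp

lemma H1.memLp_mollify (u : H1) (φ : ContDiffBump (0 : R3)) : MemLp (mollify φ u.fn) 2 volume :=
  ⟨(contDiff_mollify φ u.memLp_fn).continuous.aestronglyMeasurable,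
    (eLpNorm_mollify_le φ u.memLp_fn.1).trans_lt u.memLp_fn.2⟩

lemma H1.integral_sub_mollify_sq_le (u : H1) (φ : ContDiffBump (0 : R3)) :
    ∫ x, (u.fn x - mollify φ u.fn x) ^ 2 ≤ (φ.rOut * ‖u‖) ^ 2 := by
  have h := u.lintegral_sub_mollify_le φ
  have h1 : ENNReal.ofReal (∫ x, (u.fn x - mollify φ u.fn x) ^ 2)
      = ∫⁻ x, ‖u.fn x - mollify φ u.fn x‖ₑ ^ 2 := by
    have hi : Integrable fun x => (u.fn x - mollify φ u.fn x) ^ 2 :=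
      (u.memLp_fn.sub (u.memLp_mollify φ)).integrable_sq
    rw [ofReal_integral_eq_lintegral_ofReal hi (.of_forall fun x => sq_nonneg _)]
    refine lintegral_congr fun x => ?_
    rw [Real.enorm_eq_ofReal_abs, ← ENNReal.ofReal_pow (abs_nonneg _), sq_abs]
  rw [← h1, lintegral_enorm_sq u.grad, H1.eLpNorm_grad, ← mul_pow,
    ← ENNReal.ofReal_mul φ.rOut_pos.le, ← ENNReal.ofReal_pow
      (mul_nonneg φ.rOut_pos.le (norm_nonneg _)),
    ENNReal.ofReal_le_ofReal_iff (by positivity)] at h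
  refine h.trans ?_
  have := φ.rOut_pos
  gcongr
  exact H1.norm_gradL_le u

/-- The value of a mollification at the origin, as a functional on `H¹`. -/
def mollifyL (φ : ContDiffBump (0 : R3)) : H1 →L[ℝ] ℝ :=
  (innerSL ℝ ((φ.continuous_normed.memLp_of_hasCompactSupport
    φ.hasCompactSupport_normed : MemLp (φ.normed (volume : Measure R3)) 2 volume).toLp _)).comp
    H1.fnL

/-- Since the bump is even, evaluation at `y` is one fixed functional applied to the translate by
`-y`. Weak convergence therefore gives pointwise convergence of mollifications, with a bound
independent of `y`. -/
lemma mollify_eq_mollifyL (φ : ContDiffBump (0 : R3)) (u : H1) (y : R3) :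
    mollify φ u.fn y = mollifyL φ (translate (-y) u) := by
  rw [mollifyL, ContinuousLinearMap.comp_apply, innerSL_apply_apply, L2.inner_def,
    mollify_eq_integral]
  rw [← integral_comp_sub _ (-y)]
  refine integral_congr_ae ?_
  have h1 := (φ.continuous_normed.memLp_of_hasCompactSupport
    φ.hasCompactSupport_normed : MemLp (φ.normed (volume : Measure R3)) 2 volume).coeFn_toLp
  filter_upwards [translate_fn (-y) u, h1] with x h2 h3
  rw [h3, ← H1.fn_eq, h2, real_inner_eq_mul', smul_eq_mul, ← φ.normed_neg]
  congr 2
  abel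

/-! ### Elementary inequalities -/

/-- The common pattern of the limit arguments below: `K` does not depend on `κ`, and the null
sequence `b` may. -/
lemma tendsto_zero_of_forall_le {a : ℕ → ℝ} (K : ℝ)
    (h : ∀ κ > 0, ∃ b : ℕ → ℝ, Tendsto b atTop (𝓝 0) ∧ ∀ᶠ n in atTop, |a n| ≤ K * κ + b n) :
    Tendsto a atTop (𝓝 0) := by
  rw [Metric.tendsto_nhds]
  intro ε hε
  obtain ⟨b, hb, hab⟩ := h (ε / (2 * (|K| + 1))) (by positivity)
  filter_upwards [hab, hb.eventually (gt_mem_nhds (half_pos hε))] with n h1 h2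
  rw [Real.dist_0_eq_abs]
  have h3 : K * (ε / (2 * (|K| + 1))) ≤ ε / 2 := by
    calc K * (ε / (2 * (|K| + 1))) ≤ (|K| + 1) * (ε / (2 * (|K| + 1))) := by
          gcongr; linarith [le_abs_self K]
      _ = ε / 2 := by field_simp
  linarith

lemma abs_pow_six (t : ℝ) : |t| ^ 6 = t ^ 6 := (show Even 6 by decide).pow_abs t

lemma mul_le_young {κ a b : ℝ} (hκ : 0 < κ) : |a * b| ≤ κ * a ^ 2 + κ⁻¹ * b ^ 2 := by
  have h : 0 ≤ κ⁻¹ * (κ * |a| - |b|) ^ 2 := by positivity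
  have h1 : κ⁻¹ * (κ * |a| - |b|) ^ 2 = κ * a ^ 2 - 2 * |a * b| + κ⁻¹ * b ^ 2 := by
    rw [abs_mul, ← sq_abs a, ← sq_abs b]; field_simp; ring
  have : 0 ≤ |a * b| := abs_nonneg _
  linarith

/-- The left side is at most the sixth power of the largest of the three numbers. -/
lemma mul_mul_pow_four_le {x y z : ℝ} (hx : 0 ≤ x) (hy : 0 ≤ y) (hz : 0 ≤ z) :
    x * y * z ^ 4 ≤ x ^ 6 + y ^ 6 + z ^ 6 := by
  have key : ∀ m : ℝ, 0 ≤ m → x ≤ m → y ≤ m → z ≤ m → x * y * z ^ 4 ≤ m ^ 6 := by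
    intro m hm h1 h2 h3
    calc x * y * z ^ 4 ≤ m * m * m ^ 4 := by gcongr
      _ = m ^ 6 := by ring
  have hx6 : 0 ≤ x ^ 6 := by positivity
  have hy6 : 0 ≤ y ^ 6 := by positivity
  have hz6 : 0 ≤ z ^ 6 := by positivity
  rcases le_total x y with h1 | h1 <;> rcases le_total y z with h2 | h2 <;>
    rcases le_total x z with h3 | h3
  all_goals first
    | linarith [key x hx le_rfl (by linarith) (by linarith)]
    | linarith [key y hy (by linarith) le_rfl (by linarith)]
    | linarith [key z hz (by linarith) (by linarith) le_rfl]

/-- Interpolation of a subcritical product between degrees two and six. -/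
lemma exists_mul_mul_rpow_le {p : ℝ} (hp : 2 ≤ p) (hp6 : p < 6) {κ : ℝ} (hκ : 0 < κ) :
    ∃ K : ℝ, 0 ≤ K ∧ ∀ x y z : ℝ, 0 ≤ x → 0 ≤ y → 0 ≤ z →
      x * y * z ^ (p - 2) ≤ κ * (x ^ 6 + y ^ 6 + z ^ 6) + K * (x * y) := by
  -- The threshold where `z ^ (p - 6) = κ`. Above it `z ^ (p - 2) ≤ κ * z ^ 4`; below it `z ^ (p -
  -- 2)` is at most the constant `M ^ (p - 2)`.
  set M : ℝ := κ ^ (1 / (p - 6)) with hM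
  have hM0 : 0 < M := Real.rpow_pos_of_pos hκ _
  have hMκ : M ^ (p - 6) = κ := by
    rw [hM, ← Real.rpow_mul hκ.le, one_div_mul_cancel (by linarith), Real.rpow_one]
  refine ⟨M ^ (p - 2), by positivity, fun x y z hx hy hz => ?_⟩
  have hxy : 0 ≤ x * y := mul_nonneg hx hy
  rcases le_total z M with h | h
  · have h1 : z ^ (p - 2) ≤ M ^ (p - 2) := Real.rpow_le_rpow hz h (by linarith)
    have h2 : 0 ≤ κ * (x ^ 6 + y ^ 6 + z ^ 6) := by positivity
    nlinarith
  · have hz0 : 0 < z := hM0.trans_le h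
    have h1 : z ^ (p - 2) = z ^ (p - 6) * z ^ 4 := by
      rw [← Real.rpow_natCast z 4, ← Real.rpow_add hz0]; congr 1; push_cast; ring
    have h2 : z ^ (p - 6) ≤ κ := by
      rw [← hMκ]; exact Real.rpow_le_rpow_of_nonpos hM0 h (by linarith)
    have h3 := mul_mul_pow_four_le hx hy hz
    have h4 : 0 ≤ M ^ (p - 2) * (x * y) := by positivity
    have h5 : 0 ≤ x * y * z ^ 4 := by positivity
    calc x * y * z ^ (p - 2) = z ^ (p - 6) * (x * y * z ^ 4) := by rw [h1]; ring
      _ ≤ κ * (x ^ 6 + y ^ 6 + z ^ 6) := by gcongr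
      _ ≤ _ := by linarith

lemma sq_mul_rpow_sub_two {p t : ℝ} (hp : p ≠ 0) (ht : 0 ≤ t) : t * t * t ^ (p - 2) = t ^ p := by
  rcases ht.eq_or_lt with rfl | h
  · simp [Real.zero_rpow hp]
  · rw [← sq, ← Real.rpow_natCast t 2, ← Real.rpow_add h]; congr 1; push_cast; ring

lemma exists_rpow_le {p : ℝ} (hp : 2 ≤ p) (hp6 : p < 6) {κ : ℝ} (hκ : 0 < κ) :
    ∃ K : ℝ, 0 ≤ K ∧ ∀ t : ℝ, 0 ≤ t → t ^ p ≤ κ * t ^ 6 + K * t ^ 2 := by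
  obtain ⟨K, hK, h⟩ := exists_mul_mul_rpow_le hp hp6 (κ := κ / 3) (by positivity)
  refine ⟨K, hK, fun t ht => ?_⟩
  have := h t t t ht ht ht
  rw [sq_mul_rpow_sub_two (by linarith) ht] at this
  linarith

namespace H1

lemma integrable_rpow (u : H1) {p : ℝ} (hp : 2 ≤ p) (hp6 : p < 6) :
    Integrable fun x => |u.fn x| ^ p := by
  obtain ⟨K, hK, h⟩ := exists_rpow_le hp hp6 one_pos
  refine Integrable.mono' ((u.integrable_pow_six.const_mul 1).add (u.integrable_sq.const_mul K))
    ?_ (.of_forall fun x => ?_)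
  · exact (Real.continuous_rpow_const (by linarith)).comp_aestronglyMeasurable
      (u.aestronglyMeasurable_fn.norm)
  · rw [Real.norm_of_nonneg (by positivity)]
    have h1 := h |u.fn x| (abs_nonneg _)
    rw [abs_pow_six, sq_abs] at h1
    exact h1

end H1

/-! ### Local compactness -/

lemma WeakTo.map_translate {a : ℕ → H1} {b : H1} (h : WeakTo a b) (y : R3) :
    WeakTo (fun n => translate y (a n)) (translate y b) := by
  intro v
  simp_rw [inner_translate]
  exact h _

lemma WeakTo.tendsto_mollify {a : ℕ → H1} {b : H1} (h : WeakTo a b) (φ : ContDiffBump (0 : R3))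
    (y : R3) : Tendsto (fun n => mollify φ (a n).fn y) atTop (𝓝 (mollify φ b.fn y)) := by
  simp_rw [mollify_eq_mollifyL]
  exact (h.map_translate (-y)).apply _

lemma H1.abs_mollify_le (u : H1) (φ : ContDiffBump (0 : R3)) (y : R3) :
    |mollify φ u.fn y| ≤ ‖mollifyL φ‖ * ‖u‖ := by
  rw [mollify_eq_mollifyL, ← norm_translate (-y) u]
  exact (mollifyL φ).le_opNorm _

lemma exists_bump_rOut_lt {κ : ℝ} (hκ : 0 < κ) :
    ∃ φ : ContDiffBump (0 : R3), φ.rOut ^ 2 < κ := by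
  have h := tendsto_rOut_shrinkingBump.pow 2
  obtain ⟨n, hn⟩ := (h.eventually (gt_mem_nhds (by simpa using hκ))).exists
  exact ⟨_, hn⟩

/-- Rellich's theorem: weak convergence in `H¹` implies local strong convergence in `L²`. -/
lemma WeakTo.tendsto_setIntegral_sq {c : ℕ → H1} (h : WeakTo c 0) {C : ℝ}
    (hC : ∀ n, ‖c n‖ ≤ C) {s : Set R3} (hs : volume s ≠ ⊤) :
    Tendsto (fun n => ∫ x in s, (c n).fn x ^ 2) atTop (𝓝 0) := by
  -- With `m` the mollification, `c² ≤ 2 m² + 2 (c - m)²`, and the second part integrates to at most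
  -- `2 * κ * C ^ 2` uniformly in `n`.
  refine tendsto_zero_of_forall_le (2 * C ^ 2) fun κ hκ => ?_
  obtain ⟨φ, hφ⟩ := exists_bump_rOut_lt hκ
  have hC0 : 0 ≤ C := (norm_nonneg _).trans (hC 0)
  have hfin : IsFiniteMeasure (volume.restrict s) := ⟨by simpa using hs.lt_top⟩
  -- For a fixed radius the mollifications tend to zero pointwise and are uniformly bounded, so
  -- dominated convergence applies on a set of finite measure.
  have hlim : Tendsto (fun n => ∫ x in s, mollify φ (c n).fn x ^ 2) atTop (𝓝 0) := by
    have h0 : ∫ _ in s, (0 : ℝ) = 0 := by simp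
    rw [← h0]
    refine tendsto_integral_of_dominated_convergence (fun _ => (‖mollifyL φ‖ * C) ^ 2)
      (fun n => ?_) (integrable_const _) (fun n => .of_forall fun x => ?_)
      (.of_forall fun x => ?_)
    · exact ((contDiff_mollify φ (c n).memLp_fn).continuous.pow 2).aestronglyMeasurable
    · rw [norm_pow, Real.norm_eq_abs]
      gcongr
      refine ((c n).abs_mollify_le φ x).trans ?_
      gcongr
      exact hC n
    · have h1 := (h.tendsto_mollify φ x).pow 2
      have h2 : mollify φ (0 : H1).fn x = 0 := by
        rw [mollify_eq_mollifyL]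
        have : translate (-x) (0 : H1) = 0 := (translateₗᵢ (-x)).map_zero
        rw [this, map_zero]
      rwa [h2, zero_pow two_ne_zero] at h1
  refine ⟨fun n => 2 * ∫ x in s, mollify φ (c n).fn x ^ 2, by simpa using hlim.const_mul 2,
    .of_forall fun n => ?_⟩
  have hd : Integrable fun x => ((c n).fn x - mollify φ (c n).fn x) ^ 2 :=
    ((c n).memLp_fn.sub ((c n).memLp_mollify φ)).integrable_sq
  have hm : Integrable fun x => mollify φ (c n).fn x ^ 2 := ((c n).memLp_mollify φ).integrable_sq
  rw [abs_of_nonneg (integral_nonneg fun x => sq_nonneg _)]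
  calc ∫ x in s, (c n).fn x ^ 2
      ≤ ∫ x in s, (2 * mollify φ (c n).fn x ^ 2
          + 2 * ((c n).fn x - mollify φ (c n).fn x) ^ 2) := by
        refine integral_mono (c n).integrable_sq.integrableOn
          ((hm.const_mul 2).add (hd.const_mul 2)).integrableOn fun x => ?_
        nlinarith [sq_nonneg ((c n).fn x - 2 * mollify φ (c n).fn x)]
    _ = 2 * (∫ x in s, mollify φ (c n).fn x ^ 2)
          + 2 * ∫ x in s, ((c n).fn x - mollify φ (c n).fn x) ^ 2 := by
        rw [integral_add (hm.const_mul 2).integrableOn (hd.const_mul 2).integrableOn,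
          integral_const_mul, integral_const_mul]
    _ ≤ 2 * (∫ x in s, mollify φ (c n).fn x ^ 2) + 2 * (φ.rOut * ‖c n‖) ^ 2 := by
        gcongr
        exact (setIntegral_le_integral hd (.of_forall fun x => sq_nonneg _)).trans
          ((c n).integral_sub_mollify_sq_le φ)
    _ ≤ 2 * C ^ 2 * κ + 2 * ∫ x in s, mollify φ (c n).fn x ^ 2 := by
        have h1 : (φ.rOut * ‖c n‖) ^ 2 ≤ κ * C ^ 2 := by
          rw [mul_pow]
          gcongr
          exact hC n
        linarith

lemma exists_setIntegral_compl_ball_le {f : R3 → ℝ} (hf : Integrable f) {κ : ℝ} (hκ : 0 < κ) :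
    ∃ R : ℝ, 0 < R ∧ |∫ x in (Metric.ball (0 : R3) R)ᶜ, f x| < κ := by
  have h := tendsto_setIntegral_of_antitone (μ := (volume : Measure R3)) (f := f)
    (s := fun n : ℕ => (Metric.ball (0 : R3) n)ᶜ)
    (fun n => Metric.isOpen_ball.measurableSet.compl)
    (fun m n hmn => Set.compl_subset_compl.2 (Metric.ball_subset_ball (by exact_mod_cast hmn)))
    ⟨0, hf.integrableOn⟩
  have he : ⋂ n : ℕ, (Metric.ball (0 : R3) n)ᶜ = ∅ := by
    rw [← Set.compl_iUnion, Metric.iUnion_ball_nat, Set.compl_univ]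
  rw [he, setIntegral_empty] at h
  have h1 := h.abs
  rw [abs_zero] at h1
  obtain ⟨n, hn, hn0⟩ := ((h1.eventually (gt_mem_nhds hκ)).and (eventually_gt_atTop 0)).exists
  exact ⟨n, by exact_mod_cast hn0, hn⟩

/-- Weak null sequences in `H¹` converge to zero against fixed `L²` functions, in `L¹`. -/
lemma WeakTo.tendsto_integral_abs_mul {c : ℕ → H1} (h : WeakTo c 0) {C : ℝ}
    (hC : ∀ n, ‖c n‖ ≤ C) {f : R3 → ℝ} (hf : MemLp f 2 volume) :
    Tendsto (fun n => ∫ x, |(c n).fn x * f x|) atTop (𝓝 0) := by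
  refine tendsto_zero_of_forall_le (C ^ 2 + (∫ x, f x ^ 2) + 1) fun κ hκ => ?_
  have hf2 : Integrable fun x => f x ^ 2 := hf.integrable_sq
  -- The tail is made smaller than `κ * κ` because Young's inequality outside the ball puts the
  -- weight `κ⁻¹` on `f`. Inside the ball that weight falls on `c n`, which Rellich's theorem
  -- controls.
  obtain ⟨R, -, hR⟩ := exists_setIntegral_compl_ball_le hf2 (κ := κ * κ) (by positivity)
  set s := Metric.ball (0 : R3) R with hs
  have hsm : MeasurableSet s := Metric.isOpen_ball.measurableSet
  have hlim := h.tendsto_setIntegral_sq hC (s := s) measure_ball_lt_top.ne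
  refine ⟨fun n => κ⁻¹ * ∫ x in s, (c n).fn x ^ 2, by simpa using hlim.const_mul κ⁻¹,
    .of_forall fun n => ?_⟩
  have hi : Integrable fun x => |(c n).fn x * f x| := ((c n).memLp_fn.integrable_mul hf).abs
  have hc := (c n).integrable_sq
  rw [abs_of_nonneg (integral_nonneg fun x => abs_nonneg _), ← integral_add_compl hsm hi]
  have h1 : ∫ x in s, |(c n).fn x * f x|
      ≤ κ * (∫ x, f x ^ 2) + κ⁻¹ * ∫ x in s, (c n).fn x ^ 2 := by
    calc ∫ x in s, |(c n).fn x * f x| ≤ ∫ x in s, (κ * f x ^ 2 + κ⁻¹ * (c n).fn x ^ 2) := by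
          refine integral_mono hi.integrableOn
            ((hf2.const_mul κ).add (hc.const_mul κ⁻¹)).integrableOn fun x => ?_
          simp only
          rw [mul_comm]
          exact mul_le_young hκ
      _ = κ * (∫ x in s, f x ^ 2) + κ⁻¹ * ∫ x in s, (c n).fn x ^ 2 := by
          rw [integral_add (hf2.const_mul κ).integrableOn (hc.const_mul κ⁻¹).integrableOn,
            integral_const_mul, integral_const_mul]
      _ ≤ _ := by
          exact add_le_add (mul_le_mul_of_nonneg_left (setIntegral_le_integral hf2
            (.of_forall fun x => sq_nonneg _)) hκ.le) le_rfl
  have h2 : ∫ x in sᶜ, |(c n).fn x * f x|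
      ≤ κ * (∫ x, (c n).fn x ^ 2) + κ⁻¹ * ∫ x in sᶜ, f x ^ 2 := by
    calc ∫ x in sᶜ, |(c n).fn x * f x| ≤ ∫ x in sᶜ, (κ * (c n).fn x ^ 2 + κ⁻¹ * f x ^ 2) := by
          refine integral_mono hi.integrableOn
            ((hc.const_mul κ).add (hf2.const_mul κ⁻¹)).integrableOn fun x => mul_le_young hκ
      _ = κ * (∫ x in sᶜ, (c n).fn x ^ 2) + κ⁻¹ * ∫ x in sᶜ, f x ^ 2 := by
          rw [integral_add (hc.const_mul κ).integrableOn (hf2.const_mul κ⁻¹).integrableOn,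
            integral_const_mul, integral_const_mul]
      _ ≤ _ := by
          exact add_le_add (mul_le_mul_of_nonneg_left (setIntegral_le_integral hc
            (.of_forall fun x => sq_nonneg _)) hκ.le) le_rfl
  have h3 : κ⁻¹ * ∫ x in sᶜ, f x ^ 2 ≤ κ := by
    rw [inv_mul_le_iff₀ hκ]; exact (le_abs_self _).trans hR.le
  have h4 : ∫ x, (c n).fn x ^ 2 ≤ C ^ 2 := by
    refine (c n).integral_sq_le.trans ?_
    gcongr
    exact hC n
  nlinarith

/-! ### Escaping translations -/

/-- Once `‖z n‖ ≥ 2 * R`, the points `x` and `x - z n` cannot both lie in the ball of radius `R`. At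
every point one factor is thus in its tail and takes the large Young weight `κ⁻¹`; `F` and `G`
collect the two cases so that the integrals separate. -/
lemma tendsto_integral_translate_mul {f g : R3 → ℝ} (hf : MemLp f 2 volume)
    (hg : MemLp g 2 volume) {z : ℕ → R3} (hz : Tendsto (fun n => ‖z n‖) atTop atTop) :
    Tendsto (fun n => ∫ x, |f (x - z n) * g x|) atTop (𝓝 0) := by
  refine tendsto_zero_of_forall_le (2 + (∫ x, f x ^ 2) + ∫ x, g x ^ 2) fun κ hκ => ?_
  have hf2 : Integrable fun x => f x ^ 2 := hf.integrable_sq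
  have hg2 : Integrable fun x => g x ^ 2 := hg.integrable_sq
  obtain ⟨R, -, hR⟩ := exists_setIntegral_compl_ball_le (hf2.add hg2) (κ := κ * κ) (by positivity)
  set s := (Metric.ball (0 : R3) R)ᶜ with hs
  have hsm : MeasurableSet s := Metric.isOpen_ball.measurableSet.compl
  refine ⟨fun _ => 0, tendsto_const_nhds, ?_⟩
  filter_upwards [hz.eventually_ge_atTop (2 * R)] with n hn
  set F : R3 → ℝ := fun x => κ * f x ^ 2 + κ⁻¹ * s.indicator (fun x => f x ^ 2) x with hF
  set G : R3 → ℝ := fun x => κ * g x ^ 2 + κ⁻¹ * s.indicator (fun x => g x ^ 2) x with hG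
  have hFi : Integrable F := (hf2.const_mul κ).add ((hf2.indicator hsm).const_mul _)
  have hGi : Integrable G := (hg2.const_mul κ).add ((hg2.indicator hsm).const_mul _)
  rw [abs_of_nonneg (integral_nonneg fun x => abs_nonneg _), add_zero]
  have hpt : ∀ x, |f (x - z n) * g x| ≤ F (x - z n) + G x := by
    intro x
    have hn1 : 0 ≤ κ⁻¹ * s.indicator (fun x => f x ^ 2) (x - z n) :=
      mul_nonneg (by positivity) (Set.indicator_nonneg (fun _ _ => sq_nonneg _) _)
    have hn2 : 0 ≤ κ⁻¹ * s.indicator (fun x => g x ^ 2) x :=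
      mul_nonneg (by positivity) (Set.indicator_nonneg (fun _ _ => sq_nonneg _) _)
    have hn3 : 0 ≤ κ * f (x - z n) ^ 2 := by positivity
    have hn4 : 0 ≤ κ * g x ^ 2 := by positivity
    by_cases hx : x ∈ s
    · have := mul_le_young (a := f (x - z n)) (b := g x) hκ
      simp only [hF, hG, Set.indicator_of_mem hx]
      linarith
    · have hx' : x - z n ∈ s := by
        simp only [hs, Set.mem_compl_iff, Metric.mem_ball, dist_zero_right, not_lt] at hx ⊢
        have := norm_sub_norm_le (z n) x
        rw [norm_sub_rev] at this
        linarith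
      have := mul_le_young (a := g x) (b := f (x - z n)) hκ
      rw [mul_comm (f _)]
      simp only [hF, hG, Set.indicator_of_mem hx']
      linarith
  calc ∫ x, |f (x - z n) * g x| ≤ ∫ x, (F (x - z n) + G x) :=
        integral_mono_of_nonneg (.of_forall fun x => abs_nonneg _)
          ((hFi.comp_sub_right (z n)).add hGi) (.of_forall hpt)
    _ = (∫ x, F x) + ∫ x, G x := by
        rw [integral_add (hFi.comp_sub_right (z n)) hGi, integral_comp_sub]
    _ = κ * ((∫ x, f x ^ 2) + ∫ x, g x ^ 2) + κ⁻¹ * ∫ x in s, (f x ^ 2 + g x ^ 2) := by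
        simp only [hF, hG]
        rw [integral_add (hf2.const_mul κ) ((hf2.indicator hsm).const_mul _),
          integral_add (hg2.const_mul κ) ((hg2.indicator hsm).const_mul _),
          integral_add hf2.integrableOn hg2.integrableOn]
        simp only [integral_const_mul, integral_indicator hsm]
        ring
    _ ≤ κ * ((∫ x, f x ^ 2) + ∫ x, g x ^ 2) + κ := by
        gcongr
        rw [inv_mul_le_iff₀ hκ]
        exact (le_abs_self _).trans hR.le
    _ ≤ _ := by linarith

lemma weakTo_translate_of_tendsto_atTop (h : H1) {z : ℕ → R3}
    (hz : Tendsto (fun n => ‖z n‖) atTop atTop) : WeakTo (fun n => translate (z n) h) 0 := by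
  intro g
  rw [inner_zero_left]
  have h1 := tendsto_integral_translate_mul h.memLp_fn g.memLp_fn hz
  have h2 := tendsto_integral_translate_mul h.memLp_grad.norm g.memLp_grad.norm hz
  refine squeeze_zero_norm (fun n => ?_) (by simpa only [add_zero] using h1.add h2)
  rw [H1.inner_eq]
  refine (norm_add_le _ _).trans (add_le_add ?_ ?_)
  · refine (norm_integral_le_integral_norm _).trans (le_of_eq (integral_congr_ae ?_))
    filter_upwards [translate_fn (z n) h] with x hx
    rw [hx, Real.norm_eq_abs]
  · have hi : Integrable fun x => |‖h.grad (x - z n)‖ * ‖g.grad x‖| :=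
      ((h.memLp_grad.norm.comp_measurePreserving
        (measurePreserving_sub (z n))).integrable_mul g.memLp_grad.norm).abs
    refine (norm_integral_le_integral_norm _).trans (integral_mono_of_nonneg
      (.of_forall fun x => norm_nonneg _) hi ?_)
    filter_upwards [translate_grad (z n) h] with x hx
    rw [hx]
    exact (norm_inner_le_norm _ _).trans (le_abs_self _)

/-- If the shifts stayed bounded along a subsequence, they would converge along a further one. Moved
onto a test vector they would converge in norm, and the weak limit would be zero. This is what
forces a new centre to separate from the old ones. -/
lemma tendsto_norm_atTop_of_weakTo_translate {c : ℕ → H1} (hc : WeakTo c 0) {C : ℝ}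
    (hC : ∀ n, ‖c n‖ ≤ C) {z : ℕ → R3} {w : H1} (hw : WeakTo (fun n => translate (z n) (c n)) w)
    (hw0 : w ≠ 0) : Tendsto (fun n => ‖z n‖) atTop atTop := by
  by_contra hcon
  rw [tendsto_atTop] at hcon
  push Not at hcon
  obtain ⟨R, hR⟩ := hcon
  have hfr : ∃ᶠ n in atTop, z n ∈ Metric.closedBall (0 : R3) R := by
    refine hR.mono fun n hn => ?_
    simpa using hn.le
  obtain ⟨z₀, -, σ, hσ, hlim⟩ :=
    (isCompact_closedBall (0 : R3) R).tendsto_subseq' hfr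
  apply hw0
  refine ext_inner_right ℝ fun h => ?_
  rw [inner_zero_left]
  refine tendsto_nhds_unique ((hw.comp hσ) h) ?_
  simp_rw [inner_translate]
  have h1 : Tendsto (fun n => translate (-z (σ n)) h) atTop (𝓝 (translate (-z₀) h)) :=
    ((continuous_translate h).tendsto _).comp hlim.neg
  simpa using (hc.comp hσ).inner_tendsto (fun n => hC _) h1

/-! ### Vanishing sequences -/

/-- A sequence all of whose translates are weakly null. -/
def Vanishing (r : ℕ → H1) : Prop :=
  ∀ y : ℕ → R3, WeakTo (fun n => translate (y n) (r n)) 0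

/-- Vanishing is applied along a sequence `y n` of violating points, chosen whenever any exist. This
freedom in the translations turns pointwise smallness into uniform smallness. -/
lemma Vanishing.eventually_mollify_le {r : ℕ → H1} (h : Vanishing r) (φ : ContDiffBump (0 : R3))
    {η : ℝ} (hη : 0 < η) : ∀ᶠ n in atTop, ∀ x, |mollify φ (r n).fn x| ≤ η := by
  have hex : ∀ n, ∃ y, (∃ x, η < |mollify φ (r n).fn x|) → η < |mollify φ (r n).fn y| := by
    intro n
    by_cases hx : ∃ x, η < |mollify φ (r n).fn x|
    · exact ⟨hx.choose, fun _ => hx.choose_spec⟩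
    · exact ⟨0, fun h => absurd h hx⟩
  choose y hy using hex
  have h1 := ((h fun n => -y n).apply (mollifyL φ)).abs
  simp_rw [← mollify_eq_mollifyL, map_zero, abs_zero] at h1
  filter_upwards [h1.eventually (gt_mem_nhds hη)] with n hn x
  by_contra hx
  exact absurd (hy n ⟨x, not_le.1 hx⟩) (not_lt.2 hn.le)

/-- Lions' lemma: vanishing bounded sequences in `H¹` converge to zero in subcritical `L^q`. -/
lemma Vanishing.tendsto_integral_rpow {r : ℕ → H1} (h : Vanishing r) {C : ℝ}
    (hC : ∀ n, ‖r n‖ ≤ C) {q : ℝ} (hq : 2 < q) (hq6 : q < 6) :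
    Tendsto (fun n => ∫ x, |(r n).fn x| ^ q) atTop (𝓝 0) := by
  obtain ⟨S, hS0, hS⟩ := H1.exists_integral_pow_six_le
  have hC0 : 0 ≤ C := (norm_nonneg _).trans (hC 0)
  refine tendsto_zero_of_forall_le (C ^ 2 + S * C ^ 6 + 4 * C ^ 2) fun κ hκ => ?_
  obtain ⟨K, hK0, hK⟩ := exists_rpow_le hq.le hq6 hκ
  -- The radius is chosen after `K` so that `K` times the mollification error is at most `κ * C ^
  -- 2`.
  obtain ⟨φ, hφ⟩ := exists_bump_rOut_lt (κ := κ / (K + 1)) (by positivity)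
  refine ⟨fun _ => 0, tendsto_const_nhds, ?_⟩
  -- Then `(2 * η) ^ (q - 2) = κ`, so `|t| ^ q ≤ κ * t ^ 2` where `|t| ≤ 2 * η`. Elsewhere `|m| ≤ η`
  -- forces `|t| ≤ 2 * |t - m|`, and the quadratic part of the interpolation is absorbed by the
  -- mollification error.
  set η : ℝ := κ ^ (1 / (q - 2)) / 2 with hη
  have hη0 : 0 < η := by positivity
  have hηκ : (2 * η) ^ (q - 2) = κ := by
    rw [hη, mul_div_cancel₀ _ (two_ne_zero' ℝ), ← Real.rpow_mul hκ.le,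
      one_div_mul_cancel (by linarith), Real.rpow_one]
  filter_upwards [h.eventually_mollify_le φ hη0] with n hn
  have hd : Integrable fun x => ((r n).fn x - mollify φ (r n).fn x) ^ 2 :=
    ((r n).memLp_fn.sub ((r n).memLp_mollify φ)).integrable_sq
  have hpt : ∀ x, |(r n).fn x| ^ q ≤ κ * (r n).fn x ^ 2 + κ * (r n).fn x ^ 6
      + 4 * K * ((r n).fn x - mollify φ (r n).fn x) ^ 2 := by
    intro x
    set t := (r n).fn x
    set m := mollify φ (r n).fn x
    have hm : |m| ≤ η := hn x
    have ht6 : 0 ≤ t ^ 6 := (show Even 6 by decide).pow_nonneg t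
    rcases le_total |t| (2 * η) with h1 | h1
    · have h2 : |t| ^ q ≤ κ * t ^ 2 := by
        rw [← sq_mul_rpow_sub_two (by linarith) (abs_nonneg t), ← sq, sq_abs, mul_comm κ]
        gcongr
        rw [← hηκ]
        exact Real.rpow_le_rpow (abs_nonneg _) h1 (by linarith)
      have h3 : 0 ≤ κ * t ^ 6 := by positivity
      have h4 : 0 ≤ 4 * K * (t - m) ^ 2 := by positivity
      linarith
    · have h2 := hK |t| (abs_nonneg _)
      rw [abs_pow_six, sq_abs] at h2
      have h3 : t ^ 2 ≤ 4 * (t - m) ^ 2 := by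
        have h5 : |t| ≤ 2 * |t - m| := by
          have := abs_sub_abs_le_abs_sub t m
          linarith
        rw [← sq_abs t, ← sq_abs (t - m)]
        nlinarith [abs_nonneg t]
      have h4 : 0 ≤ κ * t ^ 2 := by positivity
      have h5 := mul_le_mul_of_nonneg_left h3 hK0
      linarith
  rw [abs_of_nonneg (integral_nonneg fun x => by positivity), add_zero]
  have h2 : ∫ x, (r n).fn x ^ 2 ≤ C ^ 2 :=
    (r n).integral_sq_le.trans (by gcongr; exact hC n)
  have h6 : ∫ x, (r n).fn x ^ 6 ≤ S * C ^ 6 :=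
    (hS (r n)).trans (by gcongr; exact hC n)
  have h3 : ∫ x, ((r n).fn x - mollify φ (r n).fn x) ^ 2 ≤ κ / (K + 1) * C ^ 2 := by
    refine ((r n).integral_sub_mollify_sq_le φ).trans ?_
    rw [mul_pow]
    gcongr
    exact hC n
  have h4 : K * (κ / (K + 1) * C ^ 2) ≤ κ * C ^ 2 := by
    have : K * (κ / (K + 1)) ≤ κ := by
      rw [← mul_div_assoc, div_le_iff₀ (by positivity)]; nlinarith
    nlinarith [sq_nonneg C]
  calc ∫ x, |(r n).fn x| ^ q
      ≤ ∫ x, (κ * (r n).fn x ^ 2 + κ * (r n).fn x ^ 6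
        + 4 * K * ((r n).fn x - mollify φ (r n).fn x) ^ 2) :=
        integral_mono ((r n).integrable_rpow hq.le hq6)
          ((((r n).integrable_sq.const_mul κ).add ((r n).integrable_pow_six.const_mul κ)).add
            (hd.const_mul _)) hpt
    _ = κ * (∫ x, (r n).fn x ^ 2) + κ * (∫ x, (r n).fn x ^ 6)
        + 4 * K * ∫ x, ((r n).fn x - mollify φ (r n).fn x) ^ 2 := by
        have hi : Integrable fun x => κ * (r n).fn x ^ 2 + κ * (r n).fn x ^ 6 :=
          ((r n).integrable_sq.const_mul κ).add ((r n).integrable_pow_six.const_mul κ)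
        rw [integral_add hi (hd.const_mul _),
          integral_add ((r n).integrable_sq.const_mul κ) ((r n).integrable_pow_six.const_mul κ)]
        simp only [integral_const_mul]
    _ ≤ _ := by nlinarith

/-! ### Newtonian potentials -/

/-- The singular part of the squared Newtonian kernel. -/
def kernelSq (δ : ℝ) (x : R3) : ℝ := if ‖x‖ < δ then (‖x‖ ^ 2)⁻¹ else 0

/-- Three times the volume of the unit ball. -/
def kernelConst : ℝ := 3 * (volume : Measure R3).real (Metric.ball 0 1)

lemma kernelConst_nonneg : 0 ≤ kernelConst := by unfold kernelConst; positivity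

/-- In dimension three the polar Jacobian `r ^ 2` cancels the singularity exactly, so the squared
kernel near the origin has integral proportional to `δ`. -/
lemma radial_kernelSq (δ : ℝ) : Set.EqOn
    (fun y : ℝ => y ^ (Module.finrank ℝ R3 - 1) • (if y < δ then (y ^ 2)⁻¹ else 0))
    ((Set.Iio δ).indicator fun _ => (1 : ℝ)) (Set.Ioi 0) := by
  intro y hy
  have hy0 : y ≠ 0 := ne_of_gt hy
  by_cases h : y < δ
  · simp [h, hy0]
  · simp [h]

lemma integrable_kernelSq (δ : ℝ) : Integrable (kernelSq δ) := by
  have h := (integrable_fun_norm_addHaar (volume : Measure R3)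
    (f := fun r : ℝ => if r < δ then (r ^ 2)⁻¹ else 0)).2 ?_
  · exact h
  · refine (integrableOn_congr_fun (radial_kernelSq δ) measurableSet_Ioi).2 ?_
    rw [IntegrableOn, integrable_indicator_iff measurableSet_Iio]
    refine integrableOn_const ?_
    rw [Measure.restrict_apply measurableSet_Iio, Set.Iio_inter_Ioi]
    exact measure_Ioo_lt_top.ne

lemma integral_kernelSq {δ : ℝ} (hδ : 0 < δ) : ∫ x, kernelSq δ x = kernelConst * δ := by
  have h := integral_fun_norm_addHaar (volume : Measure R3)
    (f := fun r : ℝ => if r < δ then (r ^ 2)⁻¹ else 0)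
  rw [setIntegral_congr_fun measurableSet_Ioi (radial_kernelSq δ),
    setIntegral_indicator measurableSet_Iio, Set.Ioi_inter_Iio] at h
  simp only [kernelSq, kernelConst]
  rw [h]
  simp [hδ.le]
  ring

/-- Functions in `L¹ ∩ L²`. -/
structure L1L2 (f : R3 → ℝ) : Prop where
  integrable : Integrable f
  memLp_two : MemLp f 2 volume

namespace L1L2

variable {f g : R3 → ℝ}

lemma integrable_sq (hf : L1L2 f) : Integrable fun x => f x ^ 2 := hf.memLp_two.integrable_sq

lemma abs (hf : L1L2 f) : L1L2 fun x => |f x| := ⟨hf.1.abs, hf.2.norm⟩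

lemma add (hf : L1L2 f) (hg : L1L2 g) : L1L2 fun x => f x + g x := ⟨hf.1.add hg.1, hf.2.add hg.2⟩

lemma const_mul (hf : L1L2 f) (c : ℝ) : L1L2 fun x => c * f x :=
  ⟨hf.1.const_mul c, hf.2.const_mul c⟩

end L1L2

/-- The Newtonian potential `|x|⁻¹ ∗ f`. -/
def newton (f : R3 → ℝ) (x : R3) : ℝ := ∫ y, f y / ‖x - y‖

/-- A pointwise majorant of the integrand of a Newtonian potential. -/
def newtonBound (f : R3 → ℝ) (η δ R : ℝ) (x y : R3) : ℝ :=
  η * f y ^ 2 + η⁻¹ * kernelSq δ (x - y) + δ⁻¹ * (Metric.ball x R).indicator (fun y => |f y|) y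
    + R⁻¹ * |f y|

section

variable {f g : R3 → ℝ}

/-- Three zones: below distance `δ` Young's inequality pairs `f` with the squared kernel, between
`δ` and `R` the kernel is at most `δ⁻¹`, and beyond `R` at most `R⁻¹`. -/
lemma abs_div_norm_le_newtonBound (f : R3 → ℝ) {η δ R : ℝ} (hη : 0 < η) (hδ : 0 < δ) (hR : 0 < R)
    (x y : R3) : |f y / ‖x - y‖| ≤ newtonBound f η δ R x y := by
  have h1 : 0 ≤ η * f y ^ 2 := by positivity
  have h2 : 0 ≤ η⁻¹ * kernelSq δ (x - y) := by
    unfold kernelSq; split_ifs <;> positivity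
  have h3 : 0 ≤ δ⁻¹ * (Metric.ball x R).indicator (fun y => |f y|) y :=
    mul_nonneg (by positivity) (Set.indicator_nonneg (fun _ _ => abs_nonneg _) _)
  have h4 : 0 ≤ R⁻¹ * |f y| := by positivity
  unfold newtonBound
  rcases lt_or_ge ‖x - y‖ δ with h | h
  · have h5 := mul_le_young (a := f y) (b := ‖x - y‖⁻¹) hη
    have h6 : kernelSq δ (x - y) = ‖x - y‖⁻¹ ^ 2 := by simp [kernelSq, h]
    rw [div_eq_mul_inv, h6]
    rw [h6] at h2
    linarith
  · rcases lt_or_ge ‖x - y‖ R with h' | h'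
    · have hy : y ∈ Metric.ball x R := by rwa [Metric.mem_ball, dist_comm, dist_eq_norm]
      rw [Set.indicator_of_mem hy] at h3 ⊢
      have h5 : |f y / ‖x - y‖| ≤ δ⁻¹ * |f y| := by
        rw [abs_div, abs_norm, div_eq_inv_mul]
        gcongr
      linarith
    · have h5 : |f y / ‖x - y‖| ≤ R⁻¹ * |f y| := by
        rw [abs_div, abs_norm, div_eq_inv_mul]
        gcongr
      linarith

lemma L1L2.integrable_newtonBound (hf : L1L2 f) (η δ R : ℝ) (x : R3) :
    Integrable (newtonBound f η δ R x) :=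
  (((hf.integrable_sq.const_mul η).add (((integrable_kernelSq δ).comp_sub_left x).const_mul _)).add
    ((hf.1.abs.indicator Metric.isOpen_ball.measurableSet).const_mul _)).add
      (hf.1.abs.const_mul _)

lemma L1L2.integral_newtonBound (hf : L1L2 f) (η : ℝ) {δ : ℝ} (hδ : 0 < δ) (R : ℝ) (x : R3) :
    ∫ y, newtonBound f η δ R x y = η * (∫ y, f y ^ 2) + η⁻¹ * (kernelConst * δ)
      + δ⁻¹ * (∫ y in Metric.ball x R, |f y|) + R⁻¹ * ∫ y, |f y| := by
  have i1 := hf.integrable_sq.const_mul η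
  have i2 := ((integrable_kernelSq δ).comp_sub_left x).const_mul η⁻¹
  have i3 := (hf.1.abs.indicator (Metric.isOpen_ball (x := x) (ε := R)).measurableSet).const_mul δ⁻¹
  have i4 := hf.1.abs.const_mul R⁻¹
  have i12 : Integrable fun y => η * f y ^ 2 + η⁻¹ * kernelSq δ (x - y) := i1.add i2
  have i123 : Integrable fun y => η * f y ^ 2 + η⁻¹ * kernelSq δ (x - y)
    + δ⁻¹ * (Metric.ball x R).indicator (fun y => |f y|) y := i12.add i3
  unfold newtonBound
  rw [integral_add i123 i4, integral_add i12 i3, integral_add i1 i2]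
  simp only [integral_const_mul, integral_indicator Metric.isOpen_ball.measurableSet,
    integral_sub_left_eq_self (kernelSq δ) volume x, integral_kernelSq hδ]

lemma L1L2.integrable_newton (hf : L1L2 f) (x : R3) : Integrable fun y => f y / ‖x - y‖ := by
  refine (hf.integrable_newtonBound 1 1 1 x).mono' ?_
    (.of_forall fun y => abs_div_norm_le_newtonBound f one_pos one_pos one_pos x y)
  exact (hf.1.1.aemeasurable.div (by fun_prop)).aestronglyMeasurable

lemma abs_newton_le (f : R3 → ℝ) (x : R3) : |newton f x| ≤ newton (fun y => |f y|) x := by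
  refine (norm_integral_le_integral_norm fun y => f y / ‖x - y‖).trans (le_of_eq ?_)
  simp only [newton, norm_div, abs_norm, Real.norm_eq_abs]

/-- The parameters remain free for two uses. For weakly null products the local mass tends to zero;
for vanishing sequences `∫ f²` does. In each case that term may carry a large coefficient while the
other three are made small. -/
lemma L1L2.newton_abs_le (hf : L1L2 f) {η δ R : ℝ} (hη : 0 < η) (hδ : 0 < δ) (hR : 0 < R)
    (x : R3) : newton (fun y => |f y|) x ≤ η * (∫ y, f y ^ 2) + η⁻¹ * (kernelConst * δ)
      + δ⁻¹ * (∫ y in Metric.ball x R, |f y|) + R⁻¹ * ∫ y, |f y| := by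
  rw [← hf.integral_newtonBound η hδ R x]
  refine integral_mono (hf.abs.integrable_newton x) (hf.integrable_newtonBound _ _ _ _) fun y => ?_
  refine le_trans (le_of_eq ?_) (abs_div_norm_le_newtonBound f hη hδ hR x y)
  rw [abs_div, abs_norm]

lemma L1L2.newton_abs_le_const (hf : L1L2 f) {M : ℝ} (h1 : ∫ y, |f y| ≤ M)
    (h2 : ∫ y, f y ^ 2 ≤ M) (x : R3) :
    newton (fun y => |f y|) x ≤ 3 * M + kernelConst := by
  have h := hf.newton_abs_le one_pos one_pos one_pos x
  have h3 : ∫ y in Metric.ball x 1, |f y| ≤ ∫ y, |f y| :=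
    setIntegral_le_integral hf.1.abs (.of_forall fun y => abs_nonneg _)
  linarith

lemma L1L2.exists_abs_newton_le (hf : L1L2 f) : ∃ M, ∀ x, |newton f x| ≤ M :=
  ⟨_, fun x => (abs_newton_le f x).trans
    (hf.newton_abs_le_const (le_max_left _ (∫ y, f y ^ 2)) (le_max_right _ _) x)⟩

lemma aestronglyMeasurable_newton_prod (hf : AEStronglyMeasurable f volume) :
    AEStronglyMeasurable (fun p : R3 × R3 => f p.2 / ‖p.1 - p.2‖)
      ((volume : Measure R3).prod volume) :=
  (hf.comp_snd.aemeasurable.div (by fun_prop)).aestronglyMeasurable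

lemma aestronglyMeasurable_newton (hf : AEStronglyMeasurable f volume) :
    AEStronglyMeasurable (newton f) volume :=
  (aestronglyMeasurable_newton_prod hf).integral_prod_right'

lemma newton_congr (h : f =ᵐ[volume] g) : newton f = newton g := by
  ext x
  refine integral_congr_ae ?_
  filter_upwards [h] with y hy
  rw [hy]

lemma newton_add (hf : L1L2 f) (hg : L1L2 g) (x : R3) :
    newton (fun y => f y + g y) x = newton f x + newton g x := by
  simp only [newton, add_div]
  exact integral_add (hf.integrable_newton x) (hg.integrable_newton x)

lemma newton_const_mul (c : ℝ) (x : R3) : newton (fun y => c * f y) x = c * newton f x := by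
  simp only [newton, mul_div_assoc, integral_const_mul]

lemma newton_comp_sub (f : R3 → ℝ) (z x : R3) :
    newton (fun y => f (y - z)) x = newton f (x - z) := by
  rw [newton, newton, ← integral_comp_sub (fun y => f y / ‖x - z - y‖) z]
  refine integral_congr_ae (.of_forall fun y => ?_)
  simp

lemma L1L2.integrable_mul_newton (hf : Integrable f) (hg : L1L2 g) :
    Integrable fun x => f x * newton g x := by
  obtain ⟨M, hM⟩ := hg.exists_abs_newton_le
  exact hf.mul_bdd (aestronglyMeasurable_newton hg.1.1) (.of_forall hM)

/-- The Coulomb form `∬ f(x) g(y) / |x - y| dx dy`. -/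
def coulombForm (f g : R3 → ℝ) : ℝ := ∫ x, f x * newton g x

lemma coulombForm_congr {f' g' : R3 → ℝ} (hf : f =ᵐ[volume] f') (hg : g =ᵐ[volume] g') :
    coulombForm f g = coulombForm f' g' := by
  rw [coulombForm, coulombForm, newton_congr hg]
  refine integral_congr_ae ?_
  filter_upwards [hf] with x hx
  rw [hx]

/-- Fubini for a symmetric kernel; absolute integrability comes from the boundedness of the
potential of `|g|`. -/
lemma coulombForm_comm (hf : L1L2 f) (hg : L1L2 g) : coulombForm f g = coulombForm g f := by
  have h : Integrable (Function.uncurry fun x y : R3 => f x * (g y / ‖x - y‖))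
      ((volume : Measure R3).prod volume) := by
    have hm : AEStronglyMeasurable (Function.uncurry fun x y : R3 => f x * (g y / ‖x - y‖))
      ((volume : Measure R3).prod volume) :=
      hf.1.1.comp_fst.mul (aestronglyMeasurable_newton_prod hg.1.1)
    rw [integrable_prod_iff hm]
    refine ⟨.of_forall fun x => (hg.integrable_newton x).const_mul (f x), ?_⟩
    refine (L1L2.integrable_mul_newton hf.1.abs hg.abs).congr (.of_forall fun x => ?_)
    simp only [Function.uncurry_apply_pair, norm_mul, norm_div, abs_norm, Real.norm_eq_abs,
      integral_const_mul, newton]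
  have hs := integral_integral_swap h
  simp only [integral_const_mul] at hs
  rw [coulombForm, coulombForm]
  simp only [newton, ← integral_const_mul] at hs ⊢
  rw [hs]
  refine integral_congr_ae (.of_forall fun x => integral_congr_ae (.of_forall fun y => ?_))
  simp only [norm_sub_rev x y]
  ring

lemma coulombForm_add_left {f' : R3 → ℝ} (hf : L1L2 f) (hf' : L1L2 f') (hg : L1L2 g) :
    coulombForm (fun x => f x + f' x) g = coulombForm f g + coulombForm f' g := by
  simp only [coulombForm, add_mul]
  exact integral_add (L1L2.integrable_mul_newton hf.1 hg) (L1L2.integrable_mul_newton hf'.1 hg)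

lemma coulombForm_add_right {g' : R3 → ℝ} (hf : L1L2 f) (hg : L1L2 g) (hg' : L1L2 g') :
    coulombForm f (fun x => g x + g' x) = coulombForm f g + coulombForm f g' := by
  simp only [coulombForm, newton_add hg hg', mul_add]
  exact integral_add (L1L2.integrable_mul_newton hf.1 hg) (L1L2.integrable_mul_newton hf.1 hg')

lemma coulombForm_const_mul_left (c : ℝ) :
    coulombForm (fun x => c * f x) g = c * coulombForm f g := by
  simp only [coulombForm, mul_assoc, integral_const_mul]

lemma coulombForm_const_mul_right (c : ℝ) :
    coulombForm f (fun x => c * g x) = c * coulombForm f g := by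
  simp only [coulombForm, newton_const_mul, mul_left_comm _ c, integral_const_mul]

lemma abs_coulombForm_le (hf : Integrable f) {M : ℝ} (hg : ∀ x, newton (fun y => |g y|) x ≤ M) :
    |coulombForm f g| ≤ M * ∫ x, |f x| := by
  rw [← integral_const_mul]
  refine (norm_integral_le_integral_norm fun x => f x * newton g x).trans
    (integral_mono_of_nonneg (.of_forall fun x => norm_nonneg (f x * newton g x))
      (hf.abs.const_mul M) (.of_forall fun x => ?_))
  simp only [norm_mul, Real.norm_eq_abs]
  rw [mul_comm]
  gcongr
  exact (abs_newton_le g x).trans (hg x)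

end

/-! ### Products of `H¹` functions -/

namespace H1

lemma integrable_pow_four (u : H1) : Integrable fun x => u.fn x ^ 4 := by
  refine (u.integrable_sq.add u.integrable_pow_six).mono' (u.aestronglyMeasurable_fn.pow 4)
    (.of_forall fun x => ?_)
  rw [Real.norm_of_nonneg ((show Even 4 by decide).pow_nonneg _)]
  simp only [Pi.add_apply]
  nlinarith [sq_nonneg (u.fn x * (u.fn x ^ 2 - 1)), sq_nonneg (u.fn x ^ 3), sq_nonneg (u.fn x)]

/-- A common bound for the integrals of powers over bounded sets of `H¹`. -/
lemma exists_integral_pow_le (C : ℝ) : ∃ M, 0 ≤ M ∧ ∀ u : H1, ‖u‖ ≤ C →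
    ∫ x, u.fn x ^ 2 ≤ M ∧ ∫ x, u.fn x ^ 4 ≤ M ∧ ∫ x, u.fn x ^ 6 ≤ M := by
  obtain ⟨S, hS0, hS⟩ := exists_integral_pow_six_le
  refine ⟨|C| ^ 2 + S * |C| ^ 6, by positivity, fun u hu => ?_⟩
  have hu' : ‖u‖ ≤ |C| := hu.trans (le_abs_self C)
  have h2 : ∫ x, u.fn x ^ 2 ≤ |C| ^ 2 := u.integral_sq_le.trans (by gcongr)
  have h6 : ∫ x, u.fn x ^ 6 ≤ S * |C| ^ 6 := (hS u).trans (by gcongr)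
  have h4 : ∫ x, u.fn x ^ 4 ≤ (∫ x, u.fn x ^ 2) + ∫ x, u.fn x ^ 6 := by
    rw [← integral_add u.integrable_sq u.integrable_pow_six]
    refine integral_mono u.integrable_pow_four (u.integrable_sq.add u.integrable_pow_six)
      fun x => ?_
    simp only
    nlinarith [sq_nonneg (u.fn x * (u.fn x ^ 2 - 1)), sq_nonneg (u.fn x ^ 3), sq_nonneg (u.fn x)]
  have h2' : 0 ≤ |C| ^ 2 := by positivity
  have h6' : 0 ≤ S * |C| ^ 6 := by positivity
  exact ⟨by linarith, by linarith, by linarith⟩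

/-- Each factor lies in `L⁴`, between `L²` and `L⁶`, so the product is square integrable. Products
of `H¹` functions are exactly the densities that occur in the Coulomb terms. -/
lemma L1L2_mul (u v : H1) : L1L2 fun x => u.fn x * v.fn x := by
  refine ⟨u.integrable_mul v, ?_⟩
  have hm : AEStronglyMeasurable (fun x => u.fn x * v.fn x) volume :=
    u.aestronglyMeasurable_fn.mul v.aestronglyMeasurable_fn
  rw [memLp_two_iff_integrable_sq hm]
  refine (u.integrable_pow_four.add v.integrable_pow_four).mono' (hm.pow 2)
    (.of_forall fun x => ?_)
  rw [Real.norm_of_nonneg (sq_nonneg _)]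
  simp only [Pi.add_apply]
  nlinarith [sq_nonneg (u.fn x ^ 2 - v.fn x ^ 2), sq_nonneg (u.fn x ^ 2), sq_nonneg (v.fn x ^ 2)]

lemma L1L2_sq (u : H1) : L1L2 fun x => u.fn x ^ 2 := by
  simpa only [sq] using u.L1L2_mul u

lemma exists_integral_mul_le (C : ℝ) : ∃ M, 0 ≤ M ∧ ∀ u v : H1, ‖u‖ ≤ C → ‖v‖ ≤ C →
    ∫ x, |u.fn x * v.fn x| ≤ M ∧ ∫ x, (u.fn x * v.fn x) ^ 2 ≤ M := by
  obtain ⟨M, hM0, hM⟩ := exists_integral_pow_le C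
  refine ⟨2 * M, by positivity, fun u v hu hv => ⟨?_, ?_⟩⟩
  · calc ∫ x, |u.fn x * v.fn x| ≤ ∫ x, (u.fn x ^ 2 + v.fn x ^ 2) := by
          refine integral_mono (u.integrable_mul v).abs (u.integrable_sq.add v.integrable_sq)
            fun x => ?_
          simpa using mul_le_young (a := u.fn x) (b := v.fn x) one_pos
      _ ≤ 2 * M := by
          rw [integral_add u.integrable_sq v.integrable_sq]
          linarith [(hM u hu).1, (hM v hv).1]
  · calc ∫ x, (u.fn x * v.fn x) ^ 2 ≤ ∫ x, (u.fn x ^ 4 + v.fn x ^ 4) := by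
          refine integral_mono (u.L1L2_mul v).integrable_sq
            (u.integrable_pow_four.add v.integrable_pow_four) fun x => ?_
          simp only
          nlinarith [sq_nonneg (u.fn x ^ 2 - v.fn x ^ 2), sq_nonneg (u.fn x ^ 2),
            sq_nonneg (v.fn x ^ 2)]
      _ ≤ 2 * M := by
          rw [integral_add u.integrable_pow_four v.integrable_pow_four]
          linarith [(hM u hu).2.1, (hM v hv).2.1]

lemma exists_newton_mul_le (C : ℝ) : ∃ M, 0 ≤ M ∧ ∀ u v : H1, ‖u‖ ≤ C → ‖v‖ ≤ C →
    ∀ x, newton (fun y => |u.fn y * v.fn y|) x ≤ M := by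
  obtain ⟨M, hM0, hM⟩ := exists_integral_mul_le C
  refine ⟨3 * M + kernelConst, add_nonneg (by positivity) kernelConst_nonneg,
    fun u v hu hv x => ?_⟩
  exact (u.L1L2_mul v).newton_abs_le_const (hM u v hu hv).1 (hM u v hu hv).2 x

lemma coulomb_eq (u : H1) : coulomb u = newton fun y => u.fn y ^ 2 := by
  ext x; simp only [coulomb, newton, sq_abs]

lemma coulombEnergy_eq (u : H1) :
    coulombEnergy u = coulombForm (fun x => u.fn x ^ 2) (fun x => u.fn x ^ 2) := by
  simp only [coulombEnergy, coulombForm, newton, sq_abs, mul_div_assoc, integral_const_mul]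

end H1

/-! ### Limits of Coulomb terms -/

section

variable {c a : ℕ → H1} {C : ℝ}

lemma WeakTo.tendsto_setIntegral_abs_mul (h : WeakTo c 0) (hC : ∀ n, ‖c n‖ ≤ C)
    (ha : ∀ n, ‖a n‖ ≤ C) {s : Set R3} (hs : volume s ≠ ⊤) :
    Tendsto (fun n => ∫ x in s, |(c n).fn x * (a n).fn x|) atTop (𝓝 0) := by
  refine tendsto_zero_of_forall_le (C ^ 2) fun κ hκ => ?_
  refine ⟨fun n => κ⁻¹ * ∫ x in s, (c n).fn x ^ 2,
    by simpa using (h.tendsto_setIntegral_sq hC hs).const_mul κ⁻¹, .of_forall fun n => ?_⟩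
  have hc := (c n).integrable_sq
  have han := (a n).integrable_sq
  rw [abs_of_nonneg (integral_nonneg fun x => abs_nonneg _)]
  calc ∫ x in s, |(c n).fn x * (a n).fn x|
      ≤ ∫ x in s, (κ * (a n).fn x ^ 2 + κ⁻¹ * (c n).fn x ^ 2) := by
        refine integral_mono ((c n).integrable_mul (a n)).abs.integrableOn
          ((han.const_mul κ).add (hc.const_mul κ⁻¹)).integrableOn fun x => ?_
        simp only
        rw [mul_comm]
        exact mul_le_young hκ
    _ = κ * (∫ x in s, (a n).fn x ^ 2) + κ⁻¹ * ∫ x in s, (c n).fn x ^ 2 := by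
        rw [integral_add (han.const_mul κ).integrableOn (hc.const_mul κ⁻¹).integrableOn,
          integral_const_mul, integral_const_mul]
    _ ≤ _ := by
        refine add_le_add ?_ le_rfl
        rw [mul_comm]
        refine mul_le_mul_of_nonneg_right ?_ hκ.le
        refine (setIntegral_le_integral han (.of_forall fun x => sq_nonneg _)).trans ?_
        refine (a n).integral_sq_le.trans ?_
        gcongr
        exact ha n

lemma WeakTo.tendsto_newton_abs_mul (h : WeakTo c 0) (hC : ∀ n, ‖c n‖ ≤ C)
    (ha : ∀ n, ‖a n‖ ≤ C) (x : R3) :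
    Tendsto (fun n => newton (fun y => |(c n).fn y * (a n).fn y|) x) atTop (𝓝 0) := by
  obtain ⟨M, hM0, hM⟩ := H1.exists_integral_mul_le C
  refine tendsto_zero_of_forall_le (2 * M + kernelConst) fun κ hκ => ?_
  have hlim := (h.tendsto_setIntegral_abs_mul hC ha
    (s := Metric.ball x κ⁻¹) measure_ball_lt_top.ne).const_mul (κ ^ 2)⁻¹
  rw [mul_zero] at hlim
  refine ⟨_, hlim, .of_forall fun n => ?_⟩
  -- With `η = κ`, `δ = κ ^ 2` and `R = κ⁻¹` the three nonlocal terms are of order `κ`; the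
  -- coefficient of the local mass is large but fixed.
  have h1 := ((c n).L1L2_mul (a n)).newton_abs_le hκ (δ := κ ^ 2) (R := κ⁻¹) (by positivity)
    (by positivity) x
  obtain ⟨h2, h3⟩ := hM (c n) (a n) (hC n) (ha n)
  have h0 : 0 ≤ newton (fun y => |(c n).fn y * (a n).fn y|) x :=
    integral_nonneg fun y => by positivity
  rw [abs_of_nonneg h0]
  refine h1.trans ?_
  rw [inv_inv]
  have h4 : κ⁻¹ * (kernelConst * κ ^ 2) = kernelConst * κ := by field_simp
  rw [h4]
  have h5 := mul_le_mul_of_nonneg_left h2 hκ.le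
  have h6 := mul_le_mul_of_nonneg_left h3 hκ.le
  linarith

/-- Coulomb energies of weakly null products against a fixed density tend to zero. -/
lemma WeakTo.tendsto_coulombForm (h : WeakTo c 0) (hC : ∀ n, ‖c n‖ ≤ C)
    (ha : ∀ n, ‖a n‖ ≤ C) {f : R3 → ℝ} (hf : Integrable f) :
    Tendsto (fun n => coulombForm f fun y => (c n).fn y * (a n).fn y) atTop (𝓝 0) := by
  obtain ⟨M, hM0, hM⟩ := H1.exists_newton_mul_le C
  have h0 : ∫ _ : R3, (0 : ℝ) = 0 := by simp
  rw [← h0]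
  -- The potentials tend to zero pointwise and are uniformly bounded, so the fixed density `f`
  -- provides the majorant.
  refine tendsto_integral_of_dominated_convergence (fun x => |f x| * M) (fun n => ?_)
    (hf.abs.mul_const M) (fun n => .of_forall fun x => ?_) (.of_forall fun x => ?_)
  · exact hf.1.mul (aestronglyMeasurable_newton ((c n).integrable_mul (a n)).1)
  · rw [norm_mul, Real.norm_eq_abs, Real.norm_eq_abs]
    gcongr
    exact (abs_newton_le _ x).trans (hM _ _ (hC n) (ha n) x)
  · have h1 : Tendsto (fun n => newton (fun y => (c n).fn y * (a n).fn y) x) atTop (𝓝 0) :=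
      squeeze_zero_norm (fun n => abs_newton_le _ x) (h.tendsto_newton_abs_mul hC ha x)
    simpa using h1.const_mul (f x)

lemma tendsto_coulombForm_of_tendsto_integral {f : ℕ → R3 → ℝ} (hf : ∀ n, Integrable (f n))
    (hlim : Tendsto (fun n => ∫ x, |f n x|) atTop (𝓝 0)) {g : ℕ → R3 → ℝ} {M : ℝ}
    (hg : ∀ n x, newton (fun y => |g n y|) x ≤ M) :
    Tendsto (fun n => coulombForm (f n) (g n)) atTop (𝓝 0) :=
  squeeze_zero_norm (fun n => abs_coulombForm_le (hf n) (hg n)) (by simpa using hlim.const_mul M)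

/-- Weak continuity of the Coulomb term of the equation. -/
lemma WeakTo.tendsto_coulomb_mul {w : H1} (h : WeakTo a w) (ha : ∀ n, ‖a n‖ ≤ C) (v : H1) :
    Tendsto (fun n => ∫ x, coulomb (a n) x * (a n).fn x * v.fn x) atTop
      (𝓝 (∫ x, coulomb w x * w.fn x * v.fn x)) := by
  have key : ∀ u : H1, ∫ x, coulomb u x * u.fn x * v.fn x
      = coulombForm (fun x => u.fn x * v.fn x) (fun x => u.fn x ^ 2) := by
    intro u
    rw [H1.coulomb_eq]
    refine integral_congr_ae (.of_forall fun x => ?_)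
    ring
  set D : ℝ := C + ‖w‖ + ‖w‖ with hD
  have hC0 : 0 ≤ C := (norm_nonneg _).trans (ha 0)
  have hw0 := norm_nonneg w
  have hcD : ∀ n, ‖a n - w‖ ≤ D := fun n =>
    (norm_sub_le _ _).trans (by linarith [ha n])
  have hbD : ∀ n, ‖a n + w‖ ≤ D := fun n =>
    (norm_add_le _ _).trans (by linarith [ha n])
  have haD : ∀ n, ‖a n‖ ≤ D := fun n => by linarith [ha n]
  obtain ⟨M, hM0, hM⟩ := H1.exists_newton_mul_le D
  have h0 := h.sub_self
  -- Write `a v = (a - w) v + w v` and `a² = (a - w)(a + w) + w²`. The first error has a density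
  -- tending to zero in `L¹` against bounded potentials; the second has a fixed density `w v`
  -- against potentials of weakly null products.
  have t1 : Tendsto (fun n => coulombForm (fun x => (a n - w).fn x * v.fn x)
      (fun x => (a n).fn x ^ 2)) atTop (𝓝 0) := by
    refine tendsto_coulombForm_of_tendsto_integral (M := M) (fun n => H1.integrable_mul _ _)
      (h0.tendsto_integral_abs_mul hcD v.memLp_fn) fun n x => ?_
    simpa only [sq] using hM _ _ (haD n) (haD n) x
  have t2 := h0.tendsto_coulombForm hcD hbD (w.integrable_mul v)
  simp only [key]
  have h3 := (t1.add t2).add_const (coulombForm (fun x => w.fn x * v.fn x) fun x => w.fn x ^ 2)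
  rw [zero_add, zero_add] at h3
  refine h3.congr fun n => ?_
  have e1 : (fun x => (a n).fn x * v.fn x) =ᵐ[volume]
      fun x => (a n - w).fn x * v.fn x + w.fn x * v.fn x := by
    filter_upwards [H1.fn_sub (a n) w] with x hx
    rw [hx]; ring
  have e2 : (fun x => (a n).fn x ^ 2) =ᵐ[volume]
      fun x => (a n - w).fn x * (a n + w).fn x + w.fn x ^ 2 := by
    filter_upwards [H1.fn_sub (a n) w, H1.fn_add (a n) w] with x hx hx'
    rw [hx, hx']; ring
  rw [coulombForm_congr e1 (ae_eq_refl _), coulombForm_add_left (H1.L1L2_mul _ _)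
    (H1.L1L2_mul _ _) (H1.L1L2_sq _), coulombForm_congr (f := fun x => w.fn x * v.fn x)
    (ae_eq_refl _) e2, coulombForm_add_right (H1.L1L2_mul _ _) (H1.L1L2_mul _ _) (H1.L1L2_sq _)]
  ring

/-- Asymptotic additivity of the Coulomb energy. -/
lemma WeakTo.tendsto_coulombEnergy_sub (h : WeakTo c 0) (hC : ∀ n, ‖c n‖ ≤ C) (w : H1) :
    Tendsto (fun n => coulombEnergy (c n + w) - coulombEnergy (c n) - coulombEnergy w) atTop
      (𝓝 0) := by
  set D : ℝ := max C ‖w‖ with hD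
  have hcD : ∀ n, ‖c n‖ ≤ D := fun n => (hC n).trans (le_max_left _ _)
  have hwD : ‖w‖ ≤ D := le_max_right _ _
  obtain ⟨M, hM0, hM⟩ := H1.exists_newton_mul_le D
  have hg := h.tendsto_integral_abs_mul hC w.memLp_fn
  -- Expanding `(c + w)² = c² + w² + 2 c w` bilinearly leaves four cross terms. This one pairs the
  -- fixed density `w²` with `c²`; in the other three one density is `c w`, which tends to zero in
  -- `L¹`.
  have t1 := h.tendsto_coulombForm hcD hcD (w.integrable_sq)
  have t2 : Tendsto (fun n => coulombForm (fun x => (c n).fn x * w.fn x)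
      (fun x => (c n).fn x * (c n).fn x)) atTop (𝓝 0) :=
    tendsto_coulombForm_of_tendsto_integral (fun n => H1.integrable_mul _ _) hg
      fun n x => hM _ _ (hcD n) (hcD n) x
  have t3 : Tendsto (fun n => coulombForm (fun x => (c n).fn x * w.fn x)
      (fun x => w.fn x * w.fn x)) atTop (𝓝 0) :=
    tendsto_coulombForm_of_tendsto_integral (fun n => H1.integrable_mul _ _) hg
      fun n x => hM _ _ hwD hwD x
  have t4 : Tendsto (fun n => coulombForm (fun x => (c n).fn x * w.fn x)
      (fun x => (c n).fn x * w.fn x)) atTop (𝓝 0) :=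
    tendsto_coulombForm_of_tendsto_integral (fun n => H1.integrable_mul _ _) hg
      fun n x => hM _ _ (hcD n) hwD x
  have ht := (((t1.const_mul 2).add (t2.const_mul 4)).add (t3.const_mul 4)).add (t4.const_mul 4)
  simp only [mul_zero, add_zero] at ht
  refine ht.congr fun n => ?_
  have e : (fun x => (c n + w).fn x ^ 2) =ᵐ[volume] fun x =>
      (c n).fn x ^ 2 + (w.fn x ^ 2 + 2 * ((c n).fn x * w.fn x)) := by
    filter_upwards [H1.fn_add (c n) w] with x hx
    rw [hx]; ring
  have i1 := (c n).L1L2_sq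
  have i2 := w.L1L2_sq
  have i3 := ((c n).L1L2_mul w).const_mul 2
  have i23 := i2.add i3
  have i := i1.add i23
  simp only [H1.coulombEnergy_eq]
  rw [coulombForm_congr e e, coulombForm_add_left i1 i23 i, coulombForm_add_left i2 i3 i,
    coulombForm_add_right i1 i1 i23, coulombForm_add_right i2 i1 i23,
    coulombForm_add_right i3 i1 i23, coulombForm_add_right i1 i2 i3,
    coulombForm_add_right i2 i2 i3, coulombForm_add_right i3 i2 i3]
  simp only [coulombForm_const_mul_left, coulombForm_const_mul_right, ← sq]
  rw [coulombForm_comm i1 ((c n).L1L2_mul w), coulombForm_comm i2 ((c n).L1L2_mul w),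
    coulombForm_comm i1 i2]
  ring

end

/-! ### Power nonlinearities -/

lemma abs_rpow_le_of_mem_uIcc {a b t q : ℝ} (hq : 0 ≤ q) (ht : t ∈ Set.uIcc a b) :
    |t| ^ q ≤ |a| ^ q + |b| ^ q := by
  have h : |t| ≤ max |a| |b| := by
    rcases Set.mem_uIcc.1 ht with ⟨h1, h2⟩ | ⟨h1, h2⟩
    · exact abs_le_max_abs_abs h1 h2
    · rw [max_comm]; exact abs_le_max_abs_abs h1 h2
  have ha : 0 ≤ |a| ^ q := by positivity
  have hb : 0 ≤ |b| ^ q := by positivity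
  rcases le_total |a| |b| with h1 | h1
  · rw [max_eq_right h1] at h
    linarith [Real.rpow_le_rpow (abs_nonneg t) h hq]
  · rw [max_eq_left h1] at h
    linarith [Real.rpow_le_rpow (abs_nonneg t) h hq]

lemma add_rpow_le {x y q : ℝ} (hx : 0 ≤ x) (hy : 0 ≤ y) (hq : 0 ≤ q) :
    (x + y) ^ q ≤ 2 ^ q * (x ^ q + y ^ q) := by
  have hxq : 0 ≤ x ^ q := by positivity
  have hyq : 0 ≤ y ^ q := by positivity
  have h2 : (0 : ℝ) ≤ 2 ^ q := by positivity
  rcases le_total x y with h | h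
  · calc (x + y) ^ q ≤ (2 * y) ^ q := Real.rpow_le_rpow (by positivity) (by linarith) hq
      _ = 2 ^ q * y ^ q := Real.mul_rpow zero_le_two hy
      _ ≤ _ := by gcongr; linarith
  · calc (x + y) ^ q ≤ (2 * x) ^ q := Real.rpow_le_rpow (by positivity) (by linarith) hq
      _ = 2 ^ q * x ^ q := Real.mul_rpow zero_le_two hx
      _ ≤ _ := by gcongr; linarith

/-- Mean value inequality for `t ↦ |t| ^ q * t`, whose derivative is `(q + 1) * |t| ^ q`. The
condition `1 < q` makes `|t| ^ q` differentiable at zero. -/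
lemma abs_rpow_mul_sub_le {q : ℝ} (hq : 1 < q) (a w : ℝ) :
    |(|a| ^ q * a - |w| ^ q * w)| ≤ (q + 1) * (|a - w| * (|a| ^ q + |w| ^ q)) := by
  have hd : ∀ t : ℝ, HasDerivAt (fun t : ℝ => |t| ^ q * t)
      (q * |t| ^ (q - 2) * t * t + |t| ^ q * 1) t :=
    fun t => (hasDerivAt_abs_rpow t hq).mul (hasDerivAt_id t)
  have hb : ∀ t ∈ Set.uIcc w a, ‖q * |t| ^ (q - 2) * t * t + |t| ^ q * 1‖
      ≤ (q + 1) * (|a| ^ q + |w| ^ q) := by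
    intro t ht
    have h1 : q * |t| ^ (q - 2) * t * t = q * |t| ^ q := by
      rw [← sq_mul_rpow_sub_two (p := q) (by linarith) (abs_nonneg t), abs_mul_abs_self]; ring
    have h2 := abs_rpow_le_of_mem_uIcc (by linarith : 0 ≤ q) ht
    have h3 : 0 ≤ |t| ^ q := by positivity
    rw [h1, Real.norm_of_nonneg (by positivity)]
    nlinarith
  have h := (convex_uIcc w a).norm_image_sub_le_of_norm_hasDerivWithin_le
    (fun t _ => (hd t).hasDerivWithinAt) hb Set.left_mem_uIcc Set.right_mem_uIcc
  simp only [Real.norm_eq_abs] at h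
  linarith

/-- Apply the mean value inequality to `s ↦ |c + s| ^ p - |s| ^ p` from `0` to `w`, which yields the
factor `|w|`. Its derivative is a difference with increment `c`, which yields the factor `|c|`. Here
`p > 3` ensures that the exponent `p - 2` exceeds `1`. -/
lemma exists_abs_rpow_add_sub_le {p : ℝ} (hp : 3 < p) : ∃ K : ℝ, 0 ≤ K ∧ ∀ c w : ℝ,
    |(|c + w| ^ p - |c| ^ p - |w| ^ p)|
      ≤ K * (|c| * |w| * |c| ^ (p - 2) + |c| * |w| * |w| ^ (p - 2)) := by
  set q := p - 2 with hq
  refine ⟨p * ((q + 1) * (2 ^ q + 1)), by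
    have : 0 ≤ q := by rw [hq]; linarith
    positivity, fun c w => ?_⟩
  have hq0 : 0 ≤ q := by rw [hq]; linarith
  have hd : ∀ s : ℝ, HasDerivAt (fun s : ℝ => |c + s| ^ p - |s| ^ p)
      (p * |c + s| ^ (p - 2) * (c + s) * 1 - p * |s| ^ (p - 2) * s) s := fun s =>
    ((hasDerivAt_abs_rpow (c + s) (by linarith)).comp s ((hasDerivAt_id s).const_add c)).sub
      (hasDerivAt_abs_rpow s (by linarith))
  have hb : ∀ s ∈ Set.uIcc 0 w, ‖p * |c + s| ^ (p - 2) * (c + s) * 1 - p * |s| ^ (p - 2) * s‖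
      ≤ p * ((q + 1) * (2 ^ q + 1)) * (|c| * (|c| ^ q + |w| ^ q)) := by
    intro s hs
    have h1 := abs_rpow_mul_sub_le (q := q) (by rw [hq]; linarith) (c + s) s
    rw [add_sub_cancel_right] at h1
    have h2 : p * |c + s| ^ (p - 2) * (c + s) * 1 - p * |s| ^ (p - 2) * s
        = p * (|c + s| ^ q * (c + s) - |s| ^ q * s) := by rw [hq]; ring
    rw [h2, norm_mul, Real.norm_of_nonneg (by linarith), Real.norm_eq_abs, mul_assoc]
    have h3 : |c + s| ^ q ≤ 2 ^ q * (|c| ^ q + |s| ^ q) :=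
      (Real.rpow_le_rpow (abs_nonneg _) (abs_add_le _ _) hq0).trans
        (add_rpow_le (abs_nonneg _) (abs_nonneg _) hq0)
    have h4 : |s| ^ q ≤ |w| ^ q := by
      refine Real.rpow_le_rpow (abs_nonneg _) ?_ hq0
      rcases Set.mem_uIcc.1 hs with ⟨h5, h6⟩ | ⟨h5, h6⟩
      · rwa [abs_of_nonneg h5, abs_of_nonneg (h5.trans h6)]
      · rw [abs_of_nonpos h6, abs_of_nonpos (h5.trans h6)]; linarith
    have h5 : |c + s| ^ q + |s| ^ q ≤ (2 ^ q + 1) * (|c| ^ q + |w| ^ q) := by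
      have : (0 : ℝ) ≤ 2 ^ q := by positivity
      have : 0 ≤ |c| ^ q := by positivity
      nlinarith
    gcongr
    calc _ ≤ _ := h1
      _ ≤ (q + 1) * (|c| * ((2 ^ q + 1) * (|c| ^ q + |w| ^ q))) := by gcongr
      _ = _ := by ring
  have h := (convex_uIcc 0 w).norm_image_sub_le_of_norm_hasDerivWithin_le
    (fun t _ => (hd t).hasDerivWithinAt) hb Set.left_mem_uIcc Set.right_mem_uIcc
  simp only [Real.norm_eq_abs, add_zero, abs_zero, sub_zero] at h
  rw [Real.zero_rpow (by linarith), sub_zero] at h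
  calc |(|c + w| ^ p - |c| ^ p - |w| ^ p)| = |(|c + w| ^ p - |w| ^ p - |c| ^ p)| := by
        congr 1; ring
    _ ≤ _ := h
    _ = _ := by ring

/-- Compare `r` with `κ * a`: the larger of the two replaces the other. -/
lemma exists_rpow_mul_le {p κ : ℝ} (hp : 1 ≤ p) (hκ : 0 < κ) : ∃ K : ℝ, 0 ≤ K ∧ ∀ a r : ℝ,
    0 ≤ a → 0 ≤ r → a ^ (p - 1) * r ≤ κ * a ^ p + K * r ^ p := by
  refine ⟨(κ⁻¹) ^ (p - 1), by positivity, fun a r ha hr => ?_⟩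
  have h1 : ∀ t : ℝ, 0 ≤ t → t ^ (p - 1) * t = t ^ p := by
    intro t ht
    rcases ht.eq_or_lt with rfl | h
    · rw [mul_zero, Real.zero_rpow (by linarith)]
    · rw [← Real.rpow_add_one h.ne']; congr 1; ring
  have hap : 0 ≤ κ * a ^ p := by positivity
  have hrp : 0 ≤ (κ⁻¹) ^ (p - 1) * r ^ p := by positivity
  rcases le_total r (κ * a) with h | h
  · calc a ^ (p - 1) * r ≤ a ^ (p - 1) * (κ * a) := by gcongr
      _ = κ * a ^ p := by rw [← h1 a ha]; ring
      _ ≤ _ := by linarith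
  · have h2 : a ≤ κ⁻¹ * r := by rw [le_inv_mul_iff₀ hκ]; exact h
    calc a ^ (p - 1) * r ≤ (κ⁻¹ * r) ^ (p - 1) * r := by
          gcongr
      _ = (κ⁻¹) ^ (p - 1) * r ^ p := by
          rw [Real.mul_rpow (by positivity) hr, ← h1 r hr]; ring
      _ ≤ _ := by linarith

/-! ### Limits of the power terms, and of the Coulomb term along vanishing sequences -/

section

variable {p : ℝ} {C : ℝ}

lemma H1.aestronglyMeasurable_rpow (u : H1) {q : ℝ} (hq : 0 ≤ q) :
    AEStronglyMeasurable (fun x => |u.fn x| ^ q) volume :=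
  (Real.continuous_rpow_const hq).comp_aestronglyMeasurable u.aestronglyMeasurable_fn.norm

lemma H1.integrable_mul_mul_rpow (hp : 2 ≤ p) (hp6 : p < 6) (c v a : H1) :
    Integrable fun x => |c.fn x| * |v.fn x| * |a.fn x| ^ (p - 2) := by
  obtain ⟨K, hK0, hK⟩ := exists_mul_mul_rpow_le hp hp6 one_pos
  refine Integrable.mono' ((((c.integrable_pow_six.add v.integrable_pow_six).add
    a.integrable_pow_six).const_mul 1).add ((c.integrable_mul v).abs.const_mul K))
    ((c.aestronglyMeasurable_fn.norm.mul v.aestronglyMeasurable_fn.norm).mul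
      (a.aestronglyMeasurable_rpow (by linarith))) (.of_forall fun x => ?_)
  rw [Real.norm_of_nonneg (by positivity)]
  have := hK |c.fn x| |v.fn x| |a.fn x| (abs_nonneg _) (abs_nonneg _) (abs_nonneg _)
  simp only [abs_pow_six] at this
  simpa only [Pi.add_apply, abs_mul] using this

/-- Subcriticality at work: sixth powers, bounded by Sobolev, take the coefficient `κ`, and what is
left is a multiple of `∫ |c v|`. -/
lemma tendsto_integral_mul_mul_rpow (hp : 2 ≤ p) (hp6 : p < 6) {c v a : ℕ → H1}
    (hc : ∀ n, ‖c n‖ ≤ C) (hv : ∀ n, ‖v n‖ ≤ C) (ha : ∀ n, ‖a n‖ ≤ C)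
    (hlim : Tendsto (fun n => ∫ x, |(c n).fn x * (v n).fn x|) atTop (𝓝 0)) :
    Tendsto (fun n => ∫ x, |(c n).fn x| * |(v n).fn x| * |(a n).fn x| ^ (p - 2)) atTop (𝓝 0) := by
  obtain ⟨M, hM0, hM⟩ := H1.exists_integral_pow_le C
  refine tendsto_zero_of_forall_le (3 * M) fun κ hκ => ?_
  obtain ⟨K, hK0, hK⟩ := exists_mul_mul_rpow_le hp hp6 hκ
  have hlim' := hlim.const_mul K
  rw [mul_zero] at hlim'
  refine ⟨_, hlim', .of_forall fun n => ?_⟩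
  rw [abs_of_nonneg (integral_nonneg fun x => by positivity)]
  have i1 := (c n).integrable_pow_six
  have i2 := (v n).integrable_pow_six
  have i3 := (a n).integrable_pow_six
  have i12 : Integrable fun x => (c n).fn x ^ 6 + (v n).fn x ^ 6 := i1.add i2
  have i123 : Integrable fun x => (c n).fn x ^ 6 + (v n).fn x ^ 6 + (a n).fn x ^ 6 := i12.add i3
  have i4 := ((c n).integrable_mul (v n)).abs
  calc ∫ x, |(c n).fn x| * |(v n).fn x| * |(a n).fn x| ^ (p - 2)
      ≤ ∫ x, (κ * ((c n).fn x ^ 6 + (v n).fn x ^ 6 + (a n).fn x ^ 6)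
          + K * |(c n).fn x * (v n).fn x|) := by
        refine integral_mono (H1.integrable_mul_mul_rpow hp hp6 _ _ _)
          ((i123.const_mul κ).add (i4.const_mul K)) fun x => ?_
        have := hK |(c n).fn x| |(v n).fn x| |(a n).fn x| (abs_nonneg _) (abs_nonneg _)
          (abs_nonneg _)
        simp only [abs_pow_six] at this
        simpa only [abs_mul] using this
    _ = κ * ((∫ x, (c n).fn x ^ 6) + (∫ x, (v n).fn x ^ 6) + ∫ x, (a n).fn x ^ 6)
          + K * ∫ x, |(c n).fn x * (v n).fn x| := by
        rw [integral_add (i123.const_mul κ) (i4.const_mul K), integral_const_mul,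
          integral_const_mul, integral_add i12 i3, integral_add i1 i2]
    _ ≤ _ := by
        have h1 := (hM _ (hc n)).2.2
        have h2 := (hM _ (hv n)).2.2
        have h3 := (hM _ (ha n)).2.2
        nlinarith

/-- The power nonlinearity paired with a test function. -/
def powerForm (p : ℝ) (u v : H1) : ℝ := ∫ x, |u.fn x| ^ (p - 2) * u.fn x * v.fn x

lemma H1.integrable_powerForm (hp : 2 ≤ p) (hp6 : p < 6) (u v : H1) :
    Integrable fun x => |u.fn x| ^ (p - 2) * u.fn x * v.fn x := by
  refine (H1.integrable_mul_mul_rpow hp hp6 u v u).mono'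
    (((u.aestronglyMeasurable_rpow (by linarith)).mul u.aestronglyMeasurable_fn).mul
      v.aestronglyMeasurable_fn) (.of_forall fun x => le_of_eq ?_)
  rw [norm_mul, norm_mul, Real.norm_of_nonneg (by positivity), Real.norm_eq_abs, Real.norm_eq_abs]
  ring

/-- The difference is controlled by `|a - w| |v| (|a| ^ (p - 2) + |w| ^ (p - 2))`, and `(a - w) v`
tends to zero in `L¹` because `v` is fixed. -/
lemma WeakTo.tendsto_powerForm (hp : 3 < p) (hp6 : p < 6) {a : ℕ → H1} {w : H1}
    (h : WeakTo a w) (ha : ∀ n, ‖a n‖ ≤ C) (v : H1) :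
    Tendsto (fun n => powerForm p (a n) v) atTop (𝓝 (powerForm p w v)) := by
  set D : ℝ := max (C + ‖w‖) ‖v‖ with hD
  have hC0 : 0 ≤ C := (norm_nonneg _).trans (ha 0)
  have hcD : ∀ n, ‖a n - w‖ ≤ D := fun n =>
    (norm_sub_le _ _).trans ((add_le_add (ha n) le_rfl).trans (le_max_left _ _))
  have haD : ∀ n, ‖a n‖ ≤ D := fun n =>
    (ha n).trans ((le_add_of_nonneg_right (norm_nonneg _)).trans (le_max_left _ _))
  have hwD : ‖w‖ ≤ D := (le_add_of_nonneg_left hC0).trans (le_max_left _ _)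
  have hvD : ‖v‖ ≤ D := le_max_right _ _
  have hlim := h.sub_self.tendsto_integral_abs_mul hcD v.memLp_fn
  have t1 := tendsto_integral_mul_mul_rpow (p := p) (by linarith) hp6 hcD (fun _ => hvD) haD hlim
  have t2 := tendsto_integral_mul_mul_rpow (p := p) (by linarith) hp6 hcD (fun _ => hvD)
    (fun _ => hwD) hlim
  rw [tendsto_iff_norm_sub_tendsto_zero]
  have t3 := (t1.add t2).const_mul (p - 2 + 1)
  rw [add_zero, mul_zero] at t3
  refine squeeze_zero (fun n => norm_nonneg _) (fun n => ?_) t3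
  have i1 := H1.integrable_mul_mul_rpow (p := p) (by linarith) hp6 (a n - w) v (a n)
  have i2 := H1.integrable_mul_mul_rpow (p := p) (by linarith) hp6 (a n - w) v w
  rw [powerForm, powerForm, ← integral_sub (H1.integrable_powerForm (by linarith) hp6 _ _)
    (H1.integrable_powerForm (by linarith) hp6 _ _), ← integral_add i1 i2, ← integral_const_mul]
  refine norm_integral_le_of_norm_le ((i1.add i2).const_mul _) ?_
  filter_upwards [H1.fn_sub (a n) w] with x hx
  have h1 := abs_rpow_mul_sub_le (q := p - 2) (by linarith) ((a n).fn x) (w.fn x)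
  rw [hx, ← sub_mul, norm_mul, Real.norm_eq_abs, Real.norm_eq_abs]
  calc _ ≤ (p - 2 + 1) * (|(a n).fn x - w.fn x| * (|(a n).fn x| ^ (p - 2) + |w.fn x| ^ (p - 2)))
        * |v.fn x| := by gcongr
    _ = _ := by ring

/-- The Brezis–Lieb splitting of the `L^p` norm. -/
lemma WeakTo.tendsto_integral_rpow_sub (hp : 3 < p) (hp6 : p < 6) {c : ℕ → H1}
    (h : WeakTo c 0) (hC : ∀ n, ‖c n‖ ≤ C) (w : H1) :
    Tendsto (fun n => (∫ x, |(c n + w).fn x| ^ p) - (∫ x, |(c n).fn x| ^ p)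
      - ∫ x, |w.fn x| ^ p) atTop (𝓝 0) := by
  have hcD : ∀ n, ‖c n‖ ≤ max C ‖w‖ := fun n => (hC n).trans (le_max_left _ _)
  have hwD : ‖w‖ ≤ max C ‖w‖ := le_max_right _ _
  have hlim := h.tendsto_integral_abs_mul hcD w.memLp_fn
  have hp2 : (2 : ℝ) ≤ p := by linarith
  have t1 := tendsto_integral_mul_mul_rpow hp2 hp6 hcD (fun _ => hwD) hcD hlim
  have t2 := tendsto_integral_mul_mul_rpow hp2 hp6 hcD (fun _ => hwD) (fun _ => hwD) hlim
  obtain ⟨K, hK0, hK⟩ := exists_abs_rpow_add_sub_le hp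
  have t3 := (t1.add t2).const_mul K
  rw [add_zero, mul_zero] at t3
  refine squeeze_zero_norm (fun n => ?_) t3
  have i1 := H1.integrable_mul_mul_rpow hp2 hp6 (c n) w (c n)
  have i2 := H1.integrable_mul_mul_rpow hp2 hp6 (c n) w w
  have j1 := (c n + w).integrable_rpow hp2 hp6
  have j2 := (c n).integrable_rpow hp2 hp6
  have j3 := w.integrable_rpow hp2 hp6
  have j12 : Integrable fun x => |(c n + w).fn x| ^ p - |(c n).fn x| ^ p := j1.sub j2
  rw [← integral_sub j1 j2, ← integral_sub j12 j3, ← integral_add i1 i2, ← integral_const_mul]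
  refine norm_integral_le_of_norm_le ((i1.add i2).const_mul _) ?_
  filter_upwards [H1.fn_add (c n) w] with x hx
  rw [hx]
  exact hK _ _

lemma H1.exists_integral_rpow_le (hp : 2 ≤ p) (hp6 : p < 6) (C : ℝ) : ∃ M, 0 ≤ M ∧
    ∀ u : H1, ‖u‖ ≤ C → ∫ x, |u.fn x| ^ p ≤ M := by
  obtain ⟨M, hM0, hM⟩ := H1.exists_integral_pow_le C
  obtain ⟨K, hK0, hK⟩ := exists_rpow_le hp hp6 one_pos
  refine ⟨1 * M + K * M, by positivity, fun u hu => ?_⟩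
  calc ∫ x, |u.fn x| ^ p ≤ ∫ x, (1 * u.fn x ^ 6 + K * u.fn x ^ 2) := by
        refine integral_mono (u.integrable_rpow hp hp6)
          ((u.integrable_pow_six.const_mul 1).add (u.integrable_sq.const_mul K)) fun x => ?_
        have := hK |u.fn x| (abs_nonneg _)
        rwa [abs_pow_six, sq_abs] at this
    _ = 1 * (∫ x, u.fn x ^ 6) + K * ∫ x, u.fn x ^ 2 := by
        rw [integral_add (u.integrable_pow_six.const_mul 1) (u.integrable_sq.const_mul K),
          integral_const_mul, integral_const_mul]
    _ ≤ _ := by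
        have h1 := (hM u hu).1
        have h2 := (hM u hu).2.2
        gcongr

/-- No weak limit of `a` is needed: it is merely bounded in `L^p`, and all the smallness comes from
`r` through Lions' lemma. -/
lemma Vanishing.tendsto_powerForm (hp : 2 < p) (hp6 : p < 6) {r a : ℕ → H1}
    (hr : Vanishing r) (hC : ∀ n, ‖r n‖ ≤ C) (ha : ∀ n, ‖a n‖ ≤ C) :
    Tendsto (fun n => powerForm p (a n) (r n)) atTop (𝓝 0) := by
  obtain ⟨M, hM0, hM⟩ := H1.exists_integral_rpow_le hp.le hp6 C
  refine tendsto_zero_of_forall_le M fun κ hκ => ?_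
  obtain ⟨K, hK0, hK⟩ := exists_rpow_mul_le (p := p) (by linarith) hκ
  have t := (hr.tendsto_integral_rpow hC hp hp6).const_mul K
  rw [mul_zero] at t
  refine ⟨_, t, .of_forall fun n => ?_⟩
  have i1 := ((a n).integrable_rpow hp.le hp6).const_mul κ
  have i2 := ((r n).integrable_rpow hp.le hp6).const_mul K
  calc |powerForm p (a n) (r n)|
      ≤ ∫ x, (κ * |(a n).fn x| ^ p + K * |(r n).fn x| ^ p) := by
        rw [powerForm, ← Real.norm_eq_abs]
        refine norm_integral_le_of_norm_le (i1.add i2) (.of_forall fun x => ?_)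
        refine le_trans (le_of_eq ?_) (hK _ _ (abs_nonneg _) (abs_nonneg _))
        have e : p - 1 = p - 2 + 1 := by ring
        simp only [norm_mul, Real.norm_eq_abs]
        rw [abs_of_nonneg (by positivity : 0 ≤ |(a n).fn x| ^ (p - 2)), e]
        rcases (abs_nonneg ((a n).fn x)).eq_or_lt with h0 | h0
        · rw [← h0, Real.zero_rpow (by linarith : p - 2 + 1 ≠ 0)]; simp
        · rw [Real.rpow_add_one h0.ne']
    _ = κ * (∫ x, |(a n).fn x| ^ p) + K * ∫ x, |(r n).fn x| ^ p := by
        rw [integral_add i1 i2, integral_const_mul, integral_const_mul]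
    _ ≤ _ := by
        have := hM _ (ha n)
        nlinarith

/-- Coulomb terms tend to zero along vanishing sequences. -/
lemma Vanishing.tendsto_coulomb_mul {r a : ℕ → H1} (hr : Vanishing r) (hC : ∀ n, ‖r n‖ ≤ C)
    (ha : ∀ n, ‖a n‖ ≤ C) :
    Tendsto (fun n => ∫ x, coulomb (a n) x * (a n).fn x * (r n).fn x) atTop (𝓝 0) := by
  obtain ⟨M, hM0, hM⟩ := H1.exists_integral_mul_le C
  obtain ⟨N, hN0, hN⟩ := H1.exists_integral_pow_le C
  -- Young's inequality reduces this to fourth powers: those of `a n` are bounded and those of `r n`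
  -- vanish by Lions' lemma with exponent `4`.
  have h4 : Tendsto (fun n => ∫ x, ((a n).fn x * (r n).fn x) ^ 2) atTop (𝓝 0) := by
    refine tendsto_zero_of_forall_le N fun κ hκ => ?_
    have t := (hr.tendsto_integral_rpow hC (q := 4) (by norm_num) (by norm_num)).const_mul κ⁻¹
    rw [mul_zero] at t
    refine ⟨_, t, .of_forall fun n => ?_⟩
    have e : ∀ x, |(r n).fn x| ^ (4 : ℝ) = (r n).fn x ^ 4 := by
      intro x
      rw [show (4 : ℝ) = ((4 : ℕ) : ℝ) by norm_num, Real.rpow_natCast,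
        (show Even 4 by decide).pow_abs]
    simp only [e]
    have i1 := ((a n).integrable_pow_four).const_mul κ
    have i2 := ((r n).integrable_pow_four).const_mul κ⁻¹
    rw [abs_of_nonneg (integral_nonneg fun x => sq_nonneg _)]
    calc ∫ x, ((a n).fn x * (r n).fn x) ^ 2
        ≤ ∫ x, (κ * (a n).fn x ^ 4 + κ⁻¹ * (r n).fn x ^ 4) := by
          refine integral_mono ((a n).L1L2_mul (r n)).integrable_sq (i1.add i2) fun x => ?_
          have h := mul_le_young (a := (a n).fn x ^ 2) (b := (r n).fn x ^ 2) hκ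
          have h' := (le_abs_self _).trans h
          simp only
          rw [mul_pow]
          calc _ ≤ _ := h'
            _ = _ := by ring
      _ = κ * (∫ x, (a n).fn x ^ 4) + κ⁻¹ * ∫ x, (r n).fn x ^ 4 := by
          rw [integral_add i1 i2, integral_const_mul, integral_const_mul]
      _ ≤ _ := by
          have := (hN _ (ha n)).2.1
          nlinarith
  -- By symmetry the product `a r` is moved under the potential, whose supremum is small once the
  -- `L²` norm of the product is.
  have key : ∀ n, ∫ x, coulomb (a n) x * (a n).fn x * (r n).fn x
      = coulombForm (fun x => (a n).fn x ^ 2) fun x => (a n).fn x * (r n).fn x := by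
    intro n
    rw [coulombForm_comm (a n).L1L2_sq ((a n).L1L2_mul (r n)), H1.coulomb_eq]
    refine integral_congr_ae (.of_forall fun x => ?_)
    ring
  simp only [key]
  refine tendsto_zero_of_forall_le (N * (kernelConst + 2 * M)) fun κ hκ => ?_
  have t := (h4.const_mul (κ ^ 2)⁻¹).const_mul N
  rw [mul_zero, mul_zero] at t
  refine ⟨_, t, .of_forall fun n => ?_⟩
  obtain ⟨h1, h2⟩ := hM (a n) (r n) (ha n) (hC n)
  have hb : ∀ x, newton (fun y => |(a n).fn y * (r n).fn y|) x
      ≤ (kernelConst + 2 * M) * κ + (κ ^ 2)⁻¹ * ∫ x, ((a n).fn x * (r n).fn x) ^ 2 := by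
    intro x
    -- Only the `L²` term keeps a large coefficient, `(κ ^ 2)⁻¹`; with `δ = R = κ⁻¹` the others are
    -- of order `κ`.
    have h3 := ((a n).L1L2_mul (r n)).newton_abs_le (η := (κ ^ 2)⁻¹) (δ := κ⁻¹) (R := κ⁻¹)
      (by positivity) (by positivity) (by positivity) x
    have h5 : ∫ y in Metric.ball x κ⁻¹, |(a n).fn y * (r n).fn y| ≤ M :=
      (setIntegral_le_integral ((a n).integrable_mul (r n)).abs
        (.of_forall fun y => abs_nonneg _)).trans h1
    refine h3.trans ?_
    simp only [inv_inv]
    have h6 : κ ^ 2 * (kernelConst * κ⁻¹) = kernelConst * κ := by field_simp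
    rw [h6]
    have h7 := mul_le_mul_of_nonneg_left h5 hκ.le
    have h8 := mul_le_mul_of_nonneg_left h1 hκ.le
    linarith
  have hB0 : 0 ≤ (kernelConst + 2 * M) * κ
      + (κ ^ 2)⁻¹ * ∫ x, ((a n).fn x * (r n).fn x) ^ 2 := by
    have := kernelConst_nonneg
    have : 0 ≤ ∫ x, ((a n).fn x * (r n).fn x) ^ 2 := integral_nonneg fun x => sq_nonneg _
    positivity
  refine (abs_coulombForm_le (a n).integrable_sq hb).trans ?_
  have h9 : ∫ x, |(a n).fn x ^ 2| ≤ N := by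
    simpa only [abs_pow, sq_abs] using (hN _ (ha n)).1
  calc _ ≤ _ := mul_le_mul_of_nonneg_left h9 hB0
    _ = _ := by ring

end

/-! ### The potential term -/

/-- Young's inequality for the conjugate exponents `3/2` and `3`: the potential is locally in
`L^{3/2}`, and products of `H¹` functions lie in `L³`. -/
lemma exists_mul_le_cube {κ : ℝ} (hκ : 0 < κ) : ∃ K : ℝ, 0 ≤ K ∧ ∀ x y : ℝ, 0 ≤ x → 0 ≤ y →
    x * y ≤ κ * y ^ 3 + K * x ^ (3 / 2 : ℝ) := by
  refine ⟨κ⁻¹ ^ (1 / 2 : ℝ), by positivity, fun x y hx hy => ?_⟩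
  have h1 : 0 ≤ κ * y ^ 3 := by positivity
  have h2 : 0 ≤ κ⁻¹ ^ (1 / 2 : ℝ) * x ^ (3 / 2 : ℝ) := by positivity
  rcases le_total x (κ * y ^ 2) with h | h
  · calc x * y ≤ κ * y ^ 2 * y := by gcongr
      _ = κ * y ^ 3 := by ring
      _ ≤ _ := by linarith
  · have h3 : y ≤ (κ⁻¹ * x) ^ (1 / 2 : ℝ) := by
      rw [← Real.sqrt_eq_rpow]
      exact Real.le_sqrt_of_sq_le (by rw [le_inv_mul_iff₀ hκ]; exact h)
    have h4 : x ^ (3 / 2 : ℝ) = x ^ (1 / 2 : ℝ) * x := by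
      rcases hx.eq_or_lt with rfl | h0
      · rw [mul_zero, Real.zero_rpow (by norm_num)]
      · rw [← Real.rpow_add_one h0.ne']; norm_num
    calc x * y ≤ x * (κ⁻¹ * x) ^ (1 / 2 : ℝ) := by gcongr
      _ = κ⁻¹ ^ (1 / 2 : ℝ) * x ^ (3 / 2 : ℝ) := by
        rw [Real.mul_rpow (by positivity) hx, h4]; ring
      _ ≤ _ := by linarith

/-- The class of potentials for which the quadratic form `∫ V u v` is weakly continuous. -/
structure AdmissiblePotential (V : R3 → ℝ) : Prop where
  aestronglyMeasurable : AEStronglyMeasurable V volume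
  integrableOn : ∀ R, IntegrableOn (fun x => |V x| ^ (3 / 2 : ℝ)) (Metric.ball 0 R)
  vanishes : VanishesAtInfinity V

/-- On a ball, which has finite measure, `L^q` embeds in `L^{3/2}`; this includes `q = ⊤`. -/
lemma admissiblePotential_of_memLp {V : R3 → ℝ} {q : ℝ≥0∞} (hq : 3 / 2 ≤ q)
    (hV : MemLp V q volume) (hV0 : VanishesAtInfinity V) : AdmissiblePotential V := by
  refine ⟨hV.1, fun R => ?_, hV0⟩
  have hfin : IsFiniteMeasure ((volume : Measure R3).restrict (Metric.ball 0 R)) :=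
    ⟨by simpa using (measure_ball_lt_top (μ := (volume : Measure R3)) (x := 0) (r := R))⟩
  have h := ((hV.restrict (Metric.ball 0 R)).mono_exponent hq).integrable_norm_rpow
    (by norm_num) (by finiteness)
  have e : (3 / 2 : ℝ≥0∞).toReal = 3 / 2 := by simp
  rw [e] at h
  exact h

lemma H1.integrable_abs_mul_cube (c a : H1) : Integrable fun x => |c.fn x * a.fn x| ^ 3 := by
  refine (c.integrable_pow_six.add a.integrable_pow_six).mono'
    ((c.integrable_mul a).1.norm.pow 3) (.of_forall fun x => ?_)
  rw [Real.norm_of_nonneg (by positivity), abs_mul, mul_pow]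
  simp only [Pi.add_apply]
  rw [← abs_pow_six (c.fn x), ← abs_pow_six (a.fn x)]
  nlinarith [sq_nonneg (|c.fn x| ^ 3 - |a.fn x| ^ 3), sq_nonneg (|c.fn x| ^ 3),
    sq_nonneg (|a.fn x| ^ 3)]


lemma H1.exists_integral_cube_le (C : ℝ) : ∃ M, 0 ≤ M ∧ ∀ u v : H1,
    ‖u‖ ≤ C → ‖v‖ ≤ C → ∫ x, |u.fn x * v.fn x| ^ 3 ≤ M := by
  obtain ⟨M, hM0, hM⟩ := H1.exists_integral_pow_le C
  refine ⟨M + M, by positivity, fun u v hu hv => ?_⟩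
  calc ∫ x, |u.fn x * v.fn x| ^ 3 ≤ ∫ x, (u.fn x ^ 6 + v.fn x ^ 6) := by
        refine integral_mono (u.integrable_abs_mul_cube v)
          (u.integrable_pow_six.add v.integrable_pow_six) fun x => ?_
        simp only
        rw [← abs_pow_six (u.fn x), ← abs_pow_six (v.fn x), abs_mul, mul_pow]
        nlinarith [sq_nonneg (|u.fn x| ^ 3 - |v.fn x| ^ 3), sq_nonneg (|u.fn x| ^ 3),
          sq_nonneg (|v.fn x| ^ 3)]
    _ = (∫ x, u.fn x ^ 6) + ∫ x, v.fn x ^ 6 := integral_add u.integrable_pow_six v.integrable_pow_six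
    _ ≤ M + M := add_le_add (hM u hu).2.2 (hM v hv).2.2

namespace AdmissiblePotential

variable {V : R3 → ℝ}

/-- The part of `|V|^{3/2}` above height `m`. -/
def excess (V : R3 → ℝ) (m : ℝ) (x : R3) : ℝ := if m < |V x| then |V x| ^ (3 / 2 : ℝ) else 0

lemma excess_nonneg (V : R3 → ℝ) (m : ℝ) (x : R3) : 0 ≤ excess V m x := by
  unfold excess; split_ifs <;> positivity

lemma excess_le (V : R3 → ℝ) (m : ℝ) (x : R3) : excess V m x ≤ |V x| ^ (3 / 2 : ℝ) := by
  unfold excess; split_ifs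
  · exact le_rfl
  · positivity

lemma aestronglyMeasurable_excess (hV : AdmissiblePotential V) (m : ℝ) :
    AEStronglyMeasurable (excess V m) volume := by
  have hg : Measurable fun t : ℝ => if m < |t| then |t| ^ (3 / 2 : ℝ) else 0 :=
    Measurable.ite (measurableSet_lt measurable_const (by fun_prop)) (by fun_prop) measurable_const
  exact (hg.comp_aemeasurable hV.1.aemeasurable).aestronglyMeasurable

lemma integrableOn_excess (hV : AdmissiblePotential V) (m R : ℝ) :
    IntegrableOn (excess V m) (Metric.ball 0 R) :=
  (hV.2 R).mono' (hV.aestronglyMeasurable_excess m).restrict (.of_forall fun x => by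
    rw [Real.norm_of_nonneg (excess_nonneg V m x)]; exact excess_le V m x)

lemma tendsto_integral_excess (hV : AdmissiblePotential V) (R : ℝ) :
    Tendsto (fun m : ℕ => ∫ x in Metric.ball 0 R, excess V m x) atTop (𝓝 0) := by
  have h0 : ∫ _ in Metric.ball (0 : R3) R, (0 : ℝ) = 0 := by simp
  rw [← h0]
  refine tendsto_integral_of_dominated_convergence (fun x => |V x| ^ (3 / 2 : ℝ))
    (fun m => (hV.aestronglyMeasurable_excess m).restrict) (hV.2 R)
    (fun m => .of_forall fun x => ?_) (.of_forall fun x => ?_)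
  · rw [Real.norm_of_nonneg (excess_nonneg V m x)]; exact excess_le V m x
  · refine tendsto_const_nhds.congr' ?_
    filter_upwards [tendsto_natCast_atTop_atTop.eventually_ge_atTop |V x|] with m hm
    rw [excess, if_neg (not_lt.2 hm)]

/-- The pointwise majorant behind both integrability and weak continuity of `∫ V c a`. -/
lemma exists_majorant (hV : AdmissiblePotential V) {κ : ℝ} (hκ : 0 < κ) :
    ∃ K R : ℝ, 0 ≤ K ∧ ∀ m : ℝ, 0 ≤ m → ∀ c a : R3 → ℝ,
      ∀ᵐ x ∂(volume : Measure R3), |V x * (c x * a x)| ≤ κ * |c x * a x| + κ * |c x * a x| ^ 3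
        + (Metric.ball 0 R).indicator (fun x => K * excess V m x + m * |c x * a x|) x := by
  obtain ⟨K, hK0, hK⟩ := exists_mul_le_cube hκ
  obtain ⟨R, hR⟩ := hV.3 κ hκ
  refine ⟨K, R, hK0, fun m hm c a => ?_⟩
  filter_upwards [hR] with x hx
  have h1 : 0 ≤ κ * |c x * a x| := by positivity
  have h2 : 0 ≤ κ * |c x * a x| ^ 3 := by positivity
  rw [abs_mul]
  -- Outside the ball `|V| < κ`. Inside, `|V|` is either at most `m`, or large enough that `excess`
  -- equals `|V| ^ (3 / 2)` and Young applies.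
  by_cases hxB : x ∈ Metric.ball (0 : R3) R
  · rw [Set.indicator_of_mem hxB]
    have h3 : 0 ≤ K * excess V m x := mul_nonneg hK0 (excess_nonneg V m x)
    have h4 : 0 ≤ m * |c x * a x| := by positivity
    rcases lt_or_ge m |V x| with h | h
    · have h5 := hK |V x| |c x * a x| (abs_nonneg _) (abs_nonneg _)
      have h6 : excess V m x = |V x| ^ (3 / 2 : ℝ) := if_pos h
      rw [h6] at h3 ⊢
      linarith
    · have h5 := mul_le_mul_of_nonneg_right h (abs_nonneg (c x * a x))
      linarith
  · rw [Set.indicator_of_notMem hxB]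
    have h3 : R ≤ ‖x‖ := by simpa using hxB
    have h5 := mul_le_mul_of_nonneg_right (hx h3).le (abs_nonneg (c x * a x))
    linarith

lemma integrable_mul (hV : AdmissiblePotential V) (c a : H1) :
    Integrable fun x => V x * (c.fn x * a.fn x) := by
  obtain ⟨K, R, hK0, h⟩ := hV.exists_majorant one_pos
  have hB : MeasurableSet (Metric.ball (0 : R3) R) := Metric.isOpen_ball.measurableSet
  have i1 := (c.integrable_mul a).abs
  have i3 : IntegrableOn (fun x => K * excess V 0 x + 0 * |c.fn x * a.fn x|) (Metric.ball 0 R) :=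
    ((hV.integrableOn_excess 0 R).const_mul K).add (i1.const_mul 0).integrableOn
  exact (((i1.const_mul 1).add ((c.integrable_abs_mul_cube a).const_mul 1)).add
    (i3.integrable_indicator hB)).mono' (hV.1.mul (c.integrable_mul a).1) (h 0 le_rfl c.fn a.fn)

/-- The order of choices is `κ`, then the radius, then the height `m` making the excess negligible.
The remaining part of `V` is bounded by `m` on a ball, where Rellich's theorem applies to `c` while
`a` need only be bounded. -/
lemma tendsto_integral_mul (hV : AdmissiblePotential V) {c a : ℕ → H1} {C : ℝ} (h : WeakTo c 0)
    (hC : ∀ n, ‖c n‖ ≤ C) (ha : ∀ n, ‖a n‖ ≤ C) :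
    Tendsto (fun n => ∫ x, V x * ((c n).fn x * (a n).fn x)) atTop (𝓝 0) := by
  obtain ⟨M, hM0, hM⟩ := H1.exists_integral_mul_le C
  obtain ⟨N, hN0, hN⟩ := H1.exists_integral_cube_le C
  refine tendsto_zero_of_forall_le (M + N + 1) fun κ hκ => ?_
  obtain ⟨K, R, hK0, hmaj⟩ := hV.exists_majorant hκ
  have hB : MeasurableSet (Metric.ball (0 : R3) R) := Metric.isOpen_ball.measurableSet
  have te := (hV.tendsto_integral_excess R).const_mul K
  rw [mul_zero] at te
  obtain ⟨m, hm⟩ := (te.eventually (gt_mem_nhds hκ)).exists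
  have t := (h.tendsto_setIntegral_abs_mul hC ha (s := Metric.ball 0 R)
    measure_ball_lt_top.ne).const_mul (m : ℝ)
  rw [mul_zero] at t
  refine ⟨_, t, .of_forall fun n => ?_⟩
  have i1 := ((c n).integrable_mul (a n)).abs
  have i2 := (c n).integrable_abs_mul_cube (a n)
  have i3 : IntegrableOn (fun x => K * excess V m x) (Metric.ball 0 R) :=
    (hV.integrableOn_excess m R).const_mul K
  have i4 : IntegrableOn (fun x => (m : ℝ) * |(c n).fn x * (a n).fn x|) (Metric.ball 0 R) :=
    (i1.const_mul (m : ℝ)).integrableOn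
  have i34 : Integrable ((Metric.ball (0 : R3) R).indicator
      fun x => K * excess V m x + m * |(c n).fn x * (a n).fn x|) :=
    (i3.add i4).integrable_indicator hB
  have i12 : Integrable fun x => κ * |(c n).fn x * (a n).fn x|
      + κ * |(c n).fn x * (a n).fn x| ^ 3 := (i1.const_mul κ).add (i2.const_mul κ)
  calc |∫ x, V x * ((c n).fn x * (a n).fn x)|
      ≤ ∫ x, (κ * |(c n).fn x * (a n).fn x| + κ * |(c n).fn x * (a n).fn x| ^ 3
        + (Metric.ball (0 : R3) R).indicator
          (fun x => K * excess V m x + m * |(c n).fn x * (a n).fn x|) x) := by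
        rw [← Real.norm_eq_abs]
        exact norm_integral_le_of_norm_le (i12.add i34) (hmaj m (Nat.cast_nonneg m) (c n).fn (a n).fn)
    _ = κ * (∫ x, |(c n).fn x * (a n).fn x|) + κ * (∫ x, |(c n).fn x * (a n).fn x| ^ 3)
        + (K * (∫ x in Metric.ball 0 R, excess V m x)
          + m * ∫ x in Metric.ball 0 R, |(c n).fn x * (a n).fn x|) := by
        rw [integral_add i12 i34, integral_add (i1.const_mul κ) (i2.const_mul κ),
          integral_indicator hB, integral_add i3 i4]
        simp only [integral_const_mul]
    _ ≤ _ := by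
        have h1 := mul_le_mul_of_nonneg_left (hM _ _ (hC n) (ha n)).1 hκ.le
        have h2 := mul_le_mul_of_nonneg_left (hN _ _ (hC n) (ha n)) hκ.le
        linarith

end AdmissiblePotential

/-! ### The differential of the energy -/

/-- The bilinear form `⟨∇u, ∇v⟩ + λ⟨u, v⟩`. -/
def linForm (lam : ℝ) (u v : H1) : ℝ :=
  (∫ x, inner ℝ (u.grad x) (v.grad x)) + lam * ∫ x, u.fn x * v.fn x

/-- The Coulomb nonlinearity paired with a test function. -/
def coulombTerm (u v : H1) : ℝ := ∫ x, coulomb u x * u.fn x * v.fn x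

lemma coulombTerm_eq (u v : H1) : coulombTerm u v
    = coulombForm (fun x => u.fn x * v.fn x) (fun x => u.fn x ^ 2) := by
  rw [coulombTerm, H1.coulomb_eq]
  refine integral_congr_ae (.of_forall fun x => ?_)
  ring

lemma linForm_eq (lam : ℝ) (u v : H1) : linForm lam u v
    = inner ℝ (H1.gradL u) (H1.gradL v) + lam * inner ℝ (H1.fnL u) (H1.fnL v) := by
  rw [H1.inner_gradL, H1.inner_fnL]; rfl

lemma linForm_sub_left (lam : ℝ) (u u' v : H1) :
    linForm lam (u - u') v = linForm lam u v - linForm lam u' v := by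
  simp only [linForm_eq, map_sub, inner_sub_left]; ring

lemma linForm_sum_left {ι : Type*} (s : Finset ι) (lam : ℝ) (f : ι → H1) (v : H1) :
    linForm lam (∑ i ∈ s, f i) v = ∑ i ∈ s, linForm lam (f i) v := by
  simp only [linForm_eq, map_sum, sum_inner, Finset.mul_sum, Finset.sum_add_distrib]

lemma WeakTo.tendsto_linForm {a : ℕ → H1} {b : H1} (h : WeakTo a b) (lam : ℝ) (v : H1) :
    Tendsto (fun n => linForm lam v (a n)) atTop (𝓝 (linForm lam v b)) := by
  simp only [linForm_eq]
  have h1 := h.apply ((innerSL ℝ (H1.gradL v)).comp H1.gradL)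
  have h2 := h.apply ((innerSL ℝ (H1.fnL v)).comp H1.fnL)
  exact h1.add (h2.const_mul lam)

lemma linForm_comm (lam : ℝ) (u v : H1) : linForm lam u v = linForm lam v u := by
  rw [linForm_eq, linForm_eq, real_inner_comm (H1.gradL v), real_inner_comm (H1.fnL v)]

lemma linForm_self (lam : ℝ) (u : H1) :
    linForm lam u u = ‖H1.gradL u‖ ^ 2 + lam * ‖H1.fnL u‖ ^ 2 := by
  simp only [linForm_eq, real_inner_self_eq_norm_sq]

lemma min_mul_norm_sq_le_linForm (lam : ℝ) (u : H1) :
    min 1 lam * ‖u‖ ^ 2 ≤ linForm lam u u := by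
  rw [linForm_self, H1.norm_sq_eq_add]
  nlinarith [min_le_left 1 lam, min_le_right 1 lam, sq_nonneg ‖H1.gradL u‖,
    sq_nonneg ‖H1.fnL u‖]

/-- Along a line every part of the energy except the `L^p` term is a polynomial of degree at most
four, so its derivative at zero is the linear coefficient. -/
lemma hasDerivAt_quartic (a b c d e : ℝ) :
    HasDerivAt (fun t : ℝ => a + b * t + c * t ^ 2 + d * t ^ 3 + e * t ^ 4) b 0 := by
  have h1 : HasDerivAt (fun t : ℝ => a + b * t) b 0 := by
    simpa using ((hasDerivAt_id (0 : ℝ)).const_mul b).const_add a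
  have h2 : HasDerivAt (fun t : ℝ => c * t ^ 2) 0 0 := by
    simpa using (hasDerivAt_pow 2 (0 : ℝ)).const_mul c
  have h3 : HasDerivAt (fun t : ℝ => d * t ^ 3) 0 0 := by
    simpa using (hasDerivAt_pow 3 (0 : ℝ)).const_mul d
  have h4 : HasDerivAt (fun t : ℝ => e * t ^ 4) 0 0 := by
    simpa using (hasDerivAt_pow 4 (0 : ℝ)).const_mul e
  simpa only [add_zero] using ((h1.fun_add h2).fun_add h3).fun_add h4

lemma hasDerivAt_norm_add_smul_sq {E : Type*} [NormedAddCommGroup E] [InnerProductSpace ℝ E]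
    (a b : E) : HasDerivAt (fun t : ℝ => ‖a + t • b‖ ^ 2) (2 * inner ℝ a b) 0 := by
  have h := hasDerivAt_quartic (‖a‖ ^ 2) (2 * inner ℝ a b) (‖b‖ ^ 2) 0 0
  convert h using 2 with t
  rw [norm_add_sq_real, inner_smul_right, norm_smul, mul_pow, Real.norm_eq_abs, sq_abs]
  ring

lemma hasDerivAt_integral_grad_sq (u h : H1) :
    HasDerivAt (fun t : ℝ => ∫ x, ‖(u + t • h).grad x‖ ^ 2)
      (2 * ∫ x, inner ℝ (u.grad x) (h.grad x)) 0 := by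
  simp only [← H1.norm_gradL_sq, ← H1.inner_gradL, map_add, map_smul]
  exact hasDerivAt_norm_add_smul_sq _ _

lemma hasDerivAt_integral_sq (u h : H1) :
    HasDerivAt (fun t : ℝ => ∫ x, (u + t • h).fn x ^ 2) (2 * ∫ x, u.fn x * h.fn x) 0 := by
  simp only [← H1.norm_fnL_sq, ← H1.inner_fnL, map_add, map_smul]
  exact hasDerivAt_norm_add_smul_sq _ _

lemma H1.fn_add_smul (u h : H1) (t : ℝ) :
    (u + t • h).fn =ᵐ[volume] fun x => u.fn x + t * h.fn x := by
  filter_upwards [H1.fn_add u (t • h), H1.fn_smul t h] with x h1 h2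
  rw [h1, h2]

lemma AdmissiblePotential.hasDerivAt_integral_mul_sq {V : R3 → ℝ} (hV : AdmissiblePotential V)
    (u h : H1) : HasDerivAt (fun t : ℝ => ∫ x, V x * (u + t • h).fn x ^ 2)
      (2 * ∫ x, V x * (u.fn x * h.fn x)) 0 := by
  have hq := hasDerivAt_quartic (∫ x, V x * (u.fn x * u.fn x))
    (2 * ∫ x, V x * (u.fn x * h.fn x)) (∫ x, V x * (h.fn x * h.fn x)) 0 0
  convert hq using 2 with t
  have i1 := hV.integrable_mul u u
  have i2 := (hV.integrable_mul u h).const_mul (2 * t)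
  have i3 := (hV.integrable_mul h h).const_mul (t ^ 2)
  have i12 : Integrable fun x => V x * (u.fn x * u.fn x) + 2 * t * (V x * (u.fn x * h.fn x)) :=
    i1.add i2
  have e : ∫ x, V x * (u + t • h).fn x ^ 2 = ∫ x, (V x * (u.fn x * u.fn x)
      + 2 * t * (V x * (u.fn x * h.fn x)) + t ^ 2 * (V x * (h.fn x * h.fn x))) := by
    refine integral_congr_ae ?_
    filter_upwards [H1.fn_add_smul u h t] with x hx
    rw [hx]; ring
  rw [e, integral_add i12 i3, integral_add i1 i2, integral_const_mul, integral_const_mul]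
  ring

lemma coulombForm_add_add_self {f g k : R3 → ℝ} (hf : L1L2 f) (hg : L1L2 g) (hk : L1L2 k)
    (a b : ℝ) : coulombForm (fun x => f x + (a * g x + b * k x)) (fun x => f x + (a * g x + b * k x))
      = coulombForm f f + 2 * a * coulombForm g f + 2 * b * coulombForm f k
        + a ^ 2 * coulombForm g g + 2 * a * b * coulombForm g k + b ^ 2 * coulombForm k k := by
  have hg' := hg.const_mul a
  have hk' := hk.const_mul b
  have hgk := hg'.add hk'
  have hs := hf.add hgk
  rw [coulombForm_add_left hf hgk hs, coulombForm_add_left hg' hk' hs,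
    coulombForm_add_right hf hf hgk, coulombForm_add_right hg' hf hgk,
    coulombForm_add_right hk' hf hgk, coulombForm_add_right hf hg' hk',
    coulombForm_add_right hg' hg' hk', coulombForm_add_right hk' hg' hk']
  simp only [coulombForm_const_mul_left, coulombForm_const_mul_right]
  rw [coulombForm_comm hf hg, coulombForm_comm hk hg, coulombForm_comm hk hf]
  ring

lemma hasDerivAt_coulombEnergy (u h : H1) :
    HasDerivAt (fun t : ℝ => coulombEnergy (u + t • h)) (4 * coulombTerm u h) 0 := by
  have hq := hasDerivAt_quartic (coulombEnergy u) (4 * coulombTerm u h)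
    (2 * coulombForm (fun x => u.fn x ^ 2) (fun x => h.fn x ^ 2)
      + 4 * coulombForm (fun x => u.fn x * h.fn x) (fun x => u.fn x * h.fn x))
    (4 * coulombForm (fun x => u.fn x * h.fn x) (fun x => h.fn x ^ 2)) (coulombEnergy h)
  have e : (fun t : ℝ => coulombEnergy (u + t • h)) = fun t : ℝ =>
      coulombEnergy u + 4 * coulombTerm u h * t
        + (2 * coulombForm (fun x => u.fn x ^ 2) (fun x => h.fn x ^ 2)
          + 4 * coulombForm (fun x => u.fn x * h.fn x) (fun x => u.fn x * h.fn x)) * t ^ 2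
        + 4 * coulombForm (fun x => u.fn x * h.fn x) (fun x => h.fn x ^ 2) * t ^ 3
        + coulombEnergy h * t ^ 4 := by
    ext t
    have e1 : (fun x => (u + t • h).fn x ^ 2) =ᵐ[volume]
        fun x => u.fn x ^ 2 + (2 * t * (u.fn x * h.fn x) + t ^ 2 * h.fn x ^ 2) := by
      filter_upwards [H1.fn_add_smul u h t] with x hx
      rw [hx]; ring
    rw [coulombTerm_eq, H1.coulombEnergy_eq, H1.coulombEnergy_eq, H1.coulombEnergy_eq,
      coulombForm_congr e1 e1, coulombForm_add_add_self u.L1L2_sq (u.L1L2_mul h) h.L1L2_sq]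
    ring
  rw [e]
  exact hq

/-- Differentiation under the integral: for `|t| < 1` the integrand's derivative is at most `p *
(|u| + |h|) ^ p`, which is integrable. -/
lemma hasDerivAt_integral_rpow {p : ℝ} (hp : 2 < p) (hp6 : p < 6) (u h : H1) :
    HasDerivAt (fun t : ℝ => ∫ x, |(u + t • h).fn x| ^ p) (p * powerForm p u h) 0 := by
  have hp1 : 1 < p := by linarith
  have e : (fun t : ℝ => ∫ x, |(u + t • h).fn x| ^ p)
      = fun t : ℝ => ∫ x, |u.fn x + t * h.fn x| ^ p := by
    ext t
    refine integral_congr_ae ?_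
    filter_upwards [H1.fn_add_smul u h t] with x hx
    rw [hx]
  rw [e]
  have hm : ∀ t : ℝ, AEStronglyMeasurable (fun x => u.fn x + t * h.fn x) volume := fun t =>
    u.aestronglyMeasurable_fn.add (h.aestronglyMeasurable_fn.const_mul t)
  have hmain := hasDerivAt_integral_of_dominated_loc_of_deriv_le (μ := (volume : Measure R3))
    (F := fun (t : ℝ) x => |u.fn x + t * h.fn x| ^ p)
    (F' := fun (t : ℝ) x => p * |u.fn x + t * h.fn x| ^ (p - 2) * (u.fn x + t * h.fn x) * h.fn x)
    (bound := fun x => p * (2 ^ p * (|u.fn x| ^ p + |h.fn x| ^ p)))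
    (s := Metric.ball 0 1) (x₀ := 0) (Metric.ball_mem_nhds _ one_pos)
    (.of_forall fun t => (Real.continuous_rpow_const (by linarith)).comp_aestronglyMeasurable
      (hm t).norm) ?_ ?_ ?_ ?_ ?_
  · have h2 := hmain.2
    simp only [zero_mul, add_zero] at h2
    have h3 : p * powerForm p u h
        = ∫ x, p * |u.fn x| ^ (p - 2) * u.fn x * h.fn x := by
      rw [powerForm, ← integral_const_mul]
      refine integral_congr_ae (.of_forall fun x => ?_)
      ring
    rw [h3]
    exact h2
  · simpa using u.integrable_rpow hp.le hp6
  · simp only [zero_mul, add_zero]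
    exact (((u.aestronglyMeasurable_rpow (by linarith)).const_mul p).mul
      u.aestronglyMeasurable_fn).mul h.aestronglyMeasurable_fn
  · refine .of_forall fun x t ht => ?_
    have ht1 : |t| ≤ 1 := by simpa using (Metric.mem_ball.1 ht).le
    set s := |u.fn x| + |h.fn x| with hs
    have hs0 : 0 ≤ s := by positivity
    have h1 : |u.fn x + t * h.fn x| ≤ s := by
      refine (abs_add_le _ _).trans ?_
      rw [abs_mul, hs]
      nlinarith [abs_nonneg (h.fn x)]
    have h2 : |h.fn x| ≤ s := by rw [hs]; linarith [abs_nonneg (u.fn x)]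
    rw [norm_mul, norm_mul, norm_mul, Real.norm_of_nonneg (by linarith : 0 ≤ p),
      Real.norm_of_nonneg (by positivity : 0 ≤ |u.fn x + t * h.fn x| ^ (p - 2)),
      Real.norm_eq_abs, Real.norm_eq_abs]
    calc p * |u.fn x + t * h.fn x| ^ (p - 2) * |u.fn x + t * h.fn x| * |h.fn x|
        ≤ p * s ^ (p - 2) * s * s := by
          gcongr
      _ = p * s ^ p := by rw [← sq_mul_rpow_sub_two (p := p) (by linarith) hs0]; ring
      _ ≤ _ := by
          gcongr
          exact add_rpow_le (abs_nonneg _) (abs_nonneg _) (by linarith)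
  · exact (((u.integrable_rpow hp.le hp6).add (h.integrable_rpow hp.le hp6)).const_mul
      _).const_mul _
  · refine .of_forall fun x t _ => ?_
    have h1 : HasDerivAt (fun t : ℝ => u.fn x + t * h.fn x) (h.fn x) t := by
      simpa using ((hasDerivAt_id t).mul_const (h.fn x)).const_add (u.fn x)
    exact (hasDerivAt_abs_rpow (u.fn x + t * h.fn x) hp1).comp t h1

/-- The differential of `J_{V,λ}`. -/
lemma AdmissiblePotential.apply_eq_of_hasFDerivAt {V : R3 → ℝ} (hV : AdmissiblePotential V)
    {p lam : ℝ} (hp : 2 < p) (hp6 : p < 6) {u : H1} {D : H1 →L[ℝ] ℝ}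
    (hD : HasFDerivAt (energyJLam V p lam) D u) (h : H1) :
    D h = linForm lam u h + (∫ x, V x * (u.fn x * h.fn x)) + coulombTerm u h
      - powerForm p u h := by
  -- The derivative `D` is given, so differentiability of the energy need not be proved: `D h` is
  -- identified by uniqueness of the derivative along the line in direction `h`.
  have h1 : HasDerivAt (fun t : ℝ => u + t • h) h 0 := by
    simpa using ((hasDerivAt_id (0 : ℝ)).smul_const h).const_add u
  have h2 : HasDerivAt (fun t : ℝ => energyJLam V p lam (u + t • h)) (D h) 0 := by
    have hD' : HasFDerivAt (energyJLam V p lam) D (u + (0 : ℝ) • h) := by simpa using hD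
    exact hD'.comp_hasDerivAt 0 h1
  have h3 := (((((hasDerivAt_integral_grad_sq u h).const_mul (1 / 2)).add
    ((hV.hasDerivAt_integral_mul_sq u h).const_mul (1 / 2))).add
    ((hasDerivAt_coulombEnergy u h).const_mul (1 / 4))).sub
    ((hasDerivAt_integral_rpow hp hp6 u h).const_mul (1 / p))).add
    ((hasDerivAt_integral_sq u h).const_mul (lam / 2))
  have h4 := h2.unique h3
  rw [h4, linForm]
  field_simp
  ring

/-! ### Translation invariance -/

lemma integral_congr_translate {E : Type*} [NormedAddCommGroup E] [NormedSpace ℝ E]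
    {f g : R3 → E} (y : R3) (h : f =ᵐ[volume] fun x => g (x - y)) : ∫ x, f x = ∫ x, g x := by
  rw [integral_congr_ae h, integral_comp_sub]

lemma integral_sq_translate (y : R3) (u : H1) :
    ∫ x, (translate y u).fn x ^ 2 = ∫ x, u.fn x ^ 2 := by
  refine integral_congr_translate (g := fun x => u.fn x ^ 2) y ?_
  filter_upwards [translate_fn y u] with x hx
  rw [hx]

lemma integral_grad_sq_translate (y : R3) (u : H1) :
    ∫ x, ‖(translate y u).grad x‖ ^ 2 = ∫ x, ‖u.grad x‖ ^ 2 := by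
  refine integral_congr_translate (g := fun x => ‖u.grad x‖ ^ 2) y ?_
  filter_upwards [translate_grad y u] with x hx
  rw [hx]

lemma integral_rpow_translate (p : ℝ) (y : R3) (u : H1) :
    ∫ x, |(translate y u).fn x| ^ p = ∫ x, |u.fn x| ^ p := by
  refine integral_congr_translate (g := fun x => |u.fn x| ^ p) y ?_
  filter_upwards [translate_fn y u] with x hx
  rw [hx]

lemma coulombForm_translate (y : R3) (f g : R3 → ℝ) :
    coulombForm (fun x => f (x - y)) (fun x => g (x - y)) = coulombForm f g := by
  simp only [coulombForm, newton_comp_sub]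
  exact integral_comp_sub (fun x => f x * newton g x) y

lemma coulombEnergy_translate (y : R3) (u : H1) :
    coulombEnergy (translate y u) = coulombEnergy u := by
  have e : (fun x => (translate y u).fn x ^ 2) =ᵐ[volume] fun x => u.fn (x - y) ^ 2 := by
    filter_upwards [translate_fn y u] with x hx
    rw [hx]
  rw [H1.coulombEnergy_eq, H1.coulombEnergy_eq, coulombForm_congr e e]
  exact coulombForm_translate y (fun x => u.fn x ^ 2) fun x => u.fn x ^ 2

lemma powerForm_translate (p : ℝ) (y : R3) (u v : H1) :
    powerForm p (translate y u) (translate y v) = powerForm p u v := by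
  refine integral_congr_translate (g := fun x => |u.fn x| ^ (p - 2) * u.fn x * v.fn x) y ?_
  filter_upwards [translate_fn y u, translate_fn y v] with x hx hx'
  rw [hx, hx']

lemma coulombTerm_translate (y : R3) (u v : H1) :
    coulombTerm (translate y u) (translate y v) = coulombTerm u v := by
  have e : (fun x => (translate y u).fn x ^ 2) =ᵐ[volume] fun x => u.fn (x - y) ^ 2 := by
    filter_upwards [translate_fn y u] with x hx
    rw [hx]
  have e' : (fun x => (translate y u).fn x * (translate y v).fn x) =ᵐ[volume]
      fun x => u.fn (x - y) * v.fn (x - y) := by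
    filter_upwards [translate_fn y u, translate_fn y v] with x hx hx'
    rw [hx, hx']
  rw [coulombTerm_eq, coulombTerm_eq, coulombForm_congr e' e]
  exact coulombForm_translate y (fun x => u.fn x * v.fn x) fun x => u.fn x ^ 2

lemma linForm_translate (lam : ℝ) (y : R3) (u v : H1) :
    linForm lam (translate y u) (translate y v) = linForm lam u v := by
  refine congrArg₂ (· + ·) ?_ (congrArg (lam * ·) ?_)
  · refine integral_congr_translate (g := fun x => inner ℝ (u.grad x) (v.grad x)) y ?_
    filter_upwards [translate_grad y u, translate_grad y v] with x hx hx'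
    rw [hx, hx']
  · refine integral_congr_translate (g := fun x => u.fn x * v.fn x) y ?_
    filter_upwards [translate_fn y u, translate_fn y v] with x hx hx'
    rw [hx, hx']

/-! ### Solutions of the limit equation -/

lemma isLimitSolution_iff {p lam : ℝ} {w : H1} : IsLimitSolution p lam w ↔
    ∀ v, linForm lam w v + coulombTerm w v = powerForm p w v := Iff.rfl

/-- Interpolation with the roles reversed: now the square carries the small coefficient, to be
absorbed by the quadratic form in the lower bound for solutions. -/
lemma exists_rpow_le_add_pow_six {p : ℝ} (hp : 2 < p) (hp6 : p < 6) {κ : ℝ} (hκ : 0 < κ) :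
    ∃ K : ℝ, 0 < K ∧ ∀ t : ℝ, 0 ≤ t → t ^ p ≤ κ * t ^ 2 + K * t ^ 6 := by
  set M : ℝ := κ ^ (1 / (p - 2)) with hM
  have hM0 : 0 < M := Real.rpow_pos_of_pos hκ _
  have hMκ : M ^ (p - 2) = κ := by
    rw [hM, ← Real.rpow_mul hκ.le, one_div_mul_cancel (by linarith), Real.rpow_one]
  refine ⟨M ^ (p - 6), by positivity, fun t ht => ?_⟩
  have h1 : 0 ≤ κ * t ^ 2 := by positivity
  have h2 : 0 ≤ M ^ (p - 6) * t ^ 6 := by positivity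
  rcases le_total t M with h | h
  · have h3 : t ^ (p - 2) ≤ κ := by
      rw [← hMκ]; exact Real.rpow_le_rpow ht h (by linarith)
    have h4 : t ^ p ≤ κ * t ^ 2 := by
      rw [← sq_mul_rpow_sub_two (by linarith) ht, ← sq, mul_comm κ]; gcongr
    linarith
  · have ht0 : 0 < t := hM0.trans_le h
    have h3 : t ^ p = t ^ (p - 6) * t ^ 6 := by
      rw [← Real.rpow_natCast t 6, ← Real.rpow_add ht0]; congr 1; push_cast; ring
    have h4 : t ^ (p - 6) ≤ M ^ (p - 6) := Real.rpow_le_rpow_of_nonpos hM0 h (by linarith)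
    have h5 : t ^ p ≤ M ^ (p - 6) * t ^ 6 := by rw [h3]; gcongr
    linarith

lemma coulombTerm_self_nonneg (u : H1) : 0 ≤ coulombTerm u u := by
  rw [coulombTerm_eq]
  refine integral_nonneg fun x => mul_nonneg (mul_self_nonneg _) (integral_nonneg fun y => ?_)
  positivity

lemma powerForm_self {p : ℝ} (hp : p ≠ 0) (u : H1) : powerForm p u u = ∫ x, |u.fn x| ^ p := by
  refine integral_congr_ae (.of_forall fun x => ?_)
  simp only
  rw [← sq_mul_rpow_sub_two hp (abs_nonneg _), abs_mul_abs_self]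
  ring

/-- Nontrivial solutions of the limit equation are bounded away from zero. -/
lemma exists_le_norm_sq_of_isLimitSolution {p lam : ℝ} (hp : 2 < p) (hp6 : p < 6)
    (hlam : 0 < lam) : ∃ m : ℝ, 0 < m ∧ ∀ w : H1, w ≠ 0 → IsLimitSolution p lam w →
      m ≤ ‖w‖ ^ 2 := by
  obtain ⟨S, hS0, hS⟩ := H1.exists_integral_pow_six_le
  set μ := min 1 lam with hμ
  have hμ0 : 0 < μ := lt_min one_pos hlam
  obtain ⟨K, hK0, hK⟩ := exists_rpow_le_add_pow_six hp hp6 (half_pos hμ0)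
  -- Testing the equation with `w` gives `μ / 2 * ‖w‖ ^ 2 ≤ K * (S + 1) * ‖w‖ ^ 6`, hence a lower
  -- bound for `‖w‖ ^ 4`. Using `S + 1` in place of `S` keeps the denominator positive.
  refine ⟨√(μ / 2 / (K * (S + 1))), by positivity, fun w hw hsol => ?_⟩
  have hn : 0 < ‖w‖ := norm_pos_iff.2 hw
  have h1 := isLimitSolution_iff.1 hsol w
  rw [powerForm_self (by linarith)] at h1
  have h2 := min_mul_norm_sq_le_linForm lam w
  have h3 := coulombTerm_self_nonneg w
  have h4 : ∫ x, |w.fn x| ^ p ≤ μ / 2 * ‖w‖ ^ 2 + K * (S * ‖w‖ ^ 6) := by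
    calc ∫ x, |w.fn x| ^ p ≤ ∫ x, (μ / 2 * w.fn x ^ 2 + K * w.fn x ^ 6) := by
          refine integral_mono (w.integrable_rpow hp.le hp6)
            ((w.integrable_sq.const_mul _).add (w.integrable_pow_six.const_mul K)) fun x => ?_
          have := hK |w.fn x| (abs_nonneg _)
          rwa [abs_pow_six, sq_abs] at this
      _ = μ / 2 * (∫ x, w.fn x ^ 2) + K * ∫ x, w.fn x ^ 6 := by
          rw [integral_add (w.integrable_sq.const_mul _) (w.integrable_pow_six.const_mul K),
            integral_const_mul, integral_const_mul]
      _ ≤ _ := by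
          gcongr
          · exact w.integral_sq_le
          · exact hS w
  have h5 : μ / 2 * ‖w‖ ^ 2 ≤ K * (S + 1) * (‖w‖ ^ 2) ^ 2 * ‖w‖ ^ 2 := by
    have h6 : K * (S * ‖w‖ ^ 6) ≤ K * (S + 1) * (‖w‖ ^ 2) ^ 2 * ‖w‖ ^ 2 := by
      have : 0 ≤ K * ‖w‖ ^ 6 := by positivity
      nlinarith
    linarith
  have h6 : μ / 2 ≤ K * (S + 1) * (‖w‖ ^ 2) ^ 2 := le_of_mul_le_mul_right h5 (by positivity)
  refine Real.sqrt_le_iff.2 ⟨by positivity, ?_⟩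
  rw [div_le_iff₀ (by positivity)]
  linarith

/-! ### Splitting functionals -/

/-- Translation invariant functionals that are asymptotically additive along weakly null bounded
perturbations. -/
structure IsSplitting (G : H1 → ℝ) : Prop where
  map_translate : ∀ y u, G (translate y u) = G u
  tendsto_sub : ∀ (c : ℕ → H1) (C : ℝ) (w : H1), WeakTo c 0 → (∀ n, ‖c n‖ ≤ C) →
    Tendsto (fun n => G (c n + w) - G (c n) - G w) atTop (𝓝 0)

lemma isSplitting_integral_sq : IsSplitting fun u => ∫ x, u.fn x ^ 2 := by
  refine ⟨integral_sq_translate, fun c C w hc hC => ?_⟩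
  have h := (hc.apply ((innerSL ℝ (H1.fnL w)).comp H1.fnL)).const_mul 2
  rw [map_zero, mul_zero] at h
  refine h.congr fun n => ?_
  simp only [← H1.norm_fnL_sq, map_add, norm_add_sq_real, ContinuousLinearMap.comp_apply,
    innerSL_apply_apply, real_inner_comm (H1.fnL (c n))]
  ring

lemma isSplitting_integral_grad_sq : IsSplitting fun u => ∫ x, ‖u.grad x‖ ^ 2 := by
  refine ⟨integral_grad_sq_translate, fun c C w hc hC => ?_⟩
  have h := (hc.apply ((innerSL ℝ (H1.gradL w)).comp H1.gradL)).const_mul 2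
  rw [map_zero, mul_zero] at h
  refine h.congr fun n => ?_
  simp only [← H1.norm_gradL_sq, map_add, norm_add_sq_real, ContinuousLinearMap.comp_apply,
    innerSL_apply_apply, real_inner_comm (H1.gradL (c n))]
  ring

lemma isSplitting_coulombEnergy : IsSplitting coulombEnergy :=
  ⟨coulombEnergy_translate, fun _ _ w hc hC => hc.tendsto_coulombEnergy_sub hC w⟩

lemma isSplitting_integral_rpow {p : ℝ} (hp : 3 < p) (hp6 : p < 6) :
    IsSplitting fun u => ∫ x, |u.fn x| ^ p :=
  ⟨integral_rpow_translate p, fun _ _ w hc hC => hc.tendsto_integral_rpow_sub hp hp6 hC w⟩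

namespace IsSplitting

variable {F G : H1 → ℝ}

lemma add (hF : IsSplitting F) (hG : IsSplitting G) : IsSplitting fun u => F u + G u := by
  refine ⟨fun y u => by rw [hF.1, hG.1], fun c C w hc hC => ?_⟩
  have h := (hF.2 c C w hc hC).add (hG.2 c C w hc hC)
  rw [add_zero] at h
  exact h.congr fun n => by ring

lemma const_mul (hF : IsSplitting F) (a : ℝ) : IsSplitting fun u => a * F u := by
  refine ⟨fun y u => by rw [hF.1], fun c C w hc hC => ?_⟩
  have h := (hF.2 c C w hc hC).const_mul a
  rw [mul_zero] at h
  exact h.congr fun n => by ring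

end IsSplitting

lemma isSplitting_norm_sq : IsSplitting fun u => ‖u‖ ^ 2 := by
  simp only [H1.norm_sq_eq]
  exact isSplitting_integral_sq.add isSplitting_integral_grad_sq

lemma isSplitting_energyILam {p : ℝ} (hp : 3 < p) (hp6 : p < 6) (lam : ℝ) :
    IsSplitting (energyILam p lam) := by
  have h := (((isSplitting_integral_grad_sq.const_mul (1 / 2)).add
    (isSplitting_coulombEnergy.const_mul (1 / 4))).add
    ((isSplitting_integral_rpow hp hp6).const_mul (-(1 / p)))).add
    (isSplitting_integral_sq.const_mul (lam / 2))
  convert h using 2 with u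
  rw [energyILam, energyI]
  ring

/-! ### Profiles -/

/-- `w j` is the weak limit of `u` recentred at `y j`, and the centres separate. -/
structure IsProfileSystem {ι : Type*} (u : ℕ → H1) (w : ι → H1) (y : ι → ℕ → R3) : Prop where
  weakTo : ∀ j, WeakTo (fun n => translate (-(y j n)) (u n)) (w j)
  separated : ∀ i j, i ≠ j → Tendsto (fun n => ‖y i n - y j n‖) atTop atTop

/-- What remains of `u` after the profiles in `s` have been removed. -/
def remainder {ι : Type*} (u : ℕ → H1) (w : ι → H1) (y : ι → ℕ → R3) (s : Finset ι) (n : ℕ) :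
    H1 := u n - ∑ j ∈ s, translate (y j n) (w j)

namespace IsProfileSystem

variable {ι : Type*} {u : ℕ → H1} {w : ι → H1} {y : ι → ℕ → R3} {C : ℝ}

lemma exists_norm_remainder_le (hC : ∀ n, ‖u n‖ ≤ C) (w : ι → H1) (y : ι → ℕ → R3)
    (s : Finset ι) : ∃ C', ∀ n, ‖remainder u w y s n‖ ≤ C' := by
  refine ⟨C + ∑ j ∈ s, ‖w j‖, fun n => (norm_sub_le _ _).trans (add_le_add (hC n) ?_)⟩
  refine (norm_sum_le _ _).trans (le_of_eq ?_)
  simp only [norm_translate]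

/-- Seen from the centre `y j`, all other profiles escape and are weakly null, while profile `j` is
subtracted exactly if it belongs to `s`. -/
lemma weakTo_remainder [DecidableEq ι] (h : IsProfileSystem u w y) (s : Finset ι) (j : ι) :
    WeakTo (fun n => translate (-(y j n)) (remainder u w y s n)) (if j ∈ s then 0 else w j) := by
  have h1 : WeakTo (fun n => ∑ i ∈ s, translate (-(y j n)) (translate (y i n) (w i)))
      (∑ i ∈ s, if i = j then w j else 0) := by
    refine WeakTo.sum s fun i _ => ?_
    simp only [translate_translate]
    split_ifs with hij
    · subst hij
      simp only [neg_add_cancel, translate_zero]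
      exact WeakTo.const _
    · refine weakTo_translate_of_tendsto_atTop _ ?_
      refine (h.2 i j hij).congr fun n => ?_
      rw [sub_eq_neg_add]
  have h2 := (h.1 j).sub h1
  rw [Finset.sum_ite_eq'] at h2
  have e : w j - (if j ∈ s then w j else 0) = if j ∈ s then 0 else w j := by
    split_ifs <;> simp
  rw [e] at h2
  simpa only [remainder, translate_sub, translate_sum] using h2

/-- Splitting functionals decouple along the profiles. -/
lemma tendsto_splitting [DecidableEq ι] (h : IsProfileSystem u w y) (hC : ∀ n, ‖u n‖ ≤ C)
    {G : H1 → ℝ} (hG : IsSplitting G) (s : Finset ι) :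
    Tendsto (fun n => G (u n) - G (remainder u w y s n)) atTop (𝓝 (∑ j ∈ s, G (w j))) := by
  induction s using Finset.induction_on with
  | empty => simp [remainder]
  | insert j s hj ih =>
    rw [Finset.sum_insert hj]
    obtain ⟨C', hC'⟩ := exists_norm_remainder_le hC w y (insert j s)
    have hw := h.weakTo_remainder (insert j s) j
    rw [if_pos (Finset.mem_insert_self j s)] at hw
    -- The recentred remainder after removal of `j` is weakly null, and adding `w j` back gives the
    -- recentred previous remainder; asymptotic additivity then peels off `G (w j)`.
    have h1 := hG.2 _ C' (w j) hw fun n => by rw [norm_translate]; exact hC' n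
    have h2 := (h1.add ih).const_add (G (w j))
    rw [zero_add] at h2
    refine h2.congr fun n => ?_
    have e : translate (-(y j n)) (remainder u w y (insert j s) n) + w j
        = translate (-(y j n)) (remainder u w y s n) := by
      simp only [remainder, Finset.sum_insert hj, translate_sub, translate_add,
        translate_neg_translate]
      abel
    rw [e, hG.1, hG.1]
    ring

/-- The squared norm splits and the remainder contributes a nonnegative amount. This bound limits
the number of profiles. -/
lemma sum_norm_sq_le [Fintype ι] [DecidableEq ι] (h : IsProfileSystem u w y)
    (hC : ∀ n, ‖u n‖ ≤ C) : ∑ j, ‖w j‖ ^ 2 ≤ C ^ 2 := by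
  refine le_of_tendsto (h.tendsto_splitting hC isSplitting_norm_sq Finset.univ)
    (.of_forall fun n => ?_)
  have h1 : ‖u n‖ ^ 2 ≤ C ^ 2 := by gcongr; exact hC n
  have h2 : 0 ≤ ‖remainder u w y Finset.univ n‖ ^ 2 := by positivity
  linarith

/-- A non-vanishing remainder produces a further profile. -/
lemma exists_snoc {k : ℕ} {w : Fin k → H1} {y : Fin k → ℕ → R3} (h : IsProfileSystem u w y)
    (hC : ∀ n, ‖u n‖ ≤ C) (hr : ¬ Vanishing (remainder u w y Finset.univ)) :
    ∃ (σ : ℕ → ℕ) (w' : H1) (y' : ℕ → R3), StrictMono σ ∧ w' ≠ 0 ∧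
      IsProfileSystem (fun n => u (σ n)) (Fin.snoc (α := fun _ => H1) w w')
        (Fin.snoc (α := fun _ => ℕ → R3) (fun j n => y j (σ n)) y') := by
  set r := remainder u w y Finset.univ with hrdef
  obtain ⟨C', hC'⟩ := exists_norm_remainder_le hC w y Finset.univ
  simp only [Vanishing, WeakTo, not_forall] at hr
  obtain ⟨z, v, hzv⟩ := hr
  rw [inner_zero_left, Metric.tendsto_atTop] at hzv
  push Not at hzv
  obtain ⟨ε, hε, hfr⟩ := hzv
  have hfr' : ∃ᶠ n in atTop, ε ≤ dist (inner ℝ (translate (z n) (r n)) v) 0 :=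
    frequently_atTop.2 fun N => hfr N
  obtain ⟨σ₁, hσ₁, hε₁⟩ := extraction_of_frequently_atTop hfr'
  obtain ⟨w', σ₂, hσ₂, hw'⟩ := exists_weakTo_subseq (a := fun n => translate (z (σ₁ n)) (r (σ₁ n)))
    (C := C') fun n => by rw [norm_translate]; exact hC' _
  set σ := σ₁ ∘ σ₂ with hσdef
  have hσ : StrictMono σ := hσ₁.comp hσ₂
  -- The pairings with `v` stay at distance at least `ε` from zero along the subsequence, so their
  -- limit does too.
  have hw'0 : w' ≠ 0 := by
    rintro rfl
    have h1 := hw' v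
    rw [inner_zero_left] at h1
    have h2 := (tendsto_iff_dist_tendsto_zero.1 h1)
    exact absurd (ge_of_tendsto h2 (.of_forall fun n => hε₁ (σ₂ n))) (not_le.2 hε)
  -- Recentred at `y j` the remainder is weakly null, yet a further shift by `z + y j` yields the
  -- nonzero limit `w'`; such shifts must be unbounded. The new centre is `-z`, so this is
  -- separation.
  have hsep : ∀ j, Tendsto (fun n => ‖z (σ n) + y j (σ n)‖) atTop atTop := by
    intro j
    have h1 := (h.weakTo_remainder Finset.univ j).comp hσ
    rw [if_pos (Finset.mem_univ j)] at h1
    refine tendsto_norm_atTop_of_weakTo_translate h1 (C := C')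
      (fun n => by rw [norm_translate]; exact hC' _) (w := w') ?_ hw'0
    simp only [translate_translate, add_neg_cancel_right]
    exact hw'
  refine ⟨σ, w', fun n => -z (σ n), hσ, hw'0, ?_, ?_⟩
  · intro j
    refine Fin.lastCases ?_ (fun j => ?_) j
    · simp only [Fin.snoc_last, neg_neg]
      -- The old profiles escape from the new centre, so the full sequence has the same recentred
      -- weak limit as the remainder.
      have h1 : WeakTo (fun n => ∑ j, translate (z (σ n)) (translate (y j (σ n)) (w j)))
          (∑ _j : Fin k, (0 : H1)) := by
        refine WeakTo.sum _ fun j _ => ?_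
        simp only [translate_translate]
        exact weakTo_translate_of_tendsto_atTop _ (hsep j)
      have h2 := hw'.add h1
      rw [Finset.sum_const_zero, add_zero] at h2
      convert h2 using 2 with n
      simp only [hrdef, remainder, translate_sub, translate_sum, hσdef, Function.comp_apply,
        sub_add_cancel]
    · simp only [Fin.snoc_castSucc]
      exact (h.1 j).comp hσ
  · intro i j
    refine Fin.lastCases ?_ (fun i => ?_) i <;> refine Fin.lastCases ?_ (fun j => ?_) j
    · intro hij; exact absurd rfl hij
    · intro _
      simp only [Fin.snoc_last, Fin.snoc_castSucc]
      refine (hsep j).congr fun n => ?_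
      rw [← norm_neg]; congr 1; abel
    · intro _
      simp only [Fin.snoc_last, Fin.snoc_castSucc]
      refine (hsep i).congr fun n => ?_
      congr 1; abel
    · intro hij
      simp only [Fin.snoc_castSucc]
      exact (h.2 i j fun e => hij (by rw [e])).comp hσ.tendsto_atTop

end IsProfileSystem

/-! ### Palais–Smale sequences -/

section

variable {V : R3 → ℝ} {p lam C : ℝ} {u : ℕ → H1} {D : ℕ → H1 →L[ℝ] ℝ}

lemma tendsto_apply_of_norm_le {h : ℕ → H1} {M : ℝ} (hD : Tendsto D atTop (𝓝 0))
    (hM : ∀ n, ‖h n‖ ≤ M) : Tendsto (fun n => D n (h n)) atTop (𝓝 0) := by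
  have h1 := (Filter.Tendsto.norm (E := H1 →L[ℝ] ℝ) hD).mul_const M
  rw [ContinuousLinearMap.opNorm_zero, zero_mul] at h1
  refine squeeze_zero_norm (fun n => ((D n).le_opNorm (h n)).trans ?_) h1
  gcongr
  exact hM n

/-- Recentred weak limits of Palais–Smale sequences along escaping centres solve the limit
equation. -/
lemma isLimitSolution_of_weakTo (hV : AdmissiblePotential V) (hp : 3 < p) (hp6 : p < 6)
    (hC : ∀ n, ‖u n‖ ≤ C) (hDer : ∀ n, HasFDerivAt (energyJLam V p lam) (D n) (u n))
    (hD : Tendsto D atTop (𝓝 0)) {y : ℕ → R3} (hy : Tendsto (fun n => ‖y n‖) atTop atTop)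
    {w : H1} (hw : WeakTo (fun n => translate (-(y n)) (u n)) w) : IsLimitSolution p lam w := by
  rw [isLimitSolution_iff]
  intro v
  have hC' : ∀ n, ‖translate (-(y n)) (u n)‖ ≤ C := fun n => by rw [norm_translate]; exact hC n
  -- The test function travels with the centre. Its norm is constant, and all terms except the
  -- potential can be translated back to the origin.
  have h0 := tendsto_apply_of_norm_le (h := fun n => translate (y n) v) hD
    fun n => (norm_translate (y n) v).le
  -- The escaping test function is the weakly null factor; `u n` is only bounded.
  have hV0 : Tendsto (fun n => ∫ x, V x * ((translate (y n) v).fn x * (u n).fn x)) atTop (𝓝 0) :=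
    hV.tendsto_integral_mul (C := max C ‖v‖) (weakTo_translate_of_tendsto_atTop v hy)
      (fun n => by rw [norm_translate]; exact le_max_right _ _)
      fun n => (hC n).trans (le_max_left _ _)
  have h1 : Tendsto (fun n => linForm lam (translate (-(y n)) (u n)) v
      + (∫ x, V x * ((translate (y n) v).fn x * (u n).fn x))
      + coulombTerm (translate (-(y n)) (u n)) v - powerForm p (translate (-(y n)) (u n)) v) atTop
      (𝓝 (linForm lam w v + 0 + coulombTerm w v - powerForm p w v)) := by
    have hl := hw.tendsto_linForm lam v
    simp only [linForm_comm lam v] at hl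
    exact ((hl.add hV0).add (hw.tendsto_coulomb_mul hC' v)).sub
      (hw.tendsto_powerForm hp hp6 hC' v)
  have h2 := tendsto_nhds_unique h1 (h0.congr fun n => ?_)
  · linarith
  · rw [hV.apply_eq_of_hasFDerivAt (by linarith) hp6 (hDer n),
      ← linForm_translate lam (-(y n)) (u n), ← coulombTerm_translate (-(y n)) (u n),
      ← powerForm_translate p (-(y n)) (u n), translate_neg_translate]
    simp only [mul_comm ((translate (y n) v).fn _)]

/-- Vanishing remainders of Palais–Smale sequences converge strongly. -/
lemma tendsto_remainder_of_vanishing {ι : Type*} [Fintype ι] [DecidableEq ι] {w : ι → H1}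
    {y : ι → ℕ → R3} (hr : Vanishing (remainder u w y Finset.univ)) (hV : AdmissiblePotential V)
    (hp : 2 < p) (hp6 : p < 6) (hlam : 0 < lam) (hC : ∀ n, ‖u n‖ ≤ C)
    (hDer : ∀ n, HasFDerivAt (energyJLam V p lam) (D n) (u n)) (hD : Tendsto D atTop (𝓝 0)) :
    Tendsto (remainder u w y Finset.univ) atTop (𝓝 0) := by
  set r := remainder u w y Finset.univ with hrdef
  obtain ⟨C', hC'⟩ := IsProfileSystem.exists_norm_remainder_le hC w y Finset.univ
  have hrM : ∀ n, ‖r n‖ ≤ max C C' := fun n => (hC' n).trans (le_max_right _ _)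
  have huM : ∀ n, ‖u n‖ ≤ max C C' := fun n => (hC n).trans (le_max_left _ _)
  have hr0 : WeakTo r 0 := by simpa only [translate_zero] using hr fun _ => 0
  have t1 := tendsto_apply_of_norm_le hD hrM
  have t2 := hV.tendsto_integral_mul hr0 hrM huM
  have t3 := hr.tendsto_coulomb_mul hrM huM
  have t4 := hr.tendsto_powerForm hp hp6 hrM huM
  -- Translating back pairs the fixed `w j` with a translate of the remainder, which is weakly null
  -- by vanishing.
  have t5 : Tendsto (fun n => ∑ j, linForm lam (translate (y j n) (w j)) (r n)) atTop
      (𝓝 (∑ _j : ι, 0)) := by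
    refine tendsto_finsetSum _ fun j _ => ?_
    have h1 := (hr fun n => -(y j n)).tendsto_linForm lam (w j)
    have h2 : linForm lam (w j) 0 = 0 := by simp [linForm_eq]
    rw [h2] at h1
    refine h1.congr fun n => ?_
    rw [← linForm_translate lam (y j n), translate_translate_neg]
  -- Substitute `r = u - ∑ translates` in the first argument only, and express `linForm lam u r`
  -- through the derivative at `u` applied to `r`.
  have t6 : Tendsto (fun n => linForm lam (r n) (r n)) atTop (𝓝 0) := by
    have t7 := (((t1.sub t2).sub t3).add t4).sub t5
    simp only [Finset.sum_const_zero, sub_zero, add_zero] at t7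
    refine t7.congr fun n => ?_
    have e1 : linForm lam (r n) (r n) = linForm lam (u n) (r n)
        - ∑ j, linForm lam (translate (y j n) (w j)) (r n) := by
      rw [← linForm_sum_left, ← linForm_sub_left]; rfl
    have e2 := hV.apply_eq_of_hasFDerivAt hp hp6 (hDer n) (r n)
    simp only [mul_comm ((r n).fn _) ((u n).fn _)]
    rw [e1, e2, coulombTerm]
    ring
  have hμ : 0 < min 1 lam := lt_min one_pos hlam
  have t8 : Tendsto (fun n => ‖r n‖ ^ 2) atTop (𝓝 0) := by
    have t9 := t6.const_mul (min 1 lam)⁻¹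
    rw [mul_zero] at t9
    refine squeeze_zero (fun n => by positivity) (fun n => ?_) t9
    rw [le_inv_mul_iff₀ hμ]
    exact min_mul_norm_sq_le_linForm lam (r n)
  rw [tendsto_zero_iff_norm_tendsto_zero]
  have t10 := t8.sqrt
  simpa [Real.sqrt_sq (norm_nonneg _)] using t10

/-! ### Limits of the energy and termination of the extraction -/

lemma energyJLam_eq (V : R3 → ℝ) (p lam : ℝ) (u : H1) :
    energyJLam V p lam u = energyILam p lam u + 1 / 2 * ∫ x, V x * u.fn x ^ 2 := by
  rw [energyJLam, energyJ, energyILam, energyI]; ring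

/-- Factor `u² - u₀² = (u - u₀)(u + u₀)`: one factor is weakly null, the other bounded. -/
lemma AdmissiblePotential.tendsto_integral_sq (hV : AdmissiblePotential V) {u₀ : H1}
    (h : WeakTo u u₀) (hC : ∀ n, ‖u n‖ ≤ C) :
    Tendsto (fun n => ∫ x, V x * (u n).fn x ^ 2) atTop (𝓝 (∫ x, V x * u₀.fn x ^ 2)) := by
  have hC0 : 0 ≤ C := (norm_nonneg _).trans (hC 0)
  have h1 := hV.tendsto_integral_mul h.sub_self (C := C + ‖u₀‖) (a := fun n => u n + u₀)
    (fun n => (norm_sub_le _ _).trans (add_le_add (hC n) le_rfl))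
    (fun n => (norm_add_le _ _).trans (add_le_add (hC n) le_rfl))
  have h2 := h1.add_const (∫ x, V x * u₀.fn x ^ 2)
  rw [zero_add] at h2
  refine h2.congr fun n => ?_
  have i := hV.integrable_mul u₀ u₀
  simp only [← sq] at i
  rw [← integral_add (hV.integrable_mul _ _) i]
  refine integral_congr_ae ?_
  filter_upwards [H1.fn_sub (u n) u₀, H1.fn_add (u n) u₀] with x hx hx'
  rw [hx, hx']; ring

lemma tendsto_integral_sq_zero {r : ℕ → H1} (h : Tendsto r atTop (𝓝 0)) :
    Tendsto (fun n => ∫ x, (r n).fn x ^ 2) atTop (𝓝 0) := by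
  have h1 := (tendsto_zero_iff_norm_tendsto_zero.1 h).pow 2
  rw [zero_pow two_ne_zero] at h1
  exact squeeze_zero (fun n => integral_nonneg fun x => sq_nonneg _)
    (fun n => (r n).integral_sq_le) h1

lemma tendsto_energyILam_zero (hp : 2 < p) (hp6 : p < 6) {r : ℕ → H1} (hr : Vanishing r)
    (hC : ∀ n, ‖r n‖ ≤ C) (h : Tendsto r atTop (𝓝 0)) :
    Tendsto (fun n => energyILam p lam (r n)) atTop (𝓝 0) := by
  have t1 := tendsto_integral_sq_zero h
  have t2 : Tendsto (fun n => ∫ x, ‖(r n).grad x‖ ^ 2) atTop (𝓝 0) := by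
    have h1 := (tendsto_zero_iff_norm_tendsto_zero.1 h).pow 2
    rw [zero_pow two_ne_zero] at h1
    refine squeeze_zero (fun n => integral_nonneg fun x => sq_nonneg _) (fun n => ?_) h1
    rw [H1.norm_sq_eq]
    have : 0 ≤ ∫ x, (r n).fn x ^ 2 := integral_nonneg fun x => sq_nonneg _
    linarith
  have t3 := hr.tendsto_integral_rpow hC hp hp6
  obtain ⟨M, hM0, hM⟩ := H1.exists_newton_mul_le C
  have t4 : Tendsto (fun n => coulombEnergy (r n)) atTop (𝓝 0) := by
    simp only [H1.coulombEnergy_eq]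
    refine tendsto_coulombForm_of_tendsto_integral (M := M) (fun n => (r n).integrable_sq)
      (by simpa only [abs_pow, sq_abs] using t1) fun n x => ?_
    simpa only [sq] using hM _ _ (hC n) (hC n) x
  have t := (((t2.const_mul (1 / 2)).add (t4.const_mul (1 / 4))).sub (t3.const_mul (1 / p))).add
    (t1.const_mul (lam / 2))
  simp only [mul_zero, add_zero, sub_zero] at t
  exact t

/-- Bounded Palais–Smale sequences admit a finite profile decomposition with vanishing
remainder. -/
lemma exists_profileSystem (hV : AdmissiblePotential V) (hp : 3 < p) (hp6 : p < 6)
    (hlam : 0 < lam) (hC : ∀ n, ‖u n‖ ≤ C)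
    (hDer : ∀ n, HasFDerivAt (energyJLam V p lam) (D n) (u n)) (hD : Tendsto D atTop (𝓝 0))
    {u₀ : H1} (hu : WeakTo u u₀) :
    ∃ (σ : ℕ → ℕ) (k : ℕ) (w : Fin (k + 1) → H1) (y : Fin (k + 1) → ℕ → R3), StrictMono σ ∧
      w 0 = u₀ ∧ y 0 = 0 ∧ (∀ j : Fin k, w j.succ ≠ 0) ∧
      IsProfileSystem (fun n => u (σ n)) w y ∧
      Vanishing (remainder (fun n => u (σ n)) w y Finset.univ) := by
  by_contra hcon
  -- If the process never stopped, there would be systems with any number `k` of nonzero profiles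
  -- beyond the initial one.
  have key : ∀ k : ℕ, ∃ (σ : ℕ → ℕ) (w : Fin (k + 1) → H1) (y : Fin (k + 1) → ℕ → R3),
      StrictMono σ ∧ w 0 = u₀ ∧ y 0 = 0 ∧ (∀ j : Fin k, w j.succ ≠ 0) ∧
      IsProfileSystem (fun n => u (σ n)) w y := by
    intro k
    induction k with
    | zero =>
      -- Index `0` is reserved for the weak limit `u₀` with centre `0`. It may vanish and is not
      -- among the solutions counted.
      refine ⟨id, fun _ => u₀, fun _ => 0, strictMono_id, rfl, rfl, fun j => j.elim0, ?_, ?_⟩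
      · intro j
        simpa [translate_zero] using hu
      · intro i j hij
        exact absurd (Fin.ext (by omega)) hij
    | succ k ih =>
      obtain ⟨σ, w, y, hσ, hw0, hy0, hw, hsys⟩ := ih
      have hr : ¬ Vanishing (remainder (fun n => u (σ n)) w y Finset.univ) := fun hr =>
        hcon ⟨σ, k, w, y, hσ, hw0, hy0, hw, hsys, hr⟩
      obtain ⟨τ, w', y', hτ, hw', hsys'⟩ := hsys.exists_snoc (fun n => hC (σ n)) hr
      refine ⟨σ ∘ τ, _, _, hσ.comp hτ, ?_, ?_, ?_, hsys'⟩
      · rw [← Fin.castSucc_zero, Fin.snoc_castSucc, hw0]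
      · rw [← Fin.castSucc_zero, Fin.snoc_castSucc, hy0]; rfl
      · intro j
        refine Fin.lastCases ?_ (fun j => ?_) j
        · rw [Fin.succ_last, Fin.snoc_last]; exact hw'
        · rw [Fin.succ_castSucc, Fin.snoc_castSucc]; exact hw j
  obtain ⟨m, hm0, hm⟩ := exists_le_norm_sq_of_isLimitSolution (p := p) (by linarith) hp6 hlam
  -- With this many profiles of squared norm at least `m`, the sum of squared norms would exceed `C
  -- ^ 2`.
  obtain ⟨k, hk⟩ := exists_nat_gt (C ^ 2 / m)
  obtain ⟨σ, w, y, hσ, hw0, hy0, hw, hsys⟩ := key k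
  have h1 := hsys.sum_norm_sq_le fun n => hC (σ n)
  rw [Fin.sum_univ_succ] at h1
  have h2 : ∀ j : Fin k, m ≤ ‖w j.succ‖ ^ 2 := by
    intro j
    refine hm _ (hw j) (isLimitSolution_of_weakTo hV hp hp6 (fun n => hC (σ n))
      (fun n => hDer (σ n)) (hD.comp hσ.tendsto_atTop) ?_ (hsys.1 j.succ))
    have h3 := hsys.2 j.succ 0 (Fin.succ_ne_zero j)
    simpa [hy0] using h3
  have h3 : (k : ℝ) * m ≤ ∑ j : Fin k, ‖w j.succ‖ ^ 2 := by
    have := Finset.sum_le_sum fun (j : Fin k) (_ : j ∈ Finset.univ) => h2 j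
    simpa using this
  rw [div_lt_iff₀ hm0] at hk
  have h4 : 0 ≤ ‖w 0‖ ^ 2 := by positivity
  linarith

end

end SchrodingerPoisson

end

/-! ### The splitting lemma -/

theorem mainTheorem7 (p lam : ℝ) (hp : 10 / 3 < p) (hp6 : p < 6) (hlam : 0 < lam)
    (V : SchrodingerPoisson.R3 → ℝ) (q : ℝ≥0∞) (hq : 3 / 2 ≤ q) (hV : MemLp V q volume)
    (hVneg : MemLp (SchrodingerPoisson.negPart V) (3 / 2) volume)
    (hVS : (eLpNorm (SchrodingerPoisson.negPart V) (3 / 2) volume).toReal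
      < SchrodingerPoisson.sobolevS)
    (hV0 : SchrodingerPoisson.VanishesAtInfinity V)
    (u : ℕ → SchrodingerPoisson.H1) (u₀ : SchrodingerPoisson.H1)
    (hbdd : ∃ C : ℝ, ∀ n, ‖u n‖ ≤ C)
    (hPS : SchrodingerPoisson.IsPalaisSmale (SchrodingerPoisson.energyJLam V p lam) u)
    (hweak : SchrodingerPoisson.WeaklyConverges u u₀) :
    ∃ σ : ℕ → ℕ, StrictMono σ ∧
    ∃ (k : ℕ) (w : Fin k → SchrodingerPoisson.H1) (y : Fin k → ℕ → SchrodingerPoisson.R3),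
      (∀ j, w j ≠ 0 ∧ SchrodingerPoisson.IsLimitSolution p lam (w j)) ∧
      (∀ j, Tendsto (fun n => ‖y j n‖) atTop atTop) ∧
      Tendsto (fun n => u (σ n) - (u₀ + ∑ j, SchrodingerPoisson.translate (y j n) (w j)))
        atTop (𝓝 0) ∧
      Tendsto (fun n => ∫ x, (u (σ n)).fn x ^ 2) atTop
        (𝓝 ((∫ x, u₀.fn x ^ 2) + ∑ j, ∫ x, (w j).fn x ^ 2)) ∧
      Tendsto (fun n => SchrodingerPoisson.energyJLam V p lam (u (σ n))) atTop
        (𝓝 (SchrodingerPoisson.energyJLam V p lam u₀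
          + ∑ j, SchrodingerPoisson.energyILam p lam (w j))) := by
  open SchrodingerPoisson in
  obtain ⟨C, hC⟩ := hbdd
  obtain ⟨-, D, hDer, hD⟩ := hPS
  have hVa := admissiblePotential_of_memLp hq hV hV0
  have hp3 : 3 < p := by linarith
  have hu := hweak.weakTo
  obtain ⟨σ, k, w, y, hσ, hw0, hy0, hw, hsys, hvan⟩ :=
    exists_profileSystem hVa hp3 hp6 hlam hC hDer hD hu
  have hCσ : ∀ n, ‖u (σ n)‖ ≤ C := fun n => hC (σ n)
  have hDerσ := fun n => hDer (σ n)
  have hDσ : Tendsto (fun n => D (σ n)) atTop (𝓝 0) := hD.comp hσ.tendsto_atTop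
  -- Escape to infinity is separation from the centre `0` of the profile with index `0`.
  have hy : ∀ j : Fin k, Tendsto (fun n => ‖y j.succ n‖) atTop atTop := fun j => by
    simpa [hy0] using hsys.2 j.succ 0 (Fin.succ_ne_zero j)
  have hr := tendsto_remainder_of_vanishing hvan hVa (by linarith) hp6 hlam hCσ hDerσ hDσ
  obtain ⟨C', hC'⟩ := IsProfileSystem.exists_norm_remainder_le hCσ w y Finset.univ
  refine ⟨σ, hσ, k, fun j => w j.succ, fun j => y j.succ, fun j => ⟨hw j,
    isLimitSolution_of_weakTo hVa hp3 hp6 hCσ hDerσ hDσ (hy j) (hsys.1 j.succ)⟩, hy, ?_, ?_, ?_⟩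
  · refine hr.congr fun n => ?_
    rw [remainder, Fin.sum_univ_succ, hw0, hy0, Pi.zero_apply, translate_zero]
  · have h := (hsys.tendsto_splitting hCσ isSplitting_integral_sq Finset.univ).add
      (tendsto_integral_sq_zero hr)
    rw [Fin.sum_univ_succ, hw0, add_zero] at h
    exact h.congr fun n => sub_add_cancel _ _
  -- The part `I_λ` splits over all profiles, including `u₀`. The potential term sees only the weak
  -- limit, and joins `I_λ(u₀)` to form `J_{V,λ}(u₀)`.
  · have h := ((hsys.tendsto_splitting hCσ (isSplitting_energyILam hp3 hp6 lam)
      Finset.univ).add (tendsto_energyILam_zero (lam := lam) (by linarith) hp6 hvan hC' hr)).add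
      ((hVa.tendsto_integral_sq (hu.comp hσ) hCσ).const_mul (1 / 2))
    rw [Fin.sum_univ_succ, hw0, add_zero] at h
    simp only [energyJLam_eq]
    convert h using 2
    · rw [sub_add_cancel]
    · ring
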